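/- Let $(\mathfrak g,p)$ be one of $(E_6,5)$, $(E_7,5)$, $(E_7,7)$, $(E_8,7)$, let $k$ be an algebraically closed field of characteristic $p$, and let $\mathfrak g$ be the simple Lie algebra over $k$ of the given type, with simple coroots $h_i$ and root vectors $e_\alpha$ of a Chevalley basis (up to signs), in the Bourbaki numbering of the simple roots $\alpha_i$. Define a nilpotent element $e$ (regular in a Levi subalgebra of type $A_{p-1}$) and toral elements $H$, $H_0$ by | $(\mathfrak g,p)$ | $e$ | $H$ | $H_0$ | |---|---|---|---| | $(E_6,5)$, $(E_7,5)$ | $e_{\alpha_1}+e_{\alpha_2}+e_{\alpha_3}+e_{\alpha_4}$ | $3h_1+3h_2+2h_3+2h_4$ | $2h_1+3h_2+4h_3+h_4$ | | $(E_7,7)$ | $e_{\alpha_1}+e_{\alpha_3}+e_{\alpha_4}+e_{\alpha_5}+e_{\alpha_6}+e_{\alpha_7}$ | $4h_1+2h_3+h_4+h_5+2h_6+4h_7$ | $6h_1+5h_3+4h_4+3h_5+2h_6+h_7$ | | $(E_8,7)$ | $e_{\alpha_2}+e_{\alpha_4}+e_{\alpha_5}+e_{\alpha_6}+e_{\alpha_7}+e_{\alpha_8}$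 | $4h_2+2h_4+h_5+h_6+2h_7+4h_8$ | $6h_2+5h_4+4h_5+3h_6+2h_7+h_8$ | Let $W_1=\mathrm{Der}_k\,k[X]/(X^p)$ be the first Witt algebra, with basis $X^i\partial$, $0\le i\le p-1$. For $0\le r\le p-1$ let $Z^+(r)$ be the $W_1$-module with basis $m_0,\dots,m_{p-1}$ and action $X^{i+1}\partial\cdot m_j=(j+i+1+(i+1)r)\,m_{j+i}$ ($-1\le i\le p-2$, $m_j=0$ for $j\notin\{0,\dots,p-1\}$), and let $L(r)$ be its unique simple quotient; thus $L(0)=k$ is trivial, $\dim L(p-1)=p-1$ and $\dim L(r)=p$ otherwise. Let $W\subseteq\mathfrak g$ be a $p$-subalgebra with an isomorphism $W_1\cong W$, and let $\lambda\in\mathbb F_p$. Suppose that, up to an automorphism of $\mathfrak g$, the element $\partial$ is represented in $W$ by $e$ and $X\partial$ is represented by $H+\lambda H_0$. Then the composition factors, with multiplicities, of the restriction $\mathfrak g|W$ of the adjoint module are: | $(\mathfrak g,p)$ | $\lambda$ | composition factors of $\mathfrak g\vert W$ | |---|---|---| | $(E_6,5)$ | $0$ | $L(1)^5,L(2)^3,L(3)^5,L(4)^2,k^5$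 | | | $1,4$ | $L(1),L(2)^5,L(3),L(4)^8,k^{11}$ | | | $2,3$ | $L(1)^4,L(2),L(3)^4,L(4)^6,k^9$ | | $(E_7,7)$ | $0$ | $L(1),L(2)^3,L(3)^5,L(4)^3,L(5),L(6)^6,k^6$ | | | $1,6$ | $L(1)^2,L(2)^3,L(3)^3,L(4)^3,L(5)^2,L(6)^6,k^6$ | | | $2,5$ | $L(1)^4,L(2)^2,L(3)^3,L(4)^2,L(5)^4,L(6)^4,k^4$ | | | $3,4$ | $L(1)^3,L(2)^3,L(3),L(4)^3,L(5)^3,L(6)^6,k^6$ | | $(E_7,5)$ | $0$ | $L(1)^7,L(2)^9,L(3)^7,L(4)^2,k^{10}$ | | | $1,4$ | $L(1),L(2)^7,L(3),L(4)^{16},k^{24}$ | | | $2,3$ | $L(1)^8,L(2),L(3)^8,L(4)^8,k^{16}$ | | $(E_8,7)$ | $0$ | $L(1)^5,L(2)^3,L(3)^{13},L(4)^3,L(5)^5,L(6)^6,k^9$ | | | $1,6$ | $L(1)^4,L(2)^5,L(3)^7,L(4)^5,L(5)^4,L(6)^{10},k^{13}$ | | | $2,5$ | $L(1)^8,L(2)^4,L(3)^3,L(4)^4,L(5)^8,L(6)^8,k^{11}$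 | | | $3,4$ | $L(1)^3,L(2)^7,L(3),L(4)^7,L(5)^3,L(6)^{14},k^{17}$ | -/

import Mathlib

open Polynomial

noncomputable section

/-! ### The first Witt algebra and its simple restricted modules -/

/-- The truncated polynomial ring `k[X]/(X^p)`. -/
abbrev TruncPoly (k : Type*) [Field k] (p : ℕ) : Type _ :=
  k[X] ⧸ Ideal.span ({(X : k[X]) ^ p} : Set k[X])

/-- The first Witt algebra `W₁`: the Lie algebra of `k`-derivations of `k[X]/(X^p)`
(with the commutator bracket). -/
abbrev Witt (k : Type*) [Field k] (p : ℕ) : Type _ :=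
  Derivation k (TruncPoly k p) (TruncPoly k p)

namespace Witt

variable (k : Type*) [Field k] (p : ℕ)

/-- The class of `X` in `k[X]/(X^p)`. -/
def x : TruncPoly k p := Ideal.Quotient.mkₐ k _ X

theorem ext_x {D E : Witt k p} (h : D (x k p) = E (x k p)) : D = E := by
  have key : ∀ f : k[X], D (Ideal.Quotient.mkₐ k _ f) = E (Ideal.Quotient.mkₐ k _ f) := by
    intro f
    induction f using Polynomial.induction_on' with
    | add f g hf hg => simp only [map_add, hf, hg]
    | monomial n a =>
      have : (Ideal.Quotient.mkₐ k (Ideal.span ({(X : k[X]) ^ p} : Set k[X])) (monomial n a))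
          = a • (x k p) ^ n := by
        rw [← Polynomial.smul_X_eq_monomial, map_smul, map_pow]; rfl
      rw [this, Derivation.map_smul, Derivation.map_smul, Derivation.leibniz_pow, Derivation.leibniz_pow, h]
  ext f
  obtain ⟨f, rfl⟩ := Ideal.Quotient.mkₐ_surjective k _ f
  exact key f

variable [CharP k p]

/-- The derivation `∂ = d/dX` of `k[X]/(X^p)`; it is well defined because `k` has
characteristic `p`. -/
def del : Witt k p :=
  Derivation.liftOfSurjective
    (f := Ideal.Quotient.mkₐ k (Ideal.span ({(X : k[X]) ^ p} : Set k[X])))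
    (Ideal.Quotient.mkₐ_surjective k _) (d := Polynomial.derivative') (by
      intro f hf
      rw [Ideal.Quotient.mkₐ_eq_mk, Ideal.Quotient.eq_zero_iff_mem,
        Ideal.mem_span_singleton] at hf ⊢
      obtain ⟨g, rfl⟩ := hf
      refine ⟨derivative g, ?_⟩
      simp [Polynomial.derivative'])

/-- The element `X ∂` of `W₁`. -/
def xdel : Witt k p := x k p • del k p

theorem del_x : del k p (x k p) = 1 := by
  rw [del, x, Derivation.liftOfSurjective_apply]
  simp [Polynomial.derivative']

theorem eq_smul_del (D : Witt k p) : D = D (x k p) • del k p := by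
  apply ext_x
  simp [del_x]

theorem div_bracket (D E : Witt k p) :
    del k p (⁅D, E⁆ (x k p)) = D (del k p (E (x k p))) - E (del k p (D (x k p))) := by
  have hD : ∀ g, D g = D (x k p) * del k p g := fun g => by
    conv_lhs => rw [eq_smul_del k p D]
    simp
  have hE : ∀ g, E g = E (x k p) * del k p g := fun g => by
    conv_lhs => rw [eq_smul_del k p E]
    simp
  rw [Derivation.commutator_apply, hD (E (x k p)), hE (D (x k p)),
    hD (del k p (E (x k p))), hE (del k p (D (x k p)))]
  simp only [map_sub, Derivation.leibniz, smul_eq_mul]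
  ring

end Witt

/-- The underlying space of the Verma module `Z⁺(r)` of `W₁`: the truncated polynomial ring, with
basis `m_j = X ^ j`, `0 ≤ j ≤ p - 1`. -/
def Verma (k : Type*) [Field k] (p : ℕ) (_r : ℕ) : Type _ := TruncPoly k p

namespace Verma

variable (k : Type*) [Field k] (p r : ℕ)

instance : AddCommGroup (Verma k p r) := inferInstanceAs (AddCommGroup (TruncPoly k p))

instance : Module k (Verma k p r) := inferInstanceAs (Module k (TruncPoly k p))

variable [CharP k p]

/-- A vector field `D = f ∂` acts on `g` by `f g' + (r + 1) f' g`; thus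
`X^{i+1} ∂ · m_j = (j + i + 1 + (i + 1) r) m_{j+i}` where `m_j = X ^ j`. -/
def act (D : Witt k p) (g : TruncPoly k p) : TruncPoly k p :=
  D g + ((r : TruncPoly k p) + 1) * (Witt.del k p (D (Witt.x k p)) * g)

theorem act_add_left (D E : Witt k p) (g : TruncPoly k p) :
    act k p r (D + E) g = act k p r D g + act k p r E g := by
  simp only [act, Derivation.add_apply, map_add]; ring

theorem act_add_right (D : Witt k p) (g h : TruncPoly k p) :
    act k p r D (g + h) = act k p r D g + act k p r D h := by
  simp only [act, map_add]; ring

theorem act_leibniz (D E : Witt k p) (g : TruncPoly k p) :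
    act k p r D (act k p r E g) = act k p r ⁅D, E⁆ g + act k p r E (act k p r D g) := by
  simp only [act, Witt.div_bracket]
  simp only [Derivation.commutator_apply, map_add, Derivation.leibniz,
    smul_eq_mul, Derivation.map_natCast, Derivation.map_one_eq_zero]
  ring

theorem act_smul_left (c : k) (D : Witt k p) (g : TruncPoly k p) :
    act k p r (c • D) g = c • act k p r D g := by
  simp only [act, Derivation.smul_apply, Derivation.map_smul, smul_mul_assoc, mul_smul_comm,
    smul_add]

theorem act_smul_right (c : k) (D : Witt k p) (g : TruncPoly k p) :
    act k p r D (c • g) = c • act k p r D g := by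
  simp only [act, Derivation.map_smul, mul_smul_comm, smul_add]

instance : LieRingModule (Witt k p) (Verma k p r) where
  bracket D g := act k p r D g
  add_lie D E g := act_add_left k p r D E g
  lie_add D g h := act_add_right k p r D g h
  leibniz_lie D E g := act_leibniz k p r D E g

instance : LieModule k (Witt k p) (Verma k p r) where
  smul_lie c D g := act_smul_left k p r c D g
  lie_smul c D g := act_smul_right k p r c D g

/-- The sum of all proper submodules, which is the unique maximal submodule of `Z⁺(r)`. -/
def maxSub : LieSubmodule k (Witt k p) (Verma k p r) :=
  sSup {N | N ≠ ⊤}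

end Verma

/-- The simple quotient `L(r)` of the Verma module `Z⁺(r)`, for `0 ≤ r ≤ p - 1`. -/
abbrev SimpleWittModule (k : Type*) [Field k] (p r : ℕ) [CharP k p] : Type _ :=
  Verma k p r ⧸ Verma.maxSub k p r

/-! ### Simply laced Lie algebras -/

/-- An even positive definite symmetric matrix with all diagonal entries equal to `2`
(a positive definite simply laced Cartan matrix is of this kind). -/
class EvenPosDef {n : ℕ} (A : Matrix (Fin n) (Fin n) ℤ) : Prop where
  symm : ∀ i j, A i j = A j i
  diag : ∀ i, A i i = 2
  pos : ∀ v : Fin n → ℤ, v ≠ 0 → 0 < ∑ i, ∑ j, v i * A i j * v j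

namespace SimplyLaced

variable {n : ℕ} (A : Matrix (Fin n) (Fin n) ℤ)

/-- The bilinear form on the root lattice `ℤⁿ` (with basis the simple roots). -/
def form (v w : Fin n → ℤ) : ℤ := ∑ i, ∑ j, v i * A i j * w j

/-- The roots: the vectors of norm `2` in the root lattice. -/
abbrev Root : Type := {v : Fin n → ℤ // form A v v = 2}

/-- A bilinear form `η` on the root lattice with `η(v, w) + η(w, v) ≡ (v, w)` and
`η(v, v) ≡ (v, v) / 2` modulo `2`. -/
def eta (v w : Fin n → ℤ) : ℤ :=
  ∑ i, v i * w i + ∑ i, ∑ j, if j < i then v i * A i j * w j else 0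

/-- The sign `ε(v, w) = (-1) ^ η(v, w)`. -/
def sgn (v w : Fin n → ℤ) : ℤ := ((eta A v w).negOnePow : ℤ)

theorem form_add_left (u v w : Fin n → ℤ) : form A (u + v) w = form A u w + form A v w := by
  simp only [form, Pi.add_apply, add_mul, Finset.sum_add_distrib]

theorem form_add_right (u v w : Fin n → ℤ) : form A u (v + w) = form A u v + form A u w := by
  simp only [form, Pi.add_apply, mul_add, Finset.sum_add_distrib]

theorem form_neg_right (u v : Fin n → ℤ) : form A u (-v) = -form A u v := by
  simp only [form, Pi.neg_apply, mul_neg, Finset.sum_neg_distrib]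

theorem form_neg_left (u v : Fin n → ℤ) : form A (-u) v = -form A u v := by
  simp only [form, Pi.neg_apply, neg_mul, Finset.sum_neg_distrib]

theorem form_single (i j : Fin n) : form A (Pi.single i 1) (Pi.single j 1) = A i j := by
  simp [form, Pi.single_apply]

theorem form_eq_sum_left (v w : Fin n → ℤ) :
    form A v w = ∑ i, v i * form A (Pi.single i 1) w := by
  simp only [form]
  refine Finset.sum_congr rfl fun i _ => ?_
  simp [Pi.single_apply, Finset.mul_sum, mul_assoc]

theorem eta_add_left (u v w : Fin n → ℤ) : eta A (u + v) w = eta A u w + eta A v w := by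
  simp only [eta, Pi.add_apply, add_mul]
  have : ∀ i j : Fin n, (if j < i then u i * A i j * w j + v i * A i j * w j else 0)
      = (if j < i then u i * A i j * w j else 0) + (if j < i then v i * A i j * w j else 0) := by
    intro i j; split <;> simp
  simp only [this, Finset.sum_add_distrib]
  ring

theorem eta_add_right (u v w : Fin n → ℤ) : eta A u (v + w) = eta A u v + eta A u w := by
  simp only [eta, Pi.add_apply, mul_add]
  have : ∀ i j : Fin n, (if j < i then u i * A i j * v j + u i * A i j * w j else 0)
      = (if j < i then u i * A i j * v j else 0) + (if j < i then u i * A i j * w j else 0) := by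
    intro i j; split <;> simp
  simp only [this, Finset.sum_add_distrib]
  ring

theorem eta_neg_right (u v : Fin n → ℤ) : eta A u (-v) = -eta A u v := by
  have h := eta_add_right A u v (-v)
  have h0 : eta A u 0 = 0 := by simp [eta]
  rw [add_neg_cancel, h0] at h
  linarith

theorem sgn_add_left (u v w : Fin n → ℤ) : sgn A (u + v) w = sgn A u w * sgn A v w := by
  simp [sgn, eta_add_left, Int.negOnePow_add]

theorem sgn_add_right (u v w : Fin n → ℤ) : sgn A u (v + w) = sgn A u v * sgn A u w := by
  simp [sgn, eta_add_right, Int.negOnePow_add]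

theorem sgn_neg_right (u v : Fin n → ℤ) : sgn A u (-v) = sgn A u v := by
  simp [sgn, eta_neg_right]

theorem sgn_mul_self (u v : Fin n → ℤ) : sgn A u v * sgn A u v = 1 := by
  simp only [sgn]
  rw [← Units.val_mul, Int.units_mul_self, Units.val_one]

section

variable [EvenPosDef A]

theorem form_comm (v w : Fin n → ℤ) : form A v w = form A w v := by
  simp only [form]
  rw [Finset.sum_comm]
  refine Finset.sum_congr rfl fun i _ => Finset.sum_congr rfl fun j _ => ?_
  rw [EvenPosDef.symm (A := A) j i]; ring

theorem eta_add_eta (v w : Fin n → ℤ) : eta A v w + eta A w v = form A v w := by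
  have h2 : ∑ i : Fin n, ∑ j : Fin n, (if j < i then w i * A i j * v j else 0)
      = ∑ i : Fin n, ∑ j : Fin n, (if i < j then v i * A i j * w j else 0) := by
    rw [Finset.sum_comm]
    refine Finset.sum_congr rfl fun i _ => Finset.sum_congr rfl fun j _ => ?_
    rw [EvenPosDef.symm (A := A) j i]
    split <;> ring
  have h1 : ∀ i j : Fin n, v i * A i j * w j = (if j < i then v i * A i j * w j else 0)
      + (if i < j then v i * A i j * w j else 0) + (if i = j then 2 * (v i * w i) else 0) := by
    intro i j
    rcases lt_trichotomy i j with h | h | h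
    · simp [h, h.not_gt, h.ne]
    · subst h; simp [EvenPosDef.diag (A := A)]; ring
    · simp [h, h.not_gt, h.ne']
  simp only [eta, form, h2]
  rw [Finset.sum_congr rfl fun i _ => Finset.sum_congr rfl fun j _ => h1 i j]
  simp only [Finset.sum_add_distrib, Finset.sum_ite_eq, Finset.mem_univ, if_true,
    ← Finset.mul_sum, mul_comm (w _) (v _)]
  ring

theorem eq_zero_of_form (v : Fin n → ℤ) (h : form A v v ≤ 0) : v = 0 := by
  by_contra hv
  exact absurd (EvenPosDef.pos (A := A) v hv) (not_lt.mpr h)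

theorem form_nonneg (v : Fin n → ℤ) : 0 ≤ form A v v := by
  by_cases hv : v = 0
  · subst hv; simp [form]
  · exact (EvenPosDef.pos (A := A) v hv).le

theorem form_root_add (α β : Root A) :
    form A (α.1 + β.1) (α.1 + β.1) = 4 + 2 * form A α.1 β.1 := by
  rw [form_add_left, form_add_right, form_add_right, α.2, β.2, form_comm A β.1 α.1]; ring

theorem neg_two_le (α β : Root A) : -2 ≤ form A α.1 β.1 := by
  have := form_nonneg A (α.1 + β.1)
  rw [form_root_add] at this; linarith

theorem le_two (α β : Root A) : form A α.1 β.1 ≤ 2 := by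
  have := form_nonneg A (α.1 + -β.1)
  rw [form_add_left, form_add_right, form_add_right, form_neg_left, form_neg_left,
    form_neg_right, form_neg_right, α.2, β.2, form_comm A β.1 α.1] at this
  linarith

theorem add_eq_zero_iff (α β : Root A) : α.1 + β.1 = 0 ↔ form A α.1 β.1 = -2 := by
  constructor
  · intro h
    have := form_root_add A α β
    rw [h] at this
    simp [form] at this
    simp only [form]; linarith
  · intro h
    apply eq_zero_of_form A
    rw [form_root_add, h]; norm_num

theorem add_root_iff (α β : Root A) :
    form A (α.1 + β.1) (α.1 + β.1) = 2 ↔ form A α.1 β.1 = -1 := by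
  rw [form_root_add]; constructor <;> intro h <;> linarith

theorem eq_of_form_eq_two (α β : Root A) (h : form A α.1 β.1 = 2) : α = β := by
  have : α.1 + -β.1 = 0 := by
    apply eq_zero_of_form A
    rw [form_add_left, form_add_right, form_add_right, form_neg_left, form_neg_left,
      form_neg_right, form_neg_right, α.2, β.2, form_comm A β.1 α.1, h]
    norm_num
  exact Subtype.ext (by simpa [← sub_eq_add_neg, sub_eq_zero] using this)

theorem eta_root (α : Root A) : eta A α.1 α.1 = 1 := by
  have := eta_add_eta A α.1 α.1
  rw [α.2] at this; linarith

theorem sgn_root (α : Root A) : sgn A α.1 α.1 = -1 := by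
  simp [sgn, eta_root]

theorem sgn_mul_swap (v w : Fin n → ℤ) :
    sgn A v w * sgn A w v = ((form A v w).negOnePow : ℤ) := by
  rw [← eta_add_eta, Int.negOnePow_add]; rfl

theorem sgn_swap (v w : Fin n → ℤ) :
    sgn A w v = ((form A v w).negOnePow : ℤ) * sgn A v w := by
  rw [← sgn_mul_swap, mul_right_comm, sgn_mul_self, one_mul]

end

end SimplyLaced

/-- The simply laced Lie algebra over `k` with Cartan matrix `A`, as a vector space: it has a
basis consisting of the `h_i` (simple coroots) and the root vectors `e_α`. -/
def SimplyLacedLie {n : ℕ} (A : Matrix (Fin n) (Fin n) ℤ) (k : Type*) [Field k] : Type _ :=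
  (Fin n ⊕ SimplyLaced.Root A) →₀ k

namespace SimplyLacedLie

open SimplyLaced

variable {n : ℕ} (A : Matrix (Fin n) (Fin n) ℤ) (k : Type*) [Field k]

instance : AddCommGroup (SimplyLacedLie A k) :=
  inferInstanceAs (AddCommGroup ((Fin n ⊕ Root A) →₀ k))

instance : Module k (SimplyLacedLie A k) :=
  inferInstanceAs (Module k ((Fin n ⊕ Root A) →₀ k))

/-- The standard basis: `basisVec (inl i) = h_i` and `basisVec (inr α) = e_α`. -/
def basisVec : Module.Basis (Fin n ⊕ Root A) k (SimplyLacedLie A k) :=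
  Module.Basis.ofRepr (LinearEquiv.refl k ((Fin n ⊕ Root A) →₀ k))

/-- The element `∑ v_i h_i` of the torus; for a root `v` this is the coroot `h_v`. -/
def torusElt (v : Fin n → ℤ) : SimplyLacedLie A k := ∑ i, (v i : k) • basisVec A k (Sum.inl i)

/-- The root vector `e_v` if `v` is a root, and `0` otherwise. -/
def rootVec (v : Fin n → ℤ) : SimplyLacedLie A k :=
  if h : form A v v = 2 then basisVec A k (Sum.inr ⟨v, h⟩) else 0

/-- The bracket on basis vectors: `[h_i, h_j] = 0`, `[h_i, e_α] = (α_i, α) e_α`,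
`[e_α, e_{-α}] = ε(α, -α) h_α`, and `[e_α, e_β] = ε(α, β) e_{α+β}` for `α + β ≠ 0`, where
`e_{α+β} = 0` if `α + β` is not a root. -/
def basisBracket : (Fin n ⊕ Root A) → (Fin n ⊕ Root A) → SimplyLacedLie A k
  | Sum.inl _, Sum.inl _ => 0
  | Sum.inl i, Sum.inr β => (form A (Pi.single i 1) β.1 : k) • basisVec A k (Sum.inr β)
  | Sum.inr α, Sum.inl j => -((form A (Pi.single j 1) α.1 : k) • basisVec A k (Sum.inr α))
  | Sum.inr α, Sum.inr β =>
      (sgn A α.1 β.1 : k) •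
        (if α.1 + β.1 = 0 then torusElt A k α.1 else rootVec A k (α.1 + β.1))

/-- The bilinear extension of `basisBracket`. -/
def bracketMap : SimplyLacedLie A k →ₗ[k] SimplyLacedLie A k →ₗ[k] SimplyLacedLie A k :=
  (basisVec A k).constr k fun a => (basisVec A k).constr k fun b => basisBracket A k a b

theorem bracketMap_basis (a b : Fin n ⊕ Root A) :
    bracketMap A k (basisVec A k a) (basisVec A k b) = basisBracket A k a b := by
  simp [bracketMap]

theorem basis_induction {P : SimplyLacedLie A k → Prop} (hb : ∀ b, P (basisVec A k b))
    (hzero : P 0)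
    (hadd : ∀ x y, P x → P y → P (x + y)) (hsmul : ∀ (c : k) x, P x → P (c • x))
    (x : SimplyLacedLie A k) : P x := by
  have hx : x ∈ Submodule.span k (Set.range (basisVec A k)) := by
    rw [(basisVec A k).span_eq]; trivial
  induction hx using Submodule.span_induction with
  | mem y hy => obtain ⟨b, rfl⟩ := hy; exact hb b
  | zero => exact hzero
  | add y z _ _ hy hz => exact hadd y z hy hz
  | smul c y _ hy => exact hsmul c y hy

theorem torusElt_neg (v : Fin n → ℤ) : torusElt A k (-v) = -torusElt A k v := by
  simp [torusElt, Finset.sum_neg_distrib]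

theorem torusElt_add (v w : Fin n → ℤ) : torusElt A k (v + w) = torusElt A k v + torusElt A k w := by
  simp [torusElt, add_smul, Finset.sum_add_distrib]

theorem bracketMap_hh (i j : Fin n) :
    bracketMap A k (basisVec A k (Sum.inl i)) (basisVec A k (Sum.inl j)) = 0 := by
  rw [bracketMap_basis]; rfl

theorem bracketMap_he (i : Fin n) (β : Root A) :
    bracketMap A k (basisVec A k (Sum.inl i)) (basisVec A k (Sum.inr β)) =
      (form A (Pi.single i 1) β.1 : k) • basisVec A k (Sum.inr β) := by
  rw [bracketMap_basis]; rfl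

theorem bracketMap_eh (i : Fin n) (β : Root A) :
    bracketMap A k (basisVec A k (Sum.inr β)) (basisVec A k (Sum.inl i)) =
      -((form A (Pi.single i 1) β.1 : k) • basisVec A k (Sum.inr β)) := by
  rw [bracketMap_basis]; rfl

theorem bracketMap_ee (α β : Root A) :
    bracketMap A k (basisVec A k (Sum.inr α)) (basisVec A k (Sum.inr β)) =
      (sgn A α.1 β.1 : k) •
        (if α.1 + β.1 = 0 then torusElt A k α.1 else rootVec A k (α.1 + β.1)) := by
  rw [bracketMap_basis]; rfl

theorem bracketMap_h_torusElt (i : Fin n) (v : Fin n → ℤ) :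
    bracketMap A k (basisVec A k (Sum.inl i)) (torusElt A k v) = 0 := by
  simp [torusElt, bracketMap_hh]

theorem bracketMap_e_torusElt (v : Fin n → ℤ) (β : Root A) :
    bracketMap A k (basisVec A k (Sum.inr β)) (torusElt A k v) =
      -((form A v β.1 : k) • basisVec A k (Sum.inr β)) := by
  rw [form_eq_sum_left]
  simp [torusElt, bracketMap_eh, Finset.sum_smul, mul_smul, Finset.sum_neg_distrib]

/-- The cyclic sum that vanishes by the Jacobi identity. -/
def cyc (x y z : SimplyLacedLie A k) : SimplyLacedLie A k :=
  bracketMap A k x (bracketMap A k y z) + bracketMap A k y (bracketMap A k z x) +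
    bracketMap A k z (bracketMap A k x y)

theorem cyc_rot (x y z : SimplyLacedLie A k) : cyc A k y z x = cyc A k x y z := by
  simp only [cyc]; abel

theorem cyc_hhe (i j : Fin n) (β : Root A) : cyc A k (basisVec A k (Sum.inl i))
    (basisVec A k (Sum.inl j)) (basisVec A k (Sum.inr β)) = 0 := by
  simp only [cyc, bracketMap_hh, bracketMap_eh, bracketMap_he, map_neg, map_smul, map_zero]
  module

theorem cyc_hhh (i j l : Fin n) : cyc A k (basisVec A k (Sum.inl i))
    (basisVec A k (Sum.inl j)) (basisVec A k (Sum.inl l)) = 0 := by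
  simp only [cyc, bracketMap_hh, map_zero, add_zero]

section

variable [EvenPosDef A]

theorem bracketMap_ee_opp (α β : Root A) (h : form A α.1 β.1 = -2) :
    bracketMap A k (basisVec A k (Sum.inr α)) (basisVec A k (Sum.inr β)) =
      -torusElt A k α.1 := by
  have h0 := (add_eq_zero_iff A α β).2 h
  have hβ : β.1 = -α.1 := by rw [eq_neg_iff_add_eq_zero, add_comm]; exact h0
  rw [bracketMap_ee, if_pos h0, hβ, sgn_neg_right, sgn_root]
  simp

theorem bracketMap_ee_root (α β : Root A) (h : form A α.1 β.1 = -1) :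
    bracketMap A k (basisVec A k (Sum.inr α)) (basisVec A k (Sum.inr β)) =
      (sgn A α.1 β.1 : k) • basisVec A k (Sum.inr ⟨α.1 + β.1, (add_root_iff A α β).2 h⟩) := by
  have h0 : ¬ α.1 + β.1 = 0 := by rw [add_eq_zero_iff, h]; norm_num
  rw [bracketMap_ee, if_neg h0, rootVec, dif_pos ((add_root_iff A α β).2 h)]

theorem bracketMap_ee_zero (α β : Root A) (h : -1 < form A α.1 β.1) :
    bracketMap A k (basisVec A k (Sum.inr α)) (basisVec A k (Sum.inr β)) = 0 := by
  have h0 : ¬ α.1 + β.1 = 0 := by rw [add_eq_zero_iff]; omega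
  have h1 : ¬ form A (α.1 + β.1) (α.1 + β.1) = 2 := by rw [add_root_iff]; omega
  rw [bracketMap_ee, if_neg h0, rootVec, dif_neg h1, smul_zero]

theorem bracketMap_h_ee (i : Fin n) (α β : Root A) :
    bracketMap A k (basisVec A k (Sum.inl i))
      (bracketMap A k (basisVec A k (Sum.inr α)) (basisVec A k (Sum.inr β))) =
    (form A (Pi.single i 1) (α.1 + β.1) : k) •
      bracketMap A k (basisVec A k (Sum.inr α)) (basisVec A k (Sum.inr β)) := by
  rcases lt_trichotomy (form A α.1 β.1) (-1) with h | h | h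
  · have h2 : form A α.1 β.1 = -2 := by have := neg_two_le A α β; omega
    have h0 := (add_eq_zero_iff A α β).2 h2
    rw [bracketMap_ee_opp A k α β h2, h0, map_neg, bracketMap_h_torusElt]
    simp [form]
  · rw [bracketMap_ee_root A k α β h, map_smul, bracketMap_he, smul_comm]
  · rw [bracketMap_ee_zero A k α β h]; simp

theorem bracketMap_basis_swap (a b : Fin n ⊕ Root A) :
    bracketMap A k (basisVec A k a) (basisVec A k b) =
      -bracketMap A k (basisVec A k b) (basisVec A k a) := by
  rcases a with i | α <;> rcases b with j | β
  · simp [bracketMap_hh]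
  · rw [bracketMap_he, bracketMap_eh, neg_neg]
  · rw [bracketMap_he, bracketMap_eh]
  · have hc := form_comm A α.1 β.1
    rcases lt_trichotomy (form A α.1 β.1) (-1) with h | h | h
    · have h2 : form A α.1 β.1 = -2 := by have := neg_two_le A α β; omega
      have h0 := (add_eq_zero_iff A α β).2 h2
      have hβ : β.1 = -α.1 := by rw [eq_neg_iff_add_eq_zero, add_comm]; exact h0
      rw [bracketMap_ee_opp A k α β h2, bracketMap_ee_opp A k β α (hc ▸ h2), hβ, torusElt_neg,
        neg_neg]
    · rw [bracketMap_ee_root A k α β h, bracketMap_ee_root A k β α (hc ▸ h),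
        sgn_swap A α.1 β.1]
      have hm : ((form A α.1 β.1).negOnePow : ℤ) = -1 := by rw [h]; simp
      rw [hm]
      simp [add_comm β.1 α.1]
    · rw [bracketMap_ee_zero A k α β h, bracketMap_ee_zero A k β α (hc ▸ h), neg_zero]

theorem bracketMap_swap (x y : SimplyLacedLie A k) :
    bracketMap A k x y = -bracketMap A k y x := by
  induction x using basis_induction with
  | hb a =>
    induction y using basis_induction with
    | hb b => exact bracketMap_basis_swap A k a b
    | hzero => simp
    | hadd y z hy hz => simp only [map_add, LinearMap.add_apply, hy, hz, neg_add]
    | hsmul c y hy => simp only [map_smul, LinearMap.smul_apply, hy, smul_neg]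
  | hzero => simp
  | hadd x z hx hz => simp only [map_add, LinearMap.add_apply, hx, hz, neg_add]
  | hsmul c x hx => simp only [map_smul, LinearMap.smul_apply, hx, smul_neg]

theorem bracketMap_self (x : SimplyLacedLie A k) : bracketMap A k x x = 0 := by
  induction x using basis_induction with
  | hb a =>
    rcases a with i | α
    · exact bracketMap_hh A k i i
    · exact bracketMap_ee_zero A k α α (by rw [α.2]; norm_num)
  | hzero => simp
  | hadd x y hx hy =>
    simp only [map_add, LinearMap.add_apply, hx, hy]
    rw [bracketMap_swap A k x y]; simp
  | hsmul c x hx => simp [hx]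

theorem cyc_hee (i : Fin n) (α β : Root A) : cyc A k (basisVec A k (Sum.inl i))
    (basisVec A k (Sum.inr α)) (basisVec A k (Sum.inr β)) = 0 := by
  simp only [cyc, bracketMap_h_ee, bracketMap_eh, bracketMap_he, map_neg, map_smul]
  rw [bracketMap_swap A k (basisVec A k (Sum.inr β)) (basisVec A k (Sum.inr α)), form_add_right]
  push_cast
  module

theorem cyc_eee_opp (α β γ : Root A) (h : form A β.1 γ.1 = -2) :
    cyc A k (basisVec A k (Sum.inr α)) (basisVec A k (Sum.inr β))
      (basisVec A k (Sum.inr γ)) = 0 := by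
  have h0 := (add_eq_zero_iff A β γ).2 h
  have hγ : γ.1 = -β.1 := by rw [eq_neg_iff_add_eq_zero, add_comm]; exact h0
  have hγα : form A γ.1 α.1 = -form A α.1 β.1 := by rw [hγ, form_neg_left, form_comm]
  have hβα := form_comm A α.1 β.1
  have hγβ := form_comm A β.1 γ.1
  rw [cyc, bracketMap_ee_opp A k β γ h, map_neg, bracketMap_e_torusElt, ← hβα]
  have l1 := neg_two_le A α β
  have l2 := le_two A α β
  obtain ha | ha | ha | ha | ha : form A α.1 β.1 = -2 ∨ form A α.1 β.1 = -1 ∨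
    form A α.1 β.1 = 0 ∨ form A α.1 β.1 = 1 ∨ form A α.1 β.1 = 2 := by omega
  · have hαγ : γ = α := eq_of_form_eq_two A γ α (by rw [hγα, ha]; norm_num)
    subst hαγ
    rw [bracketMap_ee_zero A k γ γ (by rw [γ.2]; norm_num), map_zero,
      bracketMap_ee_opp A k γ β ha, map_neg, bracketMap_e_torusElt, γ.2, ha]
    simp
  · have hs : form A γ.1 (α.1 + β.1) = -1 := by
      rw [form_add_right, hγα, ha, ← hγβ, h]; norm_num
    rw [bracketMap_ee_zero A k γ α (by rw [hγα, ha]; norm_num), map_zero,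
      bracketMap_ee_root A k α β ha, map_smul,
      bracketMap_ee_root A k γ ⟨α.1 + β.1, (add_root_iff A α β).2 ha⟩ hs]
    have e1 : (⟨γ.1 + (α.1 + β.1), (add_root_iff A γ
        ⟨α.1 + β.1, (add_root_iff A α β).2 ha⟩).2 hs⟩ : Root A) = α :=
      Subtype.ext (by simp [hγ])
    have e2 : sgn A α.1 β.1 * sgn A γ.1 (α.1 + β.1) = 1 := by
      have k1 := sgn_swap A γ.1 α.1
      have k2 := sgn_swap A γ.1 β.1
      rw [hγα, ha] at k1
      rw [← hγβ, h] at k2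
      have k3 : sgn A α.1 γ.1 = sgn A α.1 β.1 := by rw [hγ, sgn_neg_right]
      have k4 : sgn A β.1 γ.1 = -1 := by rw [hγ, sgn_neg_right, sgn_root]
      have k5 := sgn_mul_self A α.1 β.1
      simp only [neg_neg, Int.negOnePow_neg, Int.negOnePow_one, Units.val_neg, Units.val_one,
        Int.negOnePow_even 2 even_two, one_mul, neg_mul] at k1 k2
      rw [sgn_add_right, ← k2, k4]
      rw [k3] at k1
      rw [k1] at k5 ⊢
      linarith
    rw [e1, smul_smul, ← Int.cast_mul, e2, ha]
    simp
  · rw [bracketMap_ee_zero A k γ α (by rw [hγα, ha]; norm_num),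
      bracketMap_ee_zero A k α β (by rw [ha]; norm_num), ha]
    simp
  · have hs : form A β.1 (γ.1 + α.1) = -1 := by
      rw [form_add_right, h, ← hβα, ha]; norm_num
    have ha' : form A γ.1 α.1 = -1 := by rw [hγα, ha]
    rw [bracketMap_ee_zero A k α β (by rw [ha]; norm_num), map_zero,
      bracketMap_ee_root A k γ α ha', map_smul,
      bracketMap_ee_root A k β ⟨γ.1 + α.1, (add_root_iff A γ α).2 ha'⟩ hs]
    have e1 : (⟨β.1 + (γ.1 + α.1), (add_root_iff A β
        ⟨γ.1 + α.1, (add_root_iff A γ α).2 ha'⟩).2 hs⟩ : Root A) = α :=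
      Subtype.ext (by simp [hγ])
    have e2 : sgn A γ.1 α.1 * sgn A β.1 (γ.1 + α.1) = -1 := by
      have k1 := sgn_swap A α.1 γ.1
      have k2 := sgn_swap A α.1 β.1
      rw [form_comm, ha'] at k1
      rw [ha] at k2
      have k3 : sgn A α.1 γ.1 = sgn A α.1 β.1 := by rw [hγ, sgn_neg_right]
      have k4 : sgn A β.1 γ.1 = -1 := by rw [hγ, sgn_neg_right, sgn_root]
      have k5 := sgn_mul_self A α.1 β.1
      simp at k1 k2
      rw [sgn_add_right, k1, k2, k3, k4]
      linarith
    rw [e1, smul_smul, ← Int.cast_mul, e2, ha]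
    simp
  · have hαβ : α = β := eq_of_form_eq_two A α β ha
    subst hαβ
    rw [bracketMap_ee_zero A k α α (by rw [α.2]; norm_num), map_zero,
      bracketMap_ee_opp A k γ α (by rw [hγα, ha]), map_neg, bracketMap_e_torusElt, α.2, hγα, ha]
    simp

theorem inner_root (α β γ : Root A) (hb : form A β.1 γ.1 ≠ -2)
    (hs0 : α.1 + β.1 + γ.1 ≠ 0) :
    bracketMap A k (basisVec A k (Sum.inr α))
      (bracketMap A k (basisVec A k (Sum.inr β)) (basisVec A k (Sum.inr γ))) =
    ((if form A β.1 γ.1 = -1 ∧ form A α.1 β.1 + form A α.1 γ.1 = -1 then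
      sgn A β.1 γ.1 * (sgn A α.1 β.1 * sgn A α.1 γ.1) else 0 : ℤ) : k) •
        rootVec A k (α.1 + β.1 + γ.1) := by
  have hl := neg_two_le A β γ
  by_cases h1 : form A β.1 γ.1 = -1
  · rw [bracketMap_ee_root A k β γ h1, map_smul, bracketMap_ee, if_neg (by rwa [← add_assoc])]
    simp only [h1, true_and]
    have hr := add_root_iff A α ⟨β.1 + γ.1, (add_root_iff A β γ).2 h1⟩
    simp only [form_add_right A α.1] at hr
    split_ifs with h2
    · rw [smul_smul, ← Int.cast_mul, sgn_add_right, add_assoc]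
    · rw [rootVec, dif_neg (fun h => h2 (hr.1 h))]
      simp
  · rw [bracketMap_ee_zero A k β γ (by omega)]
    simp [h1]

theorem cyc_eee (α β γ : Root A) : cyc A k (basisVec A k (Sum.inr α))
    (basisVec A k (Sum.inr β)) (basisVec A k (Sum.inr γ)) = 0 := by
  by_cases hb : form A β.1 γ.1 = -2
  · exact cyc_eee_opp A k α β γ hb
  by_cases hc : form A γ.1 α.1 = -2
  · rw [← cyc_rot]; exact cyc_eee_opp A k β γ α hc
  by_cases ha : form A α.1 β.1 = -2
  · rw [← cyc_rot, ← cyc_rot]; exact cyc_eee_opp A k γ α β ha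
  have cab := form_comm A α.1 β.1
  have cbc := form_comm A β.1 γ.1
  have cca := form_comm A γ.1 α.1
  have la := neg_two_le A α β
  have lb := neg_two_le A β γ
  have lc := neg_two_le A γ α
  by_cases hs : α.1 + β.1 + γ.1 = 0
  · have f1 : ∀ w : Fin n → ℤ, form A w α.1 + form A w β.1 + form A w γ.1 = 0 := by
      intro w; rw [← form_add_right, ← form_add_right, hs]; simp [form]
    have f2 := f1 α.1
    have f3 := f1 β.1
    have f4 := f1 γ.1
    rw [α.2] at f2
    rw [β.2] at f3
    rw [γ.2] at f4
    have ha1 : form A α.1 β.1 = -1 := by omega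
    have hb1 : form A β.1 γ.1 = -1 := by omega
    have hc1 : form A γ.1 α.1 = -1 := by omega
    have t : ∀ (α β γ : Root A) (h : form A β.1 γ.1 = -1), α.1 + β.1 + γ.1 = 0 →
        bracketMap A k (basisVec A k (Sum.inr α))
          (bracketMap A k (basisVec A k (Sum.inr β)) (basisVec A k (Sum.inr γ))) =
        -(((sgn A β.1 γ.1 : ℤ) : k) • torusElt A k α.1) := by
      intro α β γ h h0
      have hβ : β.1 + γ.1 = -α.1 := by
        rw [eq_neg_iff_add_eq_zero, ← h0]; abel
      rw [bracketMap_ee_root A k β γ h, map_smul, bracketMap_ee_opp]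
      · rw [smul_neg]
      · simp only [hβ]; rw [form_neg_right, α.2]
    rw [cyc, t α β γ hb1 hs, t β γ α hc1 (by rw [← hs]; abel), t γ α β ha1 (by rw [← hs]; abel)]
    have hγ : γ.1 = -(α.1 + β.1) := by rw [eq_neg_iff_add_eq_zero, ← hs]; abel
    have k1 : sgn A β.1 γ.1 = sgn A α.1 β.1 := by
      rw [hγ, sgn_neg_right, sgn_add_right, sgn_root, sgn_swap A α.1 β.1, ha1]; simp
    have k2 : sgn A γ.1 α.1 = sgn A α.1 β.1 := by
      rw [sgn_swap A α.1 γ.1, ← cca, hc1, hγ, sgn_neg_right, sgn_add_right, sgn_root]; simp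
    rw [k1, k2, ← neg_add, ← neg_add, ← smul_add, ← smul_add, ← torusElt_add, ← torusElt_add, hs]
    simp [torusElt]
  have s2 : β.1 + γ.1 + α.1 ≠ 0 := fun h => hs (by rw [← h]; abel)
  have s3 : γ.1 + α.1 + β.1 ≠ 0 := fun h => hs (by rw [← h]; abel)
  rw [cyc, inner_root A k α β γ hb hs, inner_root A k β γ α hc s2, inner_root A k γ α β ha s3,
    show β.1 + γ.1 + α.1 = α.1 + β.1 + γ.1 by abel,
    show γ.1 + α.1 + β.1 = α.1 + β.1 + γ.1 by abel, ← add_smul, ← add_smul,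
    ← Int.cast_add, ← Int.cast_add]
  convert zero_smul k _
  rw [← Int.cast_zero]
  have k1 := sgn_swap A α.1 β.1
  have k2 := sgn_swap A β.1 γ.1
  have k3 := sgn_swap A α.1 γ.1
  by_cases h2 : form A α.1 β.1 + form A β.1 γ.1 + form A γ.1 α.1 = -2
  · obtain ⟨u, v, w⟩ | ⟨u, v, w⟩ | ⟨u, v, w⟩ :
      (form A α.1 β.1 = 0 ∧ form A β.1 γ.1 = -1 ∧ form A γ.1 α.1 = -1) ∨
      (form A α.1 β.1 = -1 ∧ form A β.1 γ.1 = 0 ∧ form A γ.1 α.1 = -1) ∨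
      (form A α.1 β.1 = -1 ∧ form A β.1 γ.1 = -1 ∧ form A γ.1 α.1 = 0) := by omega
    all_goals
      rw [← cca, w] at k3
      rw [u] at k1
      rw [v] at k2
      rw [← cab, ← cbc, ← cca, u, v, w, k1, k2, k3]
      simp
      try ring
  · rw [if_neg (by omega), if_neg (by omega), if_neg (by omega)]; simp

theorem bracketMap_cyc (x y z : SimplyLacedLie A k) : cyc A k x y z = 0 := by
  have hadd : ∀ x x' y z, cyc A k (x + x') y z = cyc A k x y z + cyc A k x' y z := by
    intro x x' y z; simp only [cyc, map_add, LinearMap.add_apply]; abel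
  have hsmul : ∀ (c : k) x y z, cyc A k (c • x) y z = c • cyc A k x y z := by
    intro c x y z; simp only [cyc, map_smul, LinearMap.smul_apply, smul_add]
  have hzero : ∀ y z, cyc A k 0 y z = 0 := by
    intro y z; simp [cyc]
  have hbasis : ∀ a b c : Fin n ⊕ Root A,
      cyc A k (basisVec A k a) (basisVec A k b) (basisVec A k c) = 0 := by
    rintro (i | α) (j | β) (l | γ)
    · exact cyc_hhh A k i j l
    · exact cyc_hhe A k i j γ
    · rw [← cyc_rot, ← cyc_rot]; exact cyc_hhe A k l i β
    · exact cyc_hee A k i β γ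
    · rw [← cyc_rot]; exact cyc_hhe A k j l α
    · rw [← cyc_rot]; exact cyc_hee A k j γ α
    · rw [← cyc_rot, ← cyc_rot]; exact cyc_hee A k l α β
    · exact cyc_eee A k α β γ
  induction x using basis_induction with
  | hb a =>
    rw [← cyc_rot]
    induction y using basis_induction with
    | hb b =>
      rw [← cyc_rot]
      induction z using basis_induction with
      | hb c => rw [← cyc_rot]; exact hbasis a b c
      | hzero => exact hzero _ _
      | hadd z z' h h' => rw [hadd, h, h', add_zero]
      | hsmul c z h => rw [hsmul, h, smul_zero]
    | hzero => exact hzero _ _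
    | hadd z z' h h' => rw [hadd, h, h', add_zero]
    | hsmul c z h => rw [hsmul, h, smul_zero]
  | hzero => exact hzero _ _
  | hadd z z' h h' => rw [hadd, h, h', add_zero]
  | hsmul c z h => rw [hsmul, h, smul_zero]

instance : LieRing (SimplyLacedLie A k) where
  bracket x y := bracketMap A k x y
  add_lie x y z := by
    change bracketMap A k (x + y) z = bracketMap A k x z + bracketMap A k y z
    rw [map_add, LinearMap.add_apply]
  lie_add x y z := map_add (bracketMap A k x) y z
  lie_self x := bracketMap_self A k x
  leibniz_lie x y z := by
    change bracketMap A k x (bracketMap A k y z) =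
      bracketMap A k (bracketMap A k x y) z + bracketMap A k y (bracketMap A k x z)
    have h := bracketMap_cyc A k x y z
    rw [cyc, bracketMap_swap A k z x, bracketMap_swap A k z, map_neg, add_neg_eq_zero,
      ← sub_eq_add_neg, sub_eq_iff_eq_add] at h
    exact h

instance : LieAlgebra k (SimplyLacedLie A k) where
  lie_smul c x y := map_smul (bracketMap A k x) c y

end

end SimplyLacedLie

/-! ### Positive definiteness of the Cartan matrices of type `E` -/

instance : EvenPosDef CartanMatrix.E₆ where
  symm i j := CartanMatrix.E₆_isSymm.apply j i
  diag := CartanMatrix.E₆_diag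
  pos v hv := by
    by_contra h
    apply hv
    have key : 6 * (∑ i, ∑ j, v i * CartanMatrix.E₆ i j * v j) =
        3 * (2 * v 0 + (-1) * v 2) ^ 2 +
        1 * (3 * v 2 + (-2) * v 3) ^ 2 +
        3 * (2 * v 1 + (-1) * v 3) ^ 2 +
        3 * ((-1) * v 4 + 2 * v 5) ^ 2 +
        1 * ((-2) * v 3 + 3 * v 4) ^ 2 +
        1 * (1 * v 3) ^ 2 := by
      simp [Fin.sum_univ_succ, CartanMatrix.E₆]
      ring
    have p0 := sq_nonneg (2 * v 0 + (-1) * v 2)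
    have p1 := sq_nonneg (3 * v 2 + (-2) * v 3)
    have p2 := sq_nonneg (2 * v 1 + (-1) * v 3)
    have p3 := sq_nonneg ((-1) * v 4 + 2 * v 5)
    have p4 := sq_nonneg ((-2) * v 3 + 3 * v 4)
    have p5 := sq_nonneg (1 * v 3)
    have z0 : 2 * v 0 + (-1) * v 2 = 0 := pow_eq_zero_iff two_ne_zero |>.1 (by linarith)
    have z1 : 3 * v 2 + (-2) * v 3 = 0 := pow_eq_zero_iff two_ne_zero |>.1 (by linarith)
    have z2 : 2 * v 1 + (-1) * v 3 = 0 := pow_eq_zero_iff two_ne_zero |>.1 (by linarith)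
    have z3 : (-1) * v 4 + 2 * v 5 = 0 := pow_eq_zero_iff two_ne_zero |>.1 (by linarith)
    have z4 : (-2) * v 3 + 3 * v 4 = 0 := pow_eq_zero_iff two_ne_zero |>.1 (by linarith)
    have z5 : 1 * v 3 = 0 := pow_eq_zero_iff two_ne_zero |>.1 (by linarith)
    funext i
    fin_cases i <;> simp <;> omega

instance : EvenPosDef CartanMatrix.E₇ where
  symm i j := CartanMatrix.E₇_isSymm.apply j i
  diag := CartanMatrix.E₇_diag
  pos v hv := by
    by_contra h
    apply hv
    have key : 12 * (∑ i, ∑ j, v i * CartanMatrix.E₇ i j * v j) =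
        6 * (2 * v 0 + (-1) * v 2) ^ 2 +
        2 * (3 * v 2 + (-2) * v 3) ^ 2 +
        6 * (2 * v 1 + (-1) * v 3) ^ 2 +
        6 * ((-1) * v 5 + 2 * v 6) ^ 2 +
        2 * ((-2) * v 4 + 3 * v 5) ^ 2 +
        1 * ((-3) * v 3 + 4 * v 4) ^ 2 +
        1 * (1 * v 3) ^ 2 := by
      simp [Fin.sum_univ_succ, CartanMatrix.E₇]
      ring
    have p0 := sq_nonneg (2 * v 0 + (-1) * v 2)
    have p1 := sq_nonneg (3 * v 2 + (-2) * v 3)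
    have p2 := sq_nonneg (2 * v 1 + (-1) * v 3)
    have p3 := sq_nonneg ((-1) * v 5 + 2 * v 6)
    have p4 := sq_nonneg ((-2) * v 4 + 3 * v 5)
    have p5 := sq_nonneg ((-3) * v 3 + 4 * v 4)
    have p6 := sq_nonneg (1 * v 3)
    have z0 : 2 * v 0 + (-1) * v 2 = 0 := pow_eq_zero_iff two_ne_zero |>.1 (by linarith)
    have z1 : 3 * v 2 + (-2) * v 3 = 0 := pow_eq_zero_iff two_ne_zero |>.1 (by linarith)
    have z2 : 2 * v 1 + (-1) * v 3 = 0 := pow_eq_zero_iff two_ne_zero |>.1 (by linarith)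
    have z3 : (-1) * v 5 + 2 * v 6 = 0 := pow_eq_zero_iff two_ne_zero |>.1 (by linarith)
    have z4 : (-2) * v 4 + 3 * v 5 = 0 := pow_eq_zero_iff two_ne_zero |>.1 (by linarith)
    have z5 : (-3) * v 3 + 4 * v 4 = 0 := pow_eq_zero_iff two_ne_zero |>.1 (by linarith)
    have z6 : 1 * v 3 = 0 := pow_eq_zero_iff two_ne_zero |>.1 (by linarith)
    funext i
    fin_cases i <;> simp <;> omega

instance : EvenPosDef CartanMatrix.E₈ where
  symm i j := CartanMatrix.E₈_isSymm.apply j i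
  diag := CartanMatrix.E₈_diag
  pos v hv := by
    by_contra h
    apply hv
    have key : 60 * (∑ i, ∑ j, v i * CartanMatrix.E₈ i j * v j) =
        30 * (2 * v 0 + (-1) * v 2) ^ 2 +
        10 * (3 * v 2 + (-2) * v 3) ^ 2 +
        30 * (2 * v 1 + (-1) * v 3) ^ 2 +
        30 * ((-1) * v 6 + 2 * v 7) ^ 2 +
        10 * ((-2) * v 5 + 3 * v 6) ^ 2 +
        5 * ((-3) * v 4 + 4 * v 5) ^ 2 +
        3 * ((-4) * v 3 + 5 * v 4) ^ 2 +
        2 * (1 * v 3) ^ 2 := by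
      simp [Fin.sum_univ_succ, CartanMatrix.E₈]
      ring
    have p0 := sq_nonneg (2 * v 0 + (-1) * v 2)
    have p1 := sq_nonneg (3 * v 2 + (-2) * v 3)
    have p2 := sq_nonneg (2 * v 1 + (-1) * v 3)
    have p3 := sq_nonneg ((-1) * v 6 + 2 * v 7)
    have p4 := sq_nonneg ((-2) * v 5 + 3 * v 6)
    have p5 := sq_nonneg ((-3) * v 4 + 4 * v 5)
    have p6 := sq_nonneg ((-4) * v 3 + 5 * v 4)
    have p7 := sq_nonneg (1 * v 3)
    have z0 : 2 * v 0 + (-1) * v 2 = 0 := pow_eq_zero_iff two_ne_zero |>.1 (by linarith)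
    have z1 : 3 * v 2 + (-2) * v 3 = 0 := pow_eq_zero_iff two_ne_zero |>.1 (by linarith)
    have z2 : 2 * v 1 + (-1) * v 3 = 0 := pow_eq_zero_iff two_ne_zero |>.1 (by linarith)
    have z3 : (-1) * v 6 + 2 * v 7 = 0 := pow_eq_zero_iff two_ne_zero |>.1 (by linarith)
    have z4 : (-2) * v 5 + 3 * v 6 = 0 := pow_eq_zero_iff two_ne_zero |>.1 (by linarith)
    have z5 : (-3) * v 4 + 4 * v 5 = 0 := pow_eq_zero_iff two_ne_zero |>.1 (by linarith)
    have z6 : (-4) * v 3 + 5 * v 4 = 0 := pow_eq_zero_iff two_ne_zero |>.1 (by linarith)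
    have z7 : 1 * v 3 = 0 := pow_eq_zero_iff two_ne_zero |>.1 (by linarith)
    funext i
    fin_cases i <;> simp <;> omega

/-! ### `p`-subalgebras and composition factors -/

/-- A subalgebra `W` of the Lie algebra `L` is a `p`-subalgebra if it is closed under the `p`-map
of `L`. Here `L` is a restricted Lie algebra with trivial centre, so that `x^[p]` is the unique
element `y` with `ad y = (ad x)^p`. -/
def IsPSubalgebra (p : ℕ) {k L : Type*} [Field k] [LieRing L] [LieAlgebra k L]
    (W : LieSubalgebra k L) : Prop :=
  ∀ x ∈ W, ∃ y ∈ W, LieAlgebra.ad k L y = LieAlgebra.ad k L x ^ p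

section

variable {p : ℕ} {k L : Type*} [Field k] [CharP k p] [LieRing L] [LieAlgebra k L]
  {W : LieSubalgebra k L}

/-- The subquotient `N' / N` of the `W`-module `L` is isomorphic to `L(r)`, where `W` is
identified with `W₁` by means of `φ`. -/
def FactorIso (φ : Witt k p ≃ₗ⁅k⁆ W) (N N' : LieSubmodule k W L) (r : ℕ) : Prop :=
  ∃ f : (N' ⧸ LieSubmodule.comap N'.incl N) ≃ₗ[k] SimpleWittModule k p r,
    ∀ (D : Witt k p) (x : N' ⧸ LieSubmodule.comap N'.incl N), f ⁅φ D, x⁆ = ⁅D, f x⁆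

/-- The composition factors of the restriction of the adjoint module `L` to `W ≅ W₁` are
the `L(r)`, each with multiplicity `m r`, `0 ≤ r ≤ p - 1`: there is a composition series, and in
every composition series the factors are the `L(r)` with these multiplicities. -/
def HasCompositionFactors (φ : Witt k p ≃ₗ⁅k⁆ W) (m : ℕ → ℕ) : Prop :=
  (∃ s : RelSeries {(N, N') : LieSubmodule k W L × LieSubmodule k W L | N ⋖ N'},
    s.head = ⊥ ∧ s.last = ⊤) ∧
  ∀ s : RelSeries {(N, N') : LieSubmodule k W L × LieSubmodule k W L | N ⋖ N'},
    s.head = ⊥ → s.last = ⊤ →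
    ∃ r : Fin s.length → Fin p,
      (∀ i, FactorIso φ (s i.castSucc) (s i.succ) (r i)) ∧
      ∀ j : Fin p, (Finset.univ.filter fun i => r i = j).card = m j

end

/-! ### The four cases -/

/-- The cases `(𝔤, p, 𝒪) = (E₆, 5, A₄), (E₇, 5, A₄), (E₇, 7, A₆), (E₈, 7, A₆)`. -/
inductive TypeACase
  | E6A4
  | E7A4
  | E7A6
  | E8A6

namespace TypeACase

/-- The characteristic. -/
def p : TypeACase → ℕ
  | E6A4 => 5
  | E7A4 => 5
  | E7A6 => 7
  | E8A6 => 7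

/-- The rank of `𝔤`. -/
def rank : TypeACase → ℕ
  | E6A4 => 6
  | E7A4 => 7
  | E7A6 => 7
  | E8A6 => 8

/-- The Cartan matrix of `𝔤` (Bourbaki numbering). -/
def cartan : (c : TypeACase) → Matrix (Fin c.rank) (Fin c.rank) ℤ
  | E6A4 => CartanMatrix.E₆
  | E7A4 => CartanMatrix.E₇
  | E7A6 => CartanMatrix.E₇
  | E8A6 => CartanMatrix.E₈

instance : (c : TypeACase) → EvenPosDef c.cartan
  | E6A4 => inferInstanceAs (EvenPosDef CartanMatrix.E₆)
  | E7A4 => inferInstanceAs (EvenPosDef CartanMatrix.E₇)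
  | E7A6 => inferInstanceAs (EvenPosDef CartanMatrix.E₇)
  | E8A6 => inferInstanceAs (EvenPosDef CartanMatrix.E₈)

/-- The exceptional Lie algebra `𝔤` over `k`. -/
abbrev lie (c : TypeACase) (k : Type*) [Field k] : Type _ := SimplyLacedLie c.cartan k

/-- Coefficients at the simple root vectors `e_{α_1}, e_{α_2}, …` of the regular nilpotent element
of the standard Levi subalgebra of type `A_{p-1}`. -/
def eCoeff : (c : TypeACase) → Fin c.rank → ℕ
  | E6A4 => ![1, 1, 1, 1, 0, 0]
  | E7A4 => ![1, 1, 1, 1, 0, 0, 0]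
  | E7A6 => ![1, 0, 1, 1, 1, 1, 1]
  | E8A6 => ![0, 1, 0, 1, 1, 1, 1, 1]

/-- Coefficients of `H` with respect to `h_1, h_2, …`. -/
def HCoeff : (c : TypeACase) → Fin c.rank → ℤ
  | E6A4 => ![3, 3, 2, 2, 0, 0]
  | E7A4 => ![3, 3, 2, 2, 0, 0, 0]
  | E7A6 => ![4, 0, 2, 1, 1, 2, 4]
  | E8A6 => ![0, 4, 0, 2, 1, 1, 2, 4]

/-- Coefficients of `H₀` with respect to `h_1, h_2, …`. -/
def H0Coeff : (c : TypeACase) → Fin c.rank → ℤ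
  | E6A4 => ![2, 3, 4, 1, 0, 0]
  | E7A4 => ![2, 3, 4, 1, 0, 0, 0]
  | E7A6 => ![6, 0, 5, 4, 3, 2, 1]
  | E8A6 => ![0, 6, 0, 5, 4, 3, 2, 1]

/-- The nilpotent element `e` of type `A_{p-1}`: the sum of the simple root vectors of the standard
Levi subalgebra of type `A_{p-1}`. -/
def e (c : TypeACase) (k : Type*) [Field k] : c.lie k :=
  ∑ i, (c.eCoeff i : k) • SimplyLacedLie.rootVec c.cartan k (Pi.single i 1)

/-- The toral element `H`. -/
def H (c : TypeACase) (k : Type*) [Field k] : c.lie k :=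
  SimplyLacedLie.torusElt c.cartan k c.HCoeff

/-- The toral element `H₀`. -/
def H0 (c : TypeACase) (k : Type*) [Field k] : c.lie k :=
  SimplyLacedLie.torusElt c.cartan k c.H0Coeff

/-- The table of composition factors: the row number `l = 0, …, p - 1` lists the multiplicities of
`L(0) = k, L(1), …, L(p-1)` in the case `X ∂ = H + l H₀`. -/
def table : TypeACase → List (List ℕ)
  | E6A4 =>
    [[5, 5, 3, 5, 2],
     [11, 1, 5, 1, 8],
     [9, 4, 1, 4, 6],
     [9, 4, 1, 4, 6],
     [11, 1, 5, 1, 8]]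
  | E7A4 =>
    [[10, 7, 9, 7, 2],
     [24, 1, 7, 1, 16],
     [16, 8, 1, 8, 8],
     [16, 8, 1, 8, 8],
     [24, 1, 7, 1, 16]]
  | E7A6 =>
    [[6, 1, 3, 5, 3, 1, 6],
     [6, 2, 3, 3, 3, 2, 6],
     [4, 4, 2, 3, 2, 4, 4],
     [6, 3, 3, 1, 3, 3, 6],
     [6, 3, 3, 1, 3, 3, 6],
     [4, 4, 2, 3, 2, 4, 4],
     [6, 2, 3, 3, 3, 2, 6]]
  | E8A6 =>
    [[9, 5, 3, 13, 3, 5, 6],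
     [13, 4, 5, 7, 5, 4, 10],
     [11, 8, 4, 3, 4, 8, 8],
     [17, 3, 7, 1, 7, 3, 14],
     [17, 3, 7, 1, 7, 3, 14],
     [11, 8, 4, 3, 4, 8, 8],
     [13, 4, 5, 7, 5, 4, 10]]

/-- The multiplicity of `L(r)` in the row `l` of the table. -/
def mult (c : TypeACase) (l r : ℕ) : ℕ := (c.table.getD l []).getD r 0

end TypeACase

end

/-! Since `W` is a `p`-subalgebra and `W₁` has trivial centre, `φ` respects `p`-maps
(`Witt.ad_pow_of_isPSubalgebra`), so every composition factor of `𝔤|W` is an irreducible restricted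
`W₁`-module. Such a module contains a common null vector of all `x ^ a ∂` with `a ≥ 2` that is an
eigenvector of `X ∂` with eigenvalue `r` in the prime field. It is therefore a quotient of `Z⁺(r)`,
that is, `L(r)` (`Witt.exists_equiv_simple`).

The multiplicities are read off from the two operators `d = ad φ(∂)` and `h = ad φ(X ∂)`
(`hasCompositionFactors_of_finrank`). On `L(r)` the monomial `x ^ j` has weight `j + 1 + r`. For `0
< s < p - 1`, the only `L(r)` with a vector of weight `s + 1` killed by `∂` is `L(s)`, where this
vector is unique up to scalars and equals `∂ ^ (p - 1)` of a vector of weight `s`. Along a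
composition series the dimension of `ker d` on weight `s + 1` is subadditive, while the rank of `d ^
(p - 1)` on weight `s` is superadditive; the image of the latter lies in the former because `d ^ p =
0`. Hence the multiplicity of `L(s)` is squeezed to the dimension of that kernel. The multiplicities
of `L(0)` and `L(p - 1)` follow from weights `0` and `1`: weight `0` occurs once in each `L(r)`
except `L(p - 1)`, weight `1` once in each except `L(0)`, and weight dimensions are additive because
`h ^ p = h`.

These dimensions are invariant under automorphisms, so they may be computed for `e` and `H + λ H₀`.
The latter is diagonal in the Chevalley basis, which turns weight dimensions into root counts. The
centralizer of `e` in a weight space is bounded from above by an explicit elimination in the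
equations `[e, x] = 0` (`finrank_ker_inf_rootSpan_le`). It is bounded from below by rank-nullity
(`le_finrank_ker_inf_rootSpan`): `ad e` lowers the weight by `1` and raises by `2` the degree given
by the sum of the positive coroots of the Levi subalgebra. The two bounds agree in every case. The
remaining finite checks run over an explicit list of positive roots, whose completeness is proved by
descent on the height (`exists_digits_of_nonneg`). -/

noncomputable section

/-! ### Truncated polynomials, the basis `x ^ a ∂` of `W₁` and its `p`-map. -/

namespace Witt

variable (k : Type*) [Field k] (p : ℕ)

theorem x_pow_eq_zero {m : ℕ} (h : p ≤ m) : x k p ^ m = 0 := by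
  have : x k p ^ p = 0 := by
    rw [x, ← map_pow, Ideal.Quotient.mkₐ_eq_mk, Ideal.Quotient.eq_zero_iff_mem]
    exact Ideal.mem_span_singleton_self _
  rw [← Nat.sub_add_cancel h, pow_add, this, mul_zero]

/-- The monomial basis `1, x, …, x ^ (p - 1)` of `k[X]/(X^p)`. -/
def powBasis : Module.Basis (Fin p) k (TruncPoly k p) :=
  (AdjoinRoot.powerBasis' (Polynomial.monic_X_pow (R := k) p)).basis.reindex
    (finCongr (by simp))

theorem powBasis_apply (j : Fin p) : powBasis k p j = x k p ^ (j : ℕ) := by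
  have h : ∀ e : Fin (AdjoinRoot.powerBasis' (Polynomial.monic_X_pow (R := k) p)).dim ≃ Fin p,
      ((e.symm j : ℕ) = j) →
      ((AdjoinRoot.powerBasis' (Polynomial.monic_X_pow (R := k) p)).basis.reindex e) j =
        AdjoinRoot.root (X ^ p : k[X]) ^ (j : ℕ) := by
    intro e he
    rw [Module.Basis.reindex_apply, PowerBasis.basis_eq_pow, he]
    rfl
  exact h _ rfl

instance : FiniteDimensional k (TruncPoly k p) := Module.Finite.of_basis (powBasis k p)

theorem trunc_induction {P : TruncPoly k p → Prop} (hx : ∀ j < p, P (x k p ^ j)) (h0 : P 0)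
    (hadd : ∀ f g, P f → P g → P (f + g)) (hsmul : ∀ (c : k) f, P f → P (c • f))
    (f : TruncPoly k p) : P f := by
  have hf : f ∈ Submodule.span k (Set.range (powBasis k p)) := by
    rw [(powBasis k p).span_eq]; trivial
  induction hf using Submodule.span_induction with
  | mem y hy =>
    obtain ⟨j, rfl⟩ := hy
    rw [powBasis_apply]; exact hx j j.2
  | zero => exact h0
  | add y z _ _ hy hz => exact hadd y z hy hz
  | smul c y _ hy => exact hsmul c y hy

/-- The coefficient of `x ^ j`. -/
def coeff (j : ℕ) : TruncPoly k p →ₗ[k] k :=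
  if h : j < p then (powBasis k p).coord ⟨j, h⟩ else 0

theorem coeff_x_pow (i j : ℕ) (hj : j < p) : coeff k p i (x k p ^ j) = if i = j then 1 else 0 := by
  have hb : x k p ^ j = powBasis k p ⟨j, hj⟩ := (powBasis_apply k p ⟨j, hj⟩).symm
  rw [coeff]
  split_ifs with h1 h2 h2
  · subst h2; rw [hb]; simp
  · rw [hb, Module.Basis.coord_apply, Module.Basis.repr_self, Finsupp.single_apply, if_neg]
    simpa [Fin.ext_iff] using Ne.symm h2
  · omega
  · rfl

theorem coeff_of_le {j : ℕ} (h : p ≤ j) : coeff k p j = 0 := dif_neg (by omega)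

theorem eq_sum_coeff (f : TruncPoly k p) :
    f = ∑ j ∈ Finset.range p, coeff k p j f • x k p ^ j := by
  conv_lhs => rw [← (powBasis k p).sum_repr f]
  rw [Finset.sum_range]
  refine Finset.sum_congr rfl fun j _ => ?_
  rw [powBasis_apply, coeff, dif_pos j.2]
  rfl

theorem ext_coeff {f g : TruncPoly k p} (h : ∀ j < p, coeff k p j f = coeff k p j g) : f = g := by
  rw [eq_sum_coeff k p f, eq_sum_coeff k p g]
  exact Finset.sum_congr rfl fun j hj => by rw [h j (Finset.mem_range.1 hj)]

variable [CharP k p]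

theorem del_x_pow (j : ℕ) : del k p (x k p ^ j) = (j : k) • x k p ^ (j - 1) := by
  rw [Derivation.leibniz_pow, del_x, smul_eq_mul, mul_one, Nat.cast_smul_eq_nsmul]

theorem coeff_del (j : ℕ) (f : TruncPoly k p) :
    coeff k p j (del k p f) = ((j + 1 : ℕ) : k) * coeff k p (j + 1) f := by
  induction f using trunc_induction with
  | hx i hi =>
    rw [del_x_pow, map_smul, coeff_x_pow k p _ _ hi, coeff_x_pow k p _ _ (by omega), smul_eq_mul]
    rcases i with _ | i
    · simp
    · simp only [Nat.add_sub_cancel, Nat.add_right_cancel_iff]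
      split_ifs with h
      · rw [h]
      · simp
  | h0 => simp
  | hadd f g hf hg => simp only [map_add, hf, hg, mul_add]
  | hsmul c f hf => simp only [Derivation.map_smul, map_smul, hf, smul_eq_mul]; ring

/-- The element `x ^ a ∂` of `W₁`. -/
def xpow (a : ℕ) : Witt k p := x k p ^ a • del k p

theorem xpow_apply (a : ℕ) (f : TruncPoly k p) : xpow k p a f = x k p ^ a * del k p f := rfl

theorem xpow_zero : xpow k p 0 = del k p := by simp [xpow]

theorem xpow_one : xpow k p 1 = xdel k p := by simp [xpow, xdel]

theorem xpow_apply_x (a : ℕ) : xpow k p a (x k p) = x k p ^ a := by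
  rw [xpow_apply, del_x, mul_one]

theorem xpow_eq_zero {a : ℕ} (h : p ≤ a) : xpow k p a = 0 := by
  apply ext_x
  rw [xpow_apply_x, x_pow_eq_zero k p h]
  rfl

theorem xpow_apply_x_pow (a b : ℕ) :
    xpow k p a (x k p ^ b) = (b : k) • x k p ^ (a + b - 1) := by
  rw [xpow_apply, del_x_pow, mul_smul_comm, ← pow_add]
  rcases b with _ | b
  · simp
  · rfl

theorem lie_xpow (a b : ℕ) :
    ⁅xpow k p a, xpow k p b⁆ = ((b : k) - (a : k)) • xpow k p (a + b - 1) := by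
  apply ext_x
  rw [Derivation.commutator_apply, xpow_apply_x, xpow_apply_x, xpow_apply_x_pow, xpow_apply_x_pow,
    Derivation.smul_apply, xpow_apply_x, add_comm b a, sub_smul]

theorem induction {P : Witt k p → Prop} (hx : ∀ a < p, P (xpow k p a)) (h0 : P 0)
    (hadd : ∀ D E, P D → P E → P (D + E)) (hsmul : ∀ (c : k) D, P D → P (c • D))
    (D : Witt k p) : P D := by
  rw [eq_smul_del k p D]
  induction D (x k p) using trunc_induction with
  | hx j hj => exact hx j hj
  | h0 => convert h0; apply ext_x; simp
  | hadd f g hf hg => rw [add_smul]; exact hadd _ _ hf hg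
  | hsmul c f hf => rw [smul_assoc]; exact hsmul _ _ hf

theorem natCast_ne_zero {j : ℕ} (h0 : 0 < j) (hj : j < p) : (j : k) ≠ 0 := by
  rw [Ne, CharP.cast_eq_zero_iff k p]
  exact Nat.not_dvd_of_pos_of_lt h0 hj

theorem natCast_inj {i j : ℕ} (hi : i < p) (hj : j < p) (h : (i : k) = j) : i = j := by
  have := (CharP.natCast_eq_natCast k p).1 h
  rwa [Nat.ModEq, Nat.mod_eq_of_lt hi, Nat.mod_eq_of_lt hj] at this

/-- Each bracket with `x ^ a ∂` shifts the exponent by `a - 1`; the scalar is irrelevant, since only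
the eventual vanishing for `a ≥ 2` is needed. -/
theorem ad_xpow_pow_apply (a : ℕ) (ha : 1 ≤ a) (b m : ℕ) :
    ∃ c : k, ((LieAlgebra.ad k (Witt k p) (xpow k p a)) ^ m) (xpow k p b) =
      c • xpow k p (b + m * (a - 1)) := by
  induction m with
  | zero => exact ⟨1, by simp⟩
  | succ m ih =>
    obtain ⟨c, hc⟩ := ih
    refine ⟨c * (((b + m * (a - 1) : ℕ) : k) - a), ?_⟩
    rw [pow_succ', Module.End.mul_apply, hc, map_smul, LieAlgebra.ad_apply, lie_xpow, smul_smul]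
    congr 2
    obtain ⟨a, rfl⟩ : ∃ a', a = a' + 1 := ⟨a - 1, by omega⟩
    simp only [Nat.add_sub_cancel]
    rw [Nat.add_mul]; omega

theorem ad_del_pow : LieAlgebra.ad k (Witt k p) (del k p) ^ p = 0 := by
  have key : ∀ m b : ℕ, b < m →
      ((LieAlgebra.ad k (Witt k p) (del k p)) ^ m) (xpow k p b) = 0 := by
    intro m
    induction m with
    | zero => intro b hb; omega
    | succ m ih =>
      intro b hb
      rw [pow_succ, Module.End.mul_apply, LieAlgebra.ad_apply]
      nth_rewrite 2 [← xpow_zero]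
      rw [lie_xpow, map_smul]
      rcases b with _ | b
      · simp
      · rw [ih _ (by omega), smul_zero]
  ext1 D
  induction D using induction with
  | hx b hb => rw [key p b hb, LinearMap.zero_apply]
  | h0 => rw [map_zero, map_zero]
  | hadd D E hD hE => rw [map_add, map_add, hD, hE]
  | hsmul c D hD => rw [map_smul, map_smul, hD]

/-- The centre of `W₁` is trivial: the bracket with `∂` determines the derivative of `D x`, and the
bracket with `X ∂` then determines `D x` itself. -/
theorem eq_of_lie_eq {D D' : Witt k p} (h : ∀ E : Witt k p, ⁅D, E⁆ = ⁅D', E⁆) : D = D' := by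
  have h0 : del k p (D (x k p)) = del k p (D' (x k p)) := by
    have := congrArg (fun E : Witt k p => E (x k p)) (h (del k p))
    simpa [Derivation.commutator_apply, del_x] using this
  have h1 := congrArg (fun E : Witt k p => E (x k p)) (h (xdel k p))
  simp only [Derivation.commutator_apply, ← xpow_one, xpow_apply, pow_one, del_x, mul_one, h0,
    sub_left_inj] at h1
  exact ext_x k p h1

theorem ad_xpow_pow {a : ℕ} (ha : 2 ≤ a) : LieAlgebra.ad k (Witt k p) (xpow k p a) ^ p = 0 := by
  ext1 D
  induction D using induction with
  | hx b hb =>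
    obtain ⟨c, hc⟩ := ad_xpow_pow_apply k p a (by omega) b p
    rw [hc, xpow_eq_zero, smul_zero, LinearMap.zero_apply]
    have : p * 1 ≤ p * (a - 1) := Nat.mul_le_mul_left _ (by omega)
    omega
  | h0 => rw [map_zero, map_zero]
  | hadd D E hD hE => rw [map_add, map_add, hD, hE]
  | hsmul c D hD => rw [map_smul, map_smul, hD]

section

variable [Fact p.Prime]

/-- In `coeff_del` the factor `j + 1` is invertible as long as `j + 1 < p`, so every nonconstant
coefficient vanishes. -/
theorem eq_smul_one_of_del_eq_zero {f : TruncPoly k p} (h : del k p f = 0) :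
    f = coeff k p 0 f • 1 := by
  have hp : 0 < p := (Fact.out : p.Prime).pos
  apply ext_coeff
  intro j hj
  rw [map_smul, ← pow_zero (x k p), coeff_x_pow k p _ _ hp]
  rcases j with _ | j
  · simp
  · have h1 := coeff_del k p j f
    rw [h, map_zero, eq_comm, mul_eq_zero] at h1
    rw [h1.resolve_left (natCast_ne_zero k p (by omega) hj)]
    simp

theorem natCast_sub_pow (a b : ℕ) : ((a : k) - (b : k)) ^ p = (a : k) - (b : k) := by
  rw [sub_pow_char, ← frobenius_def, ← frobenius_def, map_natCast, map_natCast]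

theorem ad_xdel_pow :
    LieAlgebra.ad k (Witt k p) (xdel k p) ^ p = LieAlgebra.ad k (Witt k p) (xdel k p) := by
  have h1 : ∀ b : ℕ, LieAlgebra.ad k (Witt k p) (xdel k p) (xpow k p b) =
      ((b : k) - ((1 : ℕ) : k)) • xpow k p b := by
    intro b
    rw [LieAlgebra.ad_apply, ← xpow_one, lie_xpow]
    congr 2
    omega
  have key : ∀ m b : ℕ, (LieAlgebra.ad k (Witt k p) (xdel k p) ^ m) (xpow k p b) =
      ((b : k) - ((1 : ℕ) : k)) ^ m • xpow k p b := by
    intro m b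
    induction m with
    | zero => simp
    | succ m ih => rw [pow_succ', Module.End.mul_apply, ih, map_smul, h1, smul_smul, pow_succ]
  ext1 D
  induction D using induction with
  | hx b hb => rw [key, h1, natCast_sub_pow]
  | h0 => rw [map_zero, map_zero]
  | hadd D E hD hE => rw [map_add, map_add, hD, hE]
  | hsmul c D hD => rw [map_smul, map_smul, hD]

end

end Witt

/-- An isomorphism of `W₁` with a `p`-subalgebra respects the `p`-maps. -/
theorem Witt.ad_pow_of_isPSubalgebra {k : Type*} [Field k] {p : ℕ} [CharP k p] [Fact p.Prime]
    {L : Type*} [LieRing L] [LieAlgebra k L] {W : LieSubalgebra k L}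
    (hW : IsPSubalgebra p W) (φ : Witt k p ≃ₗ⁅k⁆ W) {D E : Witt k p}
    (h : LieAlgebra.ad k (Witt k p) D ^ p = LieAlgebra.ad k (Witt k p) E) :
    LieAlgebra.ad k L (φ D : L) ^ p = LieAlgebra.ad k L (φ E : L) := by
  obtain ⟨y, hy, hyp⟩ := hW (φ D : L) (φ D).2
  have key : ∀ (m : ℕ) (F : Witt k p), (LieAlgebra.ad k L (φ D : L) ^ m) (φ F : L) =
      (φ ((LieAlgebra.ad k (Witt k p) D ^ m) F) : L) := by
    intro m F
    induction m with
    | zero => simp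
    | succ m ih =>
      rw [pow_succ', pow_succ', Module.End.mul_apply, Module.End.mul_apply, ih,
        LieAlgebra.ad_apply, LieAlgebra.ad_apply, LieEquiv.map_lie, LieSubalgebra.coe_bracket]
  -- The element `y` acts on `φ(W₁)` as `(ad φ D) ^ p`, hence as `φ E` does; as `W₁` has trivial
  -- centre, this identifies `y` inside `W`, and then the identity holds on all of `L`.
  have hz : φ.symm ⟨y, hy⟩ = E := by
    apply Witt.eq_of_lie_eq
    intro F
    apply φ.injective
    apply Subtype.ext
    change (φ ⁅φ.symm ⟨y, hy⟩, F⁆ : L) = (φ ⁅E, F⁆ : L)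
    rw [LieEquiv.map_lie, LieEquiv.apply_symm_apply, LieSubalgebra.coe_bracket]
    change ⁅y, (φ F : L)⁆ = _
    rw [← LieAlgebra.ad_apply k, hyp, key, h, LieAlgebra.ad_apply]
  have : φ E = ⟨y, hy⟩ := by rw [← hz, LieEquiv.apply_symm_apply]
  rw [this, hyp]

/-! ### The maximal submodules of the modules `Z⁺(r)`. -/

namespace Verma

open Witt (x del xdel xpow coeff)

variable (k : Type*) [Field k] (p r : ℕ)

/-- The identification of the space of truncated polynomials with the Verma module. -/
def of : TruncPoly k p ≃ₗ[k] Verma k p r := LinearEquiv.refl k _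

variable [CharP k p]

variable {k p r} in
theorem lie_of (D : Witt k p) (g : TruncPoly k p) :
    ⁅D, of k p r g⁆ = of k p r (D g + ((r : k) + 1) • (del k p (D (x k p)) * g)) := by
  have h : ((r : TruncPoly k p) + 1) = algebraMap k (TruncPoly k p) ((r : k) + 1) := by simp
  change act k p r D g = D g + ((r : k) + 1) • (del k p (D (x k p)) * g)
  rw [act, h]
  exact congrArg _ (Algebra.smul_def _ _).symm

variable {k p r} in
theorem add_lie' (D E : Witt k p) (w : Verma k p r) : ⁅D + E, w⁆ = ⁅D, w⁆ + ⁅E, w⁆ :=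
  act_add_left k p r D E w

variable {k p r} in
theorem smul_lie' (c : k) (D : Witt k p) (w : Verma k p r) : ⁅c • D, w⁆ = c • ⁅D, w⁆ :=
  act_smul_left k p r c D w

variable {k p r} in
theorem zero_lie' (w : Verma k p r) : ⁅(0 : Witt k p), w⁆ = 0 := by
  have h := smul_lie' (0 : k) (0 : Witt k p) w
  rwa [zero_smul, zero_smul] at h

variable {k p r} in
theorem lie_lie' (D E : Witt k p) (w : Verma k p r) : ⁅D, ⁅E, w⁆⁆ = ⁅⁅D, E⁆, w⁆ + ⁅E, ⁅D, w⁆⁆ :=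
  act_leibniz k p r D E w

theorem lie_xpow_of (a b : ℕ) : ⁅xpow k p a, of k p r (x k p ^ b)⁆ =
    ((b : k) + (a : k) * ((r : k) + 1)) • of k p r (x k p ^ (a + b - 1)) := by
  rw [lie_of, Witt.xpow_apply_x, Witt.xpow_apply_x_pow, Witt.del_x_pow, ← map_smul,
    smul_mul_assoc, ← pow_add]
  rcases a with _ | a
  · simp
  · rw [show a + 1 - 1 + b = a + 1 + b - 1 by omega]
    congr 1
    module

theorem lie_del_of (g : TruncPoly k p) : ⁅del k p, of k p r g⁆ = of k p r (del k p g) := by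
  rw [lie_of, Witt.del_x]
  simp

theorem lie_xdel_of (b : ℕ) : ⁅xdel k p, of k p r (x k p ^ b)⁆ =
    ((b : k) + 1 + (r : k)) • of k p r (x k p ^ b) := by
  rw [← Witt.xpow_one, lie_xpow_of, show 1 + b - 1 = b by omega]
  congr 1
  push_cast; ring

/-- The least `j` such that `x ^ j` is nonzero in `L(r)`. -/
def lo (p r : ℕ) : ℕ := if r = 0 then p - 1 else if r = p - 1 then 1 else 0

theorem eq_top_of_x_pow_mem {N : LieSubmodule k (Witt k p) (Verma k p r)}
    (h : ∀ j < p, of k p r (x k p ^ j) ∈ N) : N = ⊤ := by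
  rw [eq_top_iff]
  intro v _
  obtain ⟨g, rfl⟩ := (of k p r).surjective v
  induction g using Witt.trunc_induction with
  | hx j hj => exact h j hj
  | h0 => rw [map_zero]; exact N.zero_mem
  | hadd f g hf hg => rw [map_add]; exact N.add_mem (hf trivial) (hg trivial)
  | hsmul c f hf => rw [map_smul]; exact N.smul_mem _ (hf trivial)

theorem natCast_add_one_ne_zero {r : ℕ} (hr : r + 1 < p) : (r : k) + 1 ≠ 0 := by
  exact_mod_cast Witt.natCast_ne_zero k p (j := r + 1) (by omega) hr

variable [Fact p.Prime]

/-- `∂` acts as differentiation, so a nonzero element can be differentiated until its derivative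
vanishes, and it is then a nonzero constant. The induction runs over a degree bound `d`. -/
theorem of_one_mem {N : LieSubmodule k (Witt k p) (Verma k p r)} (hN : N ≠ ⊥) :
    of k p r 1 ∈ N := by
  have key : ∀ d, ∀ g, of k p r g ∈ N → (∀ j, d ≤ j → coeff k p j g = 0) → g ≠ 0 →
      of k p r 1 ∈ N := by
    intro d
    induction d with
    | zero => intro g _ h h0; exact absurd (Witt.ext_coeff k p fun j _ => by simp [h j]) h0
    | succ d ih =>
      intro g hg h h0
      by_cases h1 : del k p g = 0
      · have h2 := Witt.eq_smul_one_of_del_eq_zero k p h1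
        have h3 : coeff k p 0 g ≠ 0 := fun h3 => h0 (by rw [h2, h3, zero_smul])
        rw [h2, map_smul] at hg
        exact (N.toSubmodule.smul_mem_iff h3).1 hg
      · refine ih _ (lie_del_of k p r g ▸ N.lie_mem hg) (fun j hj => ?_) h1
        rw [Witt.coeff_del, h _ (by omega), mul_zero]
  obtain ⟨v, hv, h0⟩ : ∃ v ∈ N, v ≠ 0 := by
    by_contra! h
    exact hN ((LieSubmodule.eq_bot_iff N).2 h)
  obtain ⟨g, rfl⟩ := (of k p r).surjective v
  exact key p g hv (fun j hj => by rw [Witt.coeff_of_le k p hj, LinearMap.zero_apply])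
    fun h => h0 (by rw [h, map_zero])

/-- The same descent as for `of_one_mem`, stopped one step earlier: when the second derivative
vanishes but the first does not, the element is `c x` plus a constant with `c ≠ 0`. -/
theorem of_x_mem {N : LieSubmodule k (Witt k p) (Verma k p r)} {g : TruncPoly k p}
    (hg : of k p r g ∈ N) (h0 : del k p g ≠ 0) : of k p r (x k p) ∈ N := by
  have h1 : of k p r 1 ∈ N := by
    refine of_one_mem k p r fun h => h0 ?_
    rw [h, LieSubmodule.mem_bot, LinearEquiv.map_eq_zero_iff] at hg
    rw [hg, map_zero]
  have key : ∀ d, ∀ g, of k p r g ∈ N → (∀ j, d ≤ j → coeff k p j g = 0) → del k p g ≠ 0 →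
      of k p r (x k p) ∈ N := by
    intro d
    induction d with
    | zero =>
      intro g _ h h0
      refine absurd ?_ h0
      rw [Witt.ext_coeff k p (f := g) (g := 0) fun j _ => by simp [h j], map_zero]
    | succ d ih =>
      intro g hg h h0
      by_cases h2 : del k p (del k p g) = 0
      · have h3 := Witt.eq_smul_one_of_del_eq_zero k p h2
        set c := coeff k p 0 (del k p g)
        have hc : c ≠ 0 := fun h4 => h0 (by rw [h3, h4, zero_smul])
        have h4 : del k p (g - c • x k p) = 0 := by
          rw [map_sub, Derivation.map_smul, Witt.del_x, ← h3, sub_self]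
        have h5 := Witt.eq_smul_one_of_del_eq_zero k p h4
        have h6 : c • x k p = g - coeff k p 0 (g - c • x k p) • 1 := by rw [← h5]; abel
        have h7 : of k p r (c • x k p) ∈ N := by
          rw [h6, map_sub, map_smul]
          exact N.sub_mem hg (N.smul_mem _ h1)
        rw [map_smul] at h7
        exact (N.toSubmodule.smul_mem_iff hc).1 h7
      · refine ih _ (lie_del_of k p r g ▸ N.lie_mem hg) (fun j hj => ?_) h2
        rw [Witt.coeff_del, h _ (by omega), mul_zero]
  exact key p g hg (fun j hj => by rw [Witt.coeff_of_le k p hj, LinearMap.zero_apply]) h0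

/-- One has `x ^ (j + 1) ∂ · 1 = (j + 1)(r + 1) x ^ j`. The top monomial `x ^ (p - 1)` is out of
reach in this way, because `j + 1` is then zero in `k`. -/
theorem of_x_pow_mem {N : LieSubmodule k (Witt k p) (Verma k p r)} (hN : N ≠ ⊥)
    (hr : (r : k) + 1 ≠ 0) {j : ℕ} (hj : j + 1 < p) : of k p r (x k p ^ j) ∈ N := by
  have h1 := N.lie_mem (x := xpow k p (j + 1)) (of_one_mem k p r hN)
  rw [← pow_zero (x k p), lie_xpow_of] at h1
  refine (N.toSubmodule.smul_mem_iff ?_).1 h1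
  rw [Nat.cast_zero, zero_add]
  exact mul_ne_zero (Witt.natCast_ne_zero k p (by omega) hj) hr

theorem mem_maxSub_of_mid (h0 : 0 < r) (h1 : r + 1 < p) (g : TruncPoly k p) :
    of k p r g ∈ maxSub k p r ↔ g = 0 := by
  have : maxSub k p r = ⊥ := by
    rw [maxSub, sSup_eq_bot]
    intro N hN
    by_contra hb
    apply hN
    have hr := natCast_add_one_ne_zero k p h1
    apply eq_top_of_x_pow_mem
    intro j hj
    by_cases hj' : j + 1 < p
    · exact of_x_pow_mem k p r hb hr hj'
    -- The top monomial comes from `x ^ 2 ∂ · x ^ (p - 2) = 2 r x ^ (p - 1)`; here `p > 2` and `r ≠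
    -- 0` in `k`, since `0 < r` and `r + 1 < p`.
    · have h2 := N.lie_mem (x := xpow k p 2) (of_x_pow_mem k p r hb hr (j := p - 2) (by omega))
      rw [lie_xpow_of, show 2 + (p - 2) - 1 = j by omega] at h2
      refine (N.toSubmodule.smul_mem_iff ?_).1 h2
      have h3 : ((p - 2 : ℕ) : k) + ((2 : ℕ) : k) = 0 := by
        rw [← Nat.cast_add, Nat.sub_add_cancel (by omega), CharP.cast_eq_zero]
      have h4 : ((p - 2 : ℕ) : k) + ((2 : ℕ) : k) * ((r : k) + 1) = ((2 : ℕ) : k) * (r : k) := by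
        rw [mul_add, mul_one, add_comm (_ * _), ← add_assoc, h3, zero_add]
      rw [h4]
      exact mul_ne_zero (Witt.natCast_ne_zero k p (by omega) (by omega))
        (Witt.natCast_ne_zero k p h0 (by omega))
  rw [this, LieSubmodule.mem_bot, LinearEquiv.map_eq_zero_iff]

theorem natCast_pred_add_one : ((p - 1 : ℕ) : k) + 1 = 0 := by
  rw [← Nat.cast_add_one, Nat.sub_add_cancel (Fact.out : p.Prime).one_le, CharP.cast_eq_zero]

/-- For `r = 0` the action is `g ↦ (f g)'` with `f = D x`, so all values are derivatives, and these
have no term in `x ^ (p - 1)`. Conversely, a submodule with an element having such a term contains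
all lower monomials, hence `x ^ (p - 1)` as well. -/
theorem mem_maxSub_of_zero (g : TruncPoly k p) :
    of k p 0 g ∈ maxSub k p 0 ↔ coeff k p (p - 1) g = 0 := by
  have hp := (Fact.out : p.Prime).two_le
  let U : LieSubmodule k (Witt k p) (Verma k p 0) :=
    { toSubmodule := (LinearMap.ker (coeff k p (p - 1))).map (of k p 0).toLinearMap
      lie_mem := by
        rintro D _ ⟨g, -, rfl⟩
        refine ⟨del k p (D (x k p) * g), ?_, ?_⟩
        · rw [SetLike.mem_coe, LinearMap.mem_ker, Witt.coeff_del,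
            show p - 1 + 1 = p by omega, CharP.cast_eq_zero, zero_mul]
        · change of k p 0 _ = ⁅D, of k p 0 g⁆
          rw [lie_of]
          congr 1
          have hD : D g = D (x k p) * del k p g := by
            conv_lhs => rw [Witt.eq_smul_del k p D]
            simp
          rw [hD, Derivation.leibniz]
          simp [mul_comm] }
  have hU : ∀ g, of k p 0 g ∈ U ↔ coeff k p (p - 1) g = 0 := by
    intro g
    constructor
    · rintro ⟨g', hg', h⟩
      rw [← (of k p 0).injective h]; exact hg'
    · intro h; exact ⟨g, h, rfl⟩
  have : maxSub k p 0 = U := by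
    apply le_antisymm
    · apply sSup_le
      intro N hN v hv
      obtain ⟨g, rfl⟩ := (of k p 0).surjective v
      rw [hU]
      by_contra hc
      apply hN
      have hb : N ≠ ⊥ := by
        intro h
        rw [h, LieSubmodule.mem_bot, LinearEquiv.map_eq_zero_iff] at hv
        exact hc (by rw [hv, map_zero])
      have hlow : ∀ j, j + 1 < p → of k p 0 (x k p ^ j) ∈ N := fun j hj =>
        of_x_pow_mem k p 0 hb (by simp) hj
      apply eq_top_of_x_pow_mem
      intro j hj
      by_cases hj' : j + 1 < p
      · exact hlow j hj'
      obtain rfl : j = p - 1 := by omega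
      have h1 := Witt.eq_sum_coeff k p g
      rw [← Finset.add_sum_erase _ _ (Finset.mem_range.2 hj)] at h1
      have h2 : coeff k p (p - 1) g • x k p ^ (p - 1) =
          g - ∑ j ∈ (Finset.range p).erase (p - 1), coeff k p j g • x k p ^ j := by
        rw [eq_sub_iff_add_eq]; exact h1.symm
      have h3 : of k p 0 (coeff k p (p - 1) g • x k p ^ (p - 1)) ∈ N := by
        rw [h2, map_sub, map_sum]
        refine N.sub_mem hv (N.toSubmodule.sum_mem fun i hi => ?_)
        rw [map_smul]
        exact N.smul_mem _ (hlow i (by simp at hi; omega))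
      rw [map_smul] at h3
      exact (N.toSubmodule.smul_mem_iff hc).1 h3
    · apply le_sSup
      intro h
      have h1 := (hU (x k p ^ (p - 1))).1 (by rw [h]; trivial)
      rw [Witt.coeff_x_pow k p _ _ (by omega), if_pos rfl] at h1
      exact one_ne_zero h1
  rw [this, hU]

/-- For `r = p - 1` the divergence term disappears and `W₁` acts by derivations, which kill
constants. An element that is not constant produces `x`, and `x ^ j ∂ · x = x ^ j` then produces
everything. -/
theorem mem_maxSub_of_pred (g : TruncPoly k p) :
    of k p (p - 1) g ∈ maxSub k p (p - 1) ↔ del k p g = 0 := by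
  have hp := (Fact.out : p.Prime).two_le
  have hlie : ∀ (D : Witt k p) (g : TruncPoly k p),
      ⁅D, of k p (p - 1) g⁆ = of k p (p - 1) (D (x k p) * del k p g) := by
    intro D g
    rw [lie_of, natCast_pred_add_one, zero_smul, add_zero]
    conv_lhs => rw [Witt.eq_smul_del k p D]
    simp
  let U : LieSubmodule k (Witt k p) (Verma k p (p - 1)) :=
    { toSubmodule := (LinearMap.ker (del k p).toLinearMap).map (of k p (p - 1)).toLinearMap
      lie_mem := by
        rintro D _ ⟨g, hg, rfl⟩
        have hg' : del k p g = 0 := hg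
        refine ⟨0, Submodule.zero_mem _, ?_⟩
        change of k p (p - 1) 0 = ⁅D, of k p (p - 1) g⁆
        rw [hlie, hg', mul_zero] }
  have hU : ∀ g, of k p (p - 1) g ∈ U ↔ del k p g = 0 := by
    intro g
    constructor
    · rintro ⟨g', hg', h⟩
      rw [← (of k p (p - 1)).injective h]; exact hg'
    · intro h; exact ⟨g, h, rfl⟩
  have : maxSub k p (p - 1) = U := by
    apply le_antisymm
    · apply sSup_le
      intro N hN v hv
      obtain ⟨g, rfl⟩ := (of k p (p - 1)).surjective v
      rw [hU]
      by_contra hc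
      apply hN
      have hx := of_x_mem k p (p - 1) hv hc
      apply eq_top_of_x_pow_mem
      intro j hj
      have h1 := N.lie_mem (x := xpow k p j) hx
      rwa [hlie, Witt.xpow_apply_x, Witt.del_x, mul_one] at h1
    · apply le_sSup
      intro h
      have h1 := (hU (x k p)).1 (by rw [h]; trivial)
      rw [Witt.del_x] at h1
      have h2 := congrArg (coeff k p 0) h1
      rw [← pow_zero (x k p), Witt.coeff_x_pow k p _ _ (by omega), if_pos rfl, map_zero] at h2
      exact one_ne_zero h2
  rw [this, hU]

variable {r} in
/-- The unique maximal submodule of `Z⁺(r)` is spanned by the `x ^ j` with `j < lo p r`. -/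
theorem mem_maxSub_iff (hr : r < p) (g : TruncPoly k p) :
    of k p r g ∈ maxSub k p r ↔ ∀ j < p, lo p r ≤ j → coeff k p j g = 0 := by
  have hp := (Fact.out : p.Prime).two_le
  rw [lo]
  split_ifs with h0 h1
  · subst h0
    rw [mem_maxSub_of_zero]
    constructor
    · intro h j hj hj'
      rwa [show j = p - 1 by omega]
    · intro h; exact h _ (by omega) le_rfl
  · subst h1
    rw [mem_maxSub_of_pred]
    constructor
    · intro h j hj hj'
      rw [Witt.eq_smul_one_of_del_eq_zero k p h, map_smul, ← pow_zero (x k p),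
        Witt.coeff_x_pow k p _ _ (by omega), if_neg (by omega), smul_zero]
    · intro h
      apply Witt.ext_coeff
      intro j hj
      rw [Witt.coeff_del, map_zero]
      by_cases hj' : j + 1 < p
      · rw [h _ hj' (by omega), mul_zero]
      · rw [show j + 1 = p by omega, CharP.cast_eq_zero, zero_mul]
  · rw [mem_maxSub_of_mid k p r (by omega) (by omega)]
    constructor
    · rintro rfl j _ _; simp
    · intro h
      exact Witt.ext_coeff k p fun j hj => by rw [h j hj (by omega), map_zero]

variable {r} in
theorem maxSub_ne_top (hr : r < p) : maxSub k p r ≠ ⊤ := by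
  have hp := (Fact.out : p.Prime).two_le
  intro h
  have h1 := (mem_maxSub_iff k p hr (x k p ^ (p - 1))).1 (by rw [h]; trivial) (p - 1) (by omega)
    (by rw [lo]; split_ifs <;> omega)
  rw [Witt.coeff_x_pow k p _ _ (by omega), if_pos rfl] at h1
  exact one_ne_zero h1

end Verma

/-! ### Weight spaces of the simple modules `L(r)`. -/

namespace Verma

open Witt (x del xdel xpow coeff)

variable (k : Type*) [Field k] (p r : ℕ) [CharP k p]

/-- The projection of truncated polynomials onto the simple module `L(r)`. -/
def toSimple : TruncPoly k p →ₗ[k] SimpleWittModule k p r :=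
  (LieSubmodule.Quotient.mk' (maxSub k p r) : Verma k p r →ₗ[k] SimpleWittModule k p r) ∘ₗ
    (of k p r).toLinearMap

theorem toSimple_apply (g : TruncPoly k p) :
    toSimple k p r g = LieSubmodule.Quotient.mk' (maxSub k p r) (of k p r g) := rfl

theorem toSimple_surjective : Function.Surjective (toSimple k p r) := by
  intro v
  obtain ⟨w, rfl⟩ := LieSubmodule.Quotient.surjective_mk' (maxSub k p r) v
  obtain ⟨g, rfl⟩ := (of k p r).surjective w
  exact ⟨g, rfl⟩

instance : FiniteDimensional k (SimpleWittModule k p r) :=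
  Module.Finite.of_surjective _ (toSimple_surjective k p r)

theorem lie_toSimple (D : Witt k p) (g : TruncPoly k p) : ⁅D, toSimple k p r g⁆ =
    toSimple k p r (D g + ((r : k) + 1) • (del k p (D (x k p)) * g)) := by
  rw [toSimple_apply, toSimple_apply, ← lie_of, LieModuleHom.map_lie]

theorem lie_del_toSimple (g : TruncPoly k p) :
    ⁅del k p, toSimple k p r g⁆ = toSimple k p r (del k p g) := by
  rw [toSimple_apply, toSimple_apply, ← lie_del_of, LieModuleHom.map_lie]

theorem lie_xdel_toSimple (b : ℕ) : ⁅xdel k p, toSimple k p r (x k p ^ b)⁆ =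
    ((b : k) + 1 + (r : k)) • toSimple k p r (x k p ^ b) := by
  rw [toSimple_apply, ← LieModuleHom.map_lie, lie_xdel_of, map_smul]

theorem coeff_xdel (j : ℕ) (g : TruncPoly k p) :
    coeff k p j (xdel k p g) = (j : k) * coeff k p j g := by
  induction g using Witt.trunc_induction with
  | hx i hi =>
    rw [← Witt.xpow_one, Witt.xpow_apply_x_pow, show 1 + i - 1 = i by omega, map_smul,
      Witt.coeff_x_pow k p _ _ hi, smul_eq_mul]
    split_ifs with h
    · rw [h]
    · simp
  | h0 => simp
  | hadd f g hf hg => simp only [map_add, hf, hg, mul_add]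
  | hsmul c f hf => simp only [Derivation.map_smul, map_smul, hf, smul_eq_mul]; ring

variable {r}

theorem toEnd_del_pow_toSimple (m : ℕ) (g : TruncPoly k p) :
    (LieModule.toEnd k (Witt k p) (SimpleWittModule k p r) (del k p) ^ m) (toSimple k p r g) =
      toSimple k p r (((del k p : TruncPoly k p →ₗ[k] TruncPoly k p) ^ m) g) := by
  induction m with
  | zero => rfl
  | succ m ih =>
    rw [pow_succ', Module.End.mul_apply, ih, LieModule.toEnd_apply_apply, lie_del_toSimple,
      pow_succ', Module.End.mul_apply]
    rfl

theorem del_pow_x_pow (m j : ℕ) (hm : m ≤ j) (hj : j < p) : ∃ c : k, c ≠ 0 ∧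
    ((del k p : TruncPoly k p →ₗ[k] TruncPoly k p) ^ m) (x k p ^ j) = c • x k p ^ (j - m) := by
  induction m with
  | zero => exact ⟨1, one_ne_zero, by simp⟩
  | succ m ih =>
    obtain ⟨c, hc, h⟩ := ih (by omega)
    refine ⟨c * ((j - m : ℕ) : k), mul_ne_zero hc (Witt.natCast_ne_zero k p (by omega) (by omega)),
      ?_⟩
    rw [pow_succ', Module.End.mul_apply, h, map_smul]
    change c • del k p _ = _
    rw [Witt.del_x_pow, smul_smul, Nat.sub_sub]

variable [Fact p.Prime]

theorem toSimple_eq_zero_iff (hr : r < p) (g : TruncPoly k p) :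
    toSimple k p r g = 0 ↔ ∀ j < p, lo p r ≤ j → coeff k p j g = 0 := by
  rw [← mem_maxSub_iff k p hr, toSimple_apply, LieSubmodule.Quotient.mk'_apply,
    LieSubmodule.Quotient.mk_eq_zero']

theorem toSimple_x_pow_eq_zero_iff (hr : r < p) {j : ℕ} (hj : j < p) :
    toSimple k p r (x k p ^ j) = 0 ↔ j < lo p r := by
  rw [toSimple_eq_zero_iff k p hr]
  constructor
  · intro h
    by_contra h1
    have := h j hj (by omega)
    rw [Witt.coeff_x_pow k p _ _ hj, if_pos rfl] at this
    exact one_ne_zero this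
  · intro h i _ hi'
    rw [Witt.coeff_x_pow k p _ _ hj, if_neg (by omega)]

/-- Every weight space of `L(r)` is spanned by the image of a monomial. -/
theorem eigenspace_xdel (hr : r < p) {j : ℕ} (hj : j < p) {c : k} (hc : (j : k) + 1 + (r : k) = c) :
    Module.End.eigenspace (LieModule.toEnd k (Witt k p) (SimpleWittModule k p r) (xdel k p)) c =
      k ∙ toSimple k p r (x k p ^ j) := by
  apply le_antisymm
  · intro v hv
    obtain ⟨g, rfl⟩ := toSimple_surjective k p r v
    rw [Module.End.mem_eigenspace_iff, LieModule.toEnd_apply_apply, lie_toSimple, ← map_smul,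
      ← sub_eq_zero, ← map_sub, toSimple_eq_zero_iff k p hr] at hv
    rw [Submodule.mem_span_singleton]
    refine ⟨coeff k p j g, ?_⟩
    rw [← map_smul, eq_comm, ← sub_eq_zero, ← map_sub, toSimple_eq_zero_iff k p hr]
    intro i hi hi'
    have h1 := hv i hi hi'
    rw [map_sub, map_add, map_smul, map_smul, coeff_xdel, ← Witt.xpow_one, Witt.xpow_apply_x,
      pow_one, Witt.del_x, one_mul, ← hc, smul_eq_mul, smul_eq_mul] at h1
    have h2 : ((i : k) - j) * coeff k p i g = 0 := by rw [← h1]; ring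
    rw [map_sub, map_smul, Witt.coeff_x_pow k p _ _ hj]
    split_ifs with h
    · rw [h]; simp
    · rw [mul_eq_zero, sub_eq_zero] at h2
      rw [h2.resolve_left fun h3 => h (Witt.natCast_inj k p hi hj h3)]
      simp
  · rw [Submodule.span_singleton_le_iff_mem, Module.End.mem_eigenspace_iff,
      LieModule.toEnd_apply_apply, lie_xdel_toSimple, hc]

theorem finrank_eigenspace_xdel (hr : r < p) {j : ℕ} (hj : j < p) {c : k}
    (hc : (j : k) + 1 + (r : k) = c) :
    Module.finrank k (Module.End.eigenspace
      (LieModule.toEnd k (Witt k p) (SimpleWittModule k p r) (xdel k p)) c) =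
      if j < lo p r then 0 else 1 := by
  rw [eigenspace_xdel k p hr hj hc]
  split_ifs with h
  · rw [(toSimple_x_pow_eq_zero_iff k p hr hj).2 h, Submodule.span_zero_singleton, finrank_bot]
  · exact finrank_span_singleton fun h' => h ((toSimple_x_pow_eq_zero_iff k p hr hj).1 h')

/-- The monomial of weight `0` is `x ^ (p - 1 - r)`. It dies in `L(r)` only when it is the constant
`1` in `L(p - 1)`; for `r = 0` it is the surviving top monomial. -/
theorem finrank_eigenspace_zero (hr : r < p) :
    Module.finrank k (Module.End.eigenspace
      (LieModule.toEnd k (Witt k p) (SimpleWittModule k p r) (xdel k p)) 0) =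
      if r = p - 1 then 0 else 1 := by
  have hp := (Fact.out : p.Prime).two_le
  rw [finrank_eigenspace_xdel k p hr (j := p - 1 - r) (by omega)]
  · congr 1
    simp only [lo, eq_iff_iff]
    split_ifs <;> omega
  · rw [← Nat.cast_add_one, ← Nat.cast_add, show p - 1 - r + 1 + r = p by omega,
      CharP.cast_eq_zero]

/-- The monomial of weight `1` is `x ^ (p - r)`, read as `1` when `r = 0`. It dies in `L(0)`, while
in `L(p - 1)` it is `x`, the lowest survivor. -/
theorem finrank_eigenspace_one (hr : r < p) :
    Module.finrank k (Module.End.eigenspace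
      (LieModule.toEnd k (Witt k p) (SimpleWittModule k p r) (xdel k p)) 1) =
      if r = 0 then 0 else 1 := by
  have hp := (Fact.out : p.Prime).two_le
  rcases Nat.eq_zero_or_pos r with rfl | h0
  · rw [finrank_eigenspace_xdel k p hr (j := 0) (by omega) (by simp), if_pos rfl, if_pos]
    simp only [lo]; split_ifs <;> omega
  · rw [finrank_eigenspace_xdel k p hr (j := p - r) (by omega), if_neg, if_neg (by omega)]
    · simp only [lo]; split_ifs <;> omega
    · rw [add_right_comm, ← Nat.cast_add, Nat.sub_add_cancel (by omega), CharP.cast_eq_zero,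
        zero_add]

/-- In `L(r)` only the lowest surviving monomial is killed by `∂`. Its weight is `r + 1` for `0 < r
< p - 1`, but `0` for `L(0)` and `1` for `L(p - 1)`; these two weights are avoided by the conditions
on `s`. -/
theorem finrank_ker_del_inf_eigenspace_le (hr : r < p) {s : ℕ} (hs0 : 0 < s) (hs : s + 1 < p) :
    Module.finrank k (LinearMap.ker (LieModule.toEnd k (Witt k p) (SimpleWittModule k p r)
        (del k p)) ⊓ Module.End.eigenspace
      (LieModule.toEnd k (Witt k p) (SimpleWittModule k p r) (xdel k p)) ((s : k) + 1) :
      Submodule k (SimpleWittModule k p r)) ≤ if r = s then 1 else 0 := by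
  obtain ⟨j, hj, hjs⟩ : ∃ j < p, j + r = s ∨ j + r = s + p := by
    by_cases h : r ≤ s
    · exact ⟨s - r, by omega, by omega⟩
    · exact ⟨s + p - r, by omega, by omega⟩
  have hjk : (j : k) + 1 + (r : k) = (s : k) + 1 := by
    have : ((j + r : ℕ) : k) = (s : k) := by
      rcases hjs with h | h
      · rw [h]
      · rw [h]; simp
    rw [← this]; push_cast; ring
  split_ifs with h
  · refine (Submodule.finrank_mono inf_le_right).trans ?_
    rw [finrank_eigenspace_xdel k p hr hj hjk]
    split_ifs <;> simp
  · rw [Nat.le_zero, Submodule.finrank_eq_zero, eigenspace_xdel k p hr hj hjk, eq_bot_iff]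
    rintro v ⟨hv, hv'⟩
    obtain ⟨c, rfl⟩ := Submodule.mem_span_singleton.1 hv'
    have hv1 := LinearMap.mem_ker.1 hv
    rw [map_smul, LieModule.toEnd_apply_apply, lie_del_toSimple, Witt.del_x_pow, map_smul, smul_smul, smul_eq_zero,
      mul_eq_zero] at hv1
    rw [Submodule.mem_bot]
    by_cases hlo : j < lo p r
    · rw [(toSimple_x_pow_eq_zero_iff k p hr hj).2 hlo, smul_zero]
    rcases hv1 with (h1 | h1) | h1
    · rw [h1, zero_smul]
    · exact absurd h1 (Witt.natCast_ne_zero k p (by omega) hj)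
    · rw [toSimple_x_pow_eq_zero_iff k p hr (by omega)] at h1
      simp only [lo] at h1 hlo
      split_ifs at h1 hlo <;> omega

/-- In `L(s)` the monomial `x ^ (p - 1)` has weight `s`, and `∂ ^ (p - 1)` sends it to a nonzero
constant, which survives in `L(s)` because `s` is neither `0` nor `p - 1`. -/
theorem le_finrank_map_del_pow_eigenspace (hr : r < p) {s : ℕ} (hs0 : 0 < s) (hs : s + 1 < p) :
    (if r = s then 1 else 0) ≤
    Module.finrank k ((Module.End.eigenspace
      (LieModule.toEnd k (Witt k p) (SimpleWittModule k p r) (xdel k p)) (s : k)).map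
      (LieModule.toEnd k (Witt k p) (SimpleWittModule k p r) (del k p) ^ (p - 1))) := by
  split_ifs with h
  · subst h
    rw [Nat.one_le_iff_ne_zero, Ne, Submodule.finrank_eq_zero,
      eigenspace_xdel k p hr (j := p - 1) (by omega), Submodule.map_span, Set.image_singleton,
      Submodule.span_singleton_eq_bot, toEnd_del_pow_toSimple]
    · obtain ⟨c, hc, h1⟩ := del_pow_x_pow k p (p - 1) (p - 1) le_rfl (by omega)
      rw [h1, map_smul, smul_eq_zero, not_or, toSimple_x_pow_eq_zero_iff k p hr (by omega), lo]
      refine ⟨hc, ?_⟩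
      split_ifs <;> omega
    · rw [natCast_pred_add_one, zero_add]
  · exact Nat.zero_le _

end Verma

/-! ### Classification of the irreducible restricted representations of `W₁`. -/

namespace Witt

variable {k : Type*} [Field k] {p : ℕ} [CharP k p] {V : Type*} [AddCommGroup V] [Module k V]
  (ρ : Witt k p →ₗ[k] Module.End k V)

variable {ρ} in
theorem map_xpow_comm (hρ : ∀ (D E : Witt k p) v, ρ ⁅D, E⁆ v = ρ D (ρ E v) - ρ E (ρ D v))
    (a b : ℕ) (v : V) : ρ (xpow k p a) (ρ (xpow k p b) v) =
    ρ (xpow k p b) (ρ (xpow k p a) v) + ((b : k) - (a : k)) • ρ (xpow k p (a + b - 1)) v := by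
  rw [← LinearMap.smul_apply, ← map_smul, ← lie_xpow, hρ]; abel

variable {ρ} in
-- An Engel-type argument, descending in `a`. If `v` is killed by the `x ^ a ∂` with `a > b`, the
-- last nonzero vector among the iterates of `x ^ b ∂` on `v` is also killed by `x ^ b ∂`. The
-- earlier conditions persist because the bracket of `x ^ a ∂` and `x ^ b ∂` is a multiple of `x ^
-- (a + b - 1) ∂`, and `a + b - 1 ≥ a`.
theorem exists_ne_zero_map_eq_zero [Nontrivial V]
    (hρ : ∀ (D E : Witt k p) v, ρ ⁅D, E⁆ v = ρ D (ρ E v) - ρ E (ρ D v))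
    (hnil : ∀ a, 2 ≤ a → IsNilpotent (ρ (xpow k p a))) :
    ∃ v : V, v ≠ 0 ∧ ∀ a, 2 ≤ a → ρ (xpow k p a) v = 0 := by
  have key : ∀ m : ℕ, ∃ v : V, v ≠ 0 ∧ ∀ a, 2 ≤ a → p ≤ a + m → ρ (xpow k p a) v = 0 := by
    intro m
    induction m with
    | zero =>
      obtain ⟨v, hv⟩ := exists_ne (0 : V)
      refine ⟨v, hv, fun a _ ha => ?_⟩
      rw [xpow_eq_zero k p (by omega), map_zero, LinearMap.zero_apply]
    | succ m ih =>
      obtain ⟨v, hv, h⟩ := ih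
      by_cases hb : p - (m + 1) < 2
      · exact ⟨v, hv, fun a ha ha' => h a ha (by omega)⟩
      generalize hbdef : p - (m + 1) = b at hb
      obtain ⟨N, hN⟩ := hnil b (by omega)
      have hex : ∃ N, (ρ (xpow k p b) ^ N) v = 0 := ⟨N, by rw [hN, LinearMap.zero_apply]⟩
      classical
      have hn := Nat.find_spec hex
      have hn' : ∀ i < Nat.find hex, (ρ (xpow k p b) ^ i) v ≠ 0 := fun i hi => Nat.find_min hex hi
      generalize Nat.find hex = n at hn hn'
      rcases n with _ | n
      · exact absurd hn (by simpa using hv)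
      refine ⟨_, hn' n (Nat.lt_succ_self n), ?_⟩
      have stab : ∀ i a, 2 ≤ a → p ≤ a + m →
          ρ (xpow k p a) ((ρ (xpow k p b) ^ i) v) = 0 := by
        intro i
        induction i with
        | zero => intro a ha ha'; simpa using h a ha ha'
        | succ i ih =>
          intro a ha ha'
          rw [pow_succ', Module.End.mul_apply, map_xpow_comm hρ, ih a ha ha', map_zero, zero_add,
            ih _ (by omega) (by omega), smul_zero]
      intro a ha ha'
      by_cases hab : a = b
      · rw [hab, ← Module.End.mul_apply, ← pow_succ']; exact hn
      · exact stab n a ha (by omega)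
  obtain ⟨v, hv, h⟩ := key p
  exact ⟨v, hv, fun a ha => h a ha (by omega)⟩

theorem exists_natCast_eq [Fact p.Prime] {μ : k} (h : μ ^ p = μ) : ∃ r < p, (r : k) = μ := by
  have hp := (Fact.out : p.Prime).pos
  obtain ⟨n, hn⟩ := (mem_bot_iff_intCast p k).1 ((Subfield.mem_bot_iff_pow_eq_self k p).2 h)
  have h1 : 0 ≤ n % p := Int.emod_nonneg _ (by omega)
  have h2 : n % p < p := Int.emod_lt_of_pos _ (by omega)
  refine ⟨(n % p).toNat, by omega, ?_⟩
  rw [← hn, ← Int.cast_natCast, Int.toNat_of_nonneg h1, CharP.intCast_eq_intCast k p]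
  exact Int.mod_modEq n p

variable {ρ} in
-- The common kernel of the `x ^ a ∂`, `a ≥ 2`, is nonzero and stable under `X ∂`, so it contains an
-- eigenvector; the relation `(X ∂) ^ p = X ∂` puts the eigenvalue in the prime field.
theorem exists_highest_weight_vector [IsAlgClosed k] [Fact p.Prime] [Nontrivial V]
    [FiniteDimensional k V]
    (hρ : ∀ (D E : Witt k p) v, ρ ⁅D, E⁆ v = ρ D (ρ E v) - ρ E (ρ D v))
    (hnil : ∀ a, 2 ≤ a → IsNilpotent (ρ (xpow k p a)))
    (hh : ρ (xdel k p) ^ p = ρ (xdel k p)) :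
    ∃ v : V, v ≠ 0 ∧ (∀ a, 2 ≤ a → ρ (xpow k p a) v = 0) ∧
      ∃ r < p, ρ (xdel k p) v = (r : k) • v := by
  let U : Submodule k V := ⨅ a : {a : ℕ // 2 ≤ a}, LinearMap.ker (ρ (xpow k p a))
  have hU : ∀ v, v ∈ U ↔ ∀ a, 2 ≤ a → ρ (xpow k p a) v = 0 := by
    intro v; simp [U]
  have hst : ∀ v ∈ U, ρ (xdel k p) v ∈ U := by
    intro v hv
    rw [hU] at hv ⊢
    intro a ha
    rw [← xpow_one, map_xpow_comm hρ, hv a ha, map_zero, zero_add, show a + 1 - 1 = a by omega,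
      hv a ha, smul_zero]
  obtain ⟨v₀, h0, hv₀⟩ := exists_ne_zero_map_eq_zero hρ hnil
  have : Nontrivial U := ⟨⟨v₀, (hU _).2 hv₀⟩, 0, fun h => h0 (congrArg Subtype.val h)⟩
  obtain ⟨μ, hμ⟩ := Module.End.exists_eigenvalue ((ρ (xdel k p)).restrict hst)
  obtain ⟨u, hu⟩ := hμ.exists_hasEigenvector
  have hu1 : ρ (xdel k p) u = μ • (u : V) := congrArg Subtype.val hu.apply_eq_smul
  have hu0 : (u : V) ≠ 0 := fun h => hu.2 (Subtype.ext h)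
  have hpow : ∀ m : ℕ, (ρ (xdel k p) ^ m) (u : V) = μ ^ m • (u : V) := by
    intro m
    induction m with
    | zero => simp
    | succ m ih => rw [pow_succ', Module.End.mul_apply, ih, map_smul, hu1, smul_smul, pow_succ]
  have hμp : μ ^ p = μ := by
    have := hpow p
    rw [hh, hu1] at this
    exact (smul_left_injective k hu0 this).symm
  obtain ⟨r, hr, rfl⟩ := exists_natCast_eq (p := p) hμp
  exact ⟨u, hu0, (hU _).1 u.2, r, hr, hu1⟩

/-- The linear map `Z⁺(r) → V` determined by the image `v` of the highest weight vector. -/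
def vermaMap (v : V) : TruncPoly k p →ₗ[k] V :=
  (powBasis k p).constr k fun j => ((j : ℕ).factorial : k) • (ρ (del k p) ^ (p - 1 - j)) v

theorem vermaMap_x_pow (v : V) {j : ℕ} (hj : j < p) : vermaMap ρ v (x k p ^ j) =
    (j.factorial : k) • (ρ (del k p) ^ (p - 1 - j)) v := by
  rw [vermaMap, ← powBasis_apply k p ⟨j, hj⟩, Module.Basis.constr_basis]

theorem vermaMap_del (hd : ρ (del k p) ^ p = 0) (v : V) (g : TruncPoly k p) :
    vermaMap ρ v (del k p g) = ρ (del k p) (vermaMap ρ v g) := by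
  induction g using trunc_induction with
  | hx j hj =>
    rw [del_x_pow, map_smul, vermaMap_x_pow ρ v hj, vermaMap_x_pow ρ v (by omega), map_smul,
      ← Module.End.mul_apply, ← pow_succ', smul_smul]
    rcases j with _ | j
    -- At the bottom monomial `1` the left side is zero, and the right side needs the hypothesis `∂
    -- ^ p = 0`.
    · rw [show p - 1 - 0 + 1 = p by omega, hd]
      simp
    · rw [Nat.factorial_succ, Nat.cast_mul, Nat.add_sub_cancel,
        show p - 1 - (j + 1) + 1 = p - 1 - j by omega]
  | h0 => simp
  | hadd f g hf hg => simp only [map_add, hf, hg]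
  | hsmul c f hf => simp only [Derivation.map_smul, map_smul, hf]

variable {ρ} in
-- `Z⁺(r)` is generated by `x ^ (p - 1)` under `∂`. On this vector equivariance is the highest
-- weight condition on `v`; it passes from `x ^ j` to `x ^ (j - 1)` because the map commutes with
-- `∂` and `[D, ∂]` is again in `W₁`. The index `m` counts the steps down from `p - 1`.
theorem vermaMap_lie [Fact p.Prime]
    (hρ : ∀ (D E : Witt k p) v, ρ ⁅D, E⁆ v = ρ D (ρ E v) - ρ E (ρ D v))
    (hd : ρ (del k p) ^ p = 0) {v : V}
    (hv : ∀ a, 2 ≤ a → ρ (xpow k p a) v = 0) {r : ℕ} (hr : ρ (xdel k p) v = (r : k) • v)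
    (D : Witt k p) (g : TruncPoly k p) :
    vermaMap ρ v ((Verma.of k p r).symm ⁅D, Verma.of k p r g⁆) = ρ D (vermaMap ρ v g) := by
  have hp := (Fact.out : p.Prime).two_le
  have key : ∀ m < p, ∀ D : Witt k p,
      vermaMap ρ v ((Verma.of k p r).symm ⁅D, Verma.of k p r (x k p ^ (p - 1 - m))⁆) =
        ρ D (vermaMap ρ v (x k p ^ (p - 1 - m))) := by
    intro m
    induction m with
    | zero =>
      intro _ D
      rw [Nat.sub_zero]
      induction D using Witt.induction with
      | hx a ha =>
        rw [Verma.lie_xpow_of, map_smul, LinearEquiv.symm_apply_apply, map_smul,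
          vermaMap_x_pow ρ v (j := p - 1) (by omega), Nat.sub_self, pow_zero, Module.End.one_apply, map_smul]
        rcases a with _ | _ | a
        · rw [vermaMap_x_pow ρ v (by omega), xpow_zero, show p - 1 - (0 + (p - 1) - 1) = 1 by omega,
            pow_one, smul_smul, Nat.cast_zero, zero_mul, add_zero, ← Nat.cast_mul,
            show 0 + (p - 1) - 1 = p - 1 - 1 by omega, Nat.mul_factorial_pred (by omega)]
        · rw [zero_add, show 1 + (p - 1) - 1 = p - 1 by omega, vermaMap_x_pow ρ v (by omega),
            Nat.sub_self, xpow_one, hr, pow_zero, Module.End.one_apply, smul_smul, smul_smul,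
            mul_comm]
          congr 2
          have := Verma.natCast_pred_add_one k p
          rw [Nat.cast_one, one_mul, add_comm (r : k), ← add_assoc, this, zero_add]
        · rw [hv _ (by omega), x_pow_eq_zero k p (by omega), map_zero, smul_zero, smul_zero]
      | h0 => rw [Verma.zero_lie', map_zero, map_zero, map_zero, LinearMap.zero_apply]
      | hadd D E hD hE =>
        rw [Verma.add_lie', map_add, map_add, hD, hE, map_add, LinearMap.add_apply]
      | hsmul c D hD => rw [Verma.smul_lie', map_smul, map_smul, hD, map_smul, LinearMap.smul_apply]
    | succ m ih =>
      intro hm D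
      have hj : p - 1 - m = p - 1 - (m + 1) + 1 := by omega
      have h0 := natCast_ne_zero k p (j := p - 1 - m) (by omega) (by omega)
      have h1 : Verma.of k p r (x k p ^ (p - 1 - (m + 1))) =
          ((p - 1 - m : ℕ) : k)⁻¹ • ⁅del k p, Verma.of k p r (x k p ^ (p - 1 - m))⁆ := by
        rw [Verma.lie_del_of, del_x_pow, map_smul, smul_smul, inv_mul_cancel₀ h0, one_smul,
          show p - 1 - m - 1 = p - 1 - (m + 1) by omega]
      have h2 : x k p ^ (p - 1 - (m + 1)) =
          ((p - 1 - m : ℕ) : k)⁻¹ • del k p (x k p ^ (p - 1 - m)) := by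
        rw [del_x_pow, smul_smul, inv_mul_cancel₀ h0, one_smul,
          show p - 1 - m - 1 = p - 1 - (m + 1) by omega]
      have h3 : ∀ w : Verma k p r, (Verma.of k p r).symm ⁅del k p, w⁆ =
          del k p ((Verma.of k p r).symm w) := by
        intro w
        obtain ⟨g, rfl⟩ := (Verma.of k p r).surjective w
        rw [Verma.lie_del_of, LinearEquiv.symm_apply_apply, LinearEquiv.symm_apply_apply]
      have hl : ⁅D, ⁅del k p, Verma.of k p r (x k p ^ (p - 1 - m))⁆⁆ =
          ⁅⁅D, del k p⁆, Verma.of k p r (x k p ^ (p - 1 - m))⁆ +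
          ⁅del k p, ⁅D, Verma.of k p r (x k p ^ (p - 1 - m))⁆⁆ := Verma.lie_lie' _ _ _
      rw [h1, h2, lie_smul, map_smul, map_smul, map_smul, map_smul, hl, map_add, map_add,
        ih (by omega), h3, vermaMap_del ρ hd, vermaMap_del ρ hd, ih (by omega), hρ,
        sub_add_cancel]
  induction g using trunc_induction with
  | hx j hj =>
    have := key (p - 1 - j) (by omega) D
    rwa [show p - 1 - (p - 1 - j) = j by omega] at this
  | h0 => rw [map_zero, lie_zero, map_zero, map_zero, map_zero]
  | hadd f g hf hg => rw [map_add, lie_add, map_add, map_add, hf, hg, map_add, map_add]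
  | hsmul c f hf => rw [map_smul, lie_smul, map_smul, map_smul, hf, map_smul, map_smul]

variable {ρ} in
/-- Every irreducible restricted representation of `W₁` is one of the `L(r)`. -/
theorem exists_equiv_simple [IsAlgClosed k] [Fact p.Prime] [Nontrivial V] [FiniteDimensional k V]
    (hρ : ∀ (D E : Witt k p) v, ρ ⁅D, E⁆ v = ρ D (ρ E v) - ρ E (ρ D v))
    (hd : ρ (del k p) ^ p = 0)
    (hnil : ∀ a, 2 ≤ a → IsNilpotent (ρ (xpow k p a)))
    (hh : ρ (xdel k p) ^ p = ρ (xdel k p))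
    (hirr : ∀ U : Submodule k V, (∀ D, ∀ u ∈ U, ρ D u ∈ U) → U = ⊥ ∨ U = ⊤) :
    ∃ r < p, ∃ f : V ≃ₗ[k] SimpleWittModule k p r, ∀ D v, f (ρ D v) = ⁅D, f v⁆ := by
  have hp := (Fact.out : p.Prime).two_le
  obtain ⟨v, hv0, hv, r, hr, hvr⟩ := exists_highest_weight_vector hρ hnil hh
  refine ⟨r, hr, ?_⟩
  let F : Verma k p r →ₗ[k] V := vermaMap ρ v ∘ₗ (Verma.of k p r).symm.toLinearMap
  have hF : ∀ D w, F ⁅D, w⁆ = ρ D (F w) := by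
    intro D w
    obtain ⟨g, rfl⟩ := (Verma.of k p r).surjective w
    have := vermaMap_lie hρ hd hv hvr D g
    simpa [F] using this
  have himage : ∀ N : LieSubmodule k (Witt k p) (Verma k p r),
      N.toSubmodule.map F = ⊥ ∨ N.toSubmodule.map F = ⊤ := by
    intro N
    apply hirr
    rintro D _ ⟨w, hw, rfl⟩
    exact ⟨⁅D, w⁆, N.lie_mem hw, hF D w⟩
  have hne : F (Verma.of k p r (x k p ^ (p - 1))) ≠ 0 := by
    have : F (Verma.of k p r (x k p ^ (p - 1))) = ((p - 1).factorial : k) • v := by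
      rw [LinearMap.comp_apply, LinearEquiv.coe_coe, LinearEquiv.symm_apply_apply, vermaMap_x_pow ρ v (by omega),
        Nat.sub_self, pow_zero, Module.End.one_apply]
    rw [this]
    refine smul_ne_zero ?_ hv0
    rw [Ne, CharP.cast_eq_zero_iff k p, (Fact.out : p.Prime).dvd_factorial]
    omega
  have hsurj : Function.Surjective F := by
    rw [← LinearMap.range_eq_top, ← Submodule.map_top]
    refine (himage ⊤).resolve_left fun h => hne ?_
    rw [← Submodule.mem_bot k, ← h]
    exact ⟨_, trivial, rfl⟩
  let K : LieSubmodule k (Witt k p) (Verma k p r) :=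
    { toSubmodule := LinearMap.ker F
      lie_mem := by
        intro D w hw
        have hw' : F w = 0 := hw
        change F ⁅D, w⁆ = 0
        rw [hF, hw', map_zero] }
  have hK : K = Verma.maxSub k p r := by
    apply le_antisymm
    · apply le_sSup
      intro h
      apply hne
      have : Verma.of k p r (x k p ^ (p - 1)) ∈ K := by rw [h]; trivial
      exact this
    · intro w hw
      rcases himage (Verma.maxSub k p r) with h | h
      · change F w = 0
        rw [← Submodule.mem_bot k, ← h]
        exact ⟨w, hw, rfl⟩
      -- If the maximal submodule had image `V`, then together with the kernel `K` it would span
      -- `Z⁺(r)`; but `K` is proper, hence lies in the maximal submodule, which is itself proper.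
      · exfalso
        have hle : K ≤ Verma.maxSub k p r := by
          apply le_sSup
          intro h
          apply hne
          have : Verma.of k p r (x k p ^ (p - 1)) ∈ K := by rw [h]; trivial
          exact this
        apply Verma.maxSub_ne_top k p hr
        rw [eq_top_iff]
        intro w _
        have hw : F w ∈ (Verma.maxSub k p r).toSubmodule.map F := by rw [h]; trivial
        obtain ⟨w', hw', hww⟩ := hw
        have : w - w' ∈ K := by
          change F (w - w') = 0
          rw [map_sub, hww, sub_self]
        have := (Verma.maxSub k p r).add_mem (hle this) hw'
        rwa [sub_add_cancel] at this
  have hker : LinearMap.ker F = (Verma.maxSub k p r).toSubmodule := by rw [← hK]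
  let e : SimpleWittModule k p r ≃ₗ[k] V :=
    (Submodule.quotEquivOfEq _ _ hker.symm).trans (F.quotKerEquivOfSurjective hsurj)
  have he : ∀ w, e (LieSubmodule.Quotient.mk' (Verma.maxSub k p r) w) = F w := fun w => rfl
  refine ⟨e.symm, fun D u => ?_⟩
  obtain ⟨w, rfl⟩ := hsurj u
  have h1 : ∀ w, e.symm (F w) = LieSubmodule.Quotient.mk' (Verma.maxSub k p r) w := by
    intro w
    rw [← he, LinearEquiv.symm_apply_apply]
  rw [← hF, h1, h1, LieModuleHom.map_lie]

end Witt

/-! ### Dimension counts along a chain of submodules. -/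

namespace Fin

theorem le_add_sum_of_succ_le {n : ℕ} (a : Fin (n + 1) → ℕ) (w : Fin n → ℕ)
    (h : ∀ i : Fin n, a i.succ ≤ a i.castSucc + w i) : a (last n) ≤ a 0 + ∑ i, w i := by
  induction n with
  | zero => simp
  | succ n ih =>
    have h1 := ih (fun i => a i.castSucc) (fun i => w i.castSucc) fun i => h i.castSucc
    have h2 : a (last (n + 1)) ≤ _ := h (last n)
    rw [Fin.sum_univ_castSucc]
    simp only [castSucc_zero] at h1
    omega

theorem add_sum_le_of_le_succ {n : ℕ} (a : Fin (n + 1) → ℕ) (w : Fin n → ℕ)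
    (h : ∀ i : Fin n, a i.castSucc + w i ≤ a i.succ) : a 0 + ∑ i, w i ≤ a (last n) := by
  induction n with
  | zero => simp
  | succ n ih =>
    have h1 := ih (fun i => a i.castSucc) (fun i => w i.castSucc) fun i => h i.castSucc
    have h2 : _ ≤ a (last (n + 1)) := h (last n)
    rw [Fin.sum_univ_castSucc]
    simp only [castSucc_zero] at h1
    omega

end Fin

namespace Subquotient

variable {k : Type*} [Field k] {L S : Type*} [AddCommGroup L] [Module k L]
  [AddCommGroup S] [Module k S] {N N' : Submodule k L} {g : L →ₗ[k] S}
  {d h : Module.End k L} {dS hS : Module.End k S}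

/-- Rank-nullity for `g` on `T`. Here `g` plays the part of the projection `N' → N' / N`, extended
to all of `L` to avoid subtypes; its values outside `N'` do not matter. -/
theorem finrank_eq_add [FiniteDimensional k L] (hg : ∀ v ∈ N', g v = 0 ↔ v ∈ N) {T : Submodule k L} (hT : T ≤ N') :
    Module.finrank k T = Module.finrank k (T ⊓ N : Submodule k L) +
      Module.finrank k (T.map g) := by
  have h1 := LinearMap.finrank_range_add_finrank_ker (g ∘ₗ T.subtype)
  rw [LinearMap.range_comp, Submodule.range_subtype] at h1
  have h2 : (LinearMap.ker (g ∘ₗ T.subtype)).map T.subtype = T ⊓ N := by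
    ext v
    simp only [Submodule.mem_map, LinearMap.mem_ker, LinearMap.comp_apply, Submodule.subtype_apply,
      Subtype.exists, exists_and_right, exists_eq_right, Submodule.mem_inf]
    constructor
    · rintro ⟨hv, hv'⟩; exact ⟨hv, (hg v (hT hv)).1 hv'⟩
    · rintro ⟨hv, hv'⟩; exact ⟨hv, (hg v (hT hv)).2 hv'⟩
  rw [← h2, Submodule.finrank_map_subtype_eq]
  omega

/-- Only an inequality: a vector of the quotient killed by `dS` need not lift to one killed by `d`.
-/
theorem finrank_inf_ker_inf_eigenspace_le [FiniteDimensional k L] [FiniteDimensional k S] (hNN : N ≤ N')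
    (hg : ∀ v ∈ N', g v = 0 ↔ v ∈ N) (hgd : ∀ v ∈ N', g (d v) = dS (g v))
    (hgh : ∀ v ∈ N', g (h v) = hS (g v)) (c : k) :
    Module.finrank k (N' ⊓ (LinearMap.ker d ⊓ h.eigenspace c) : Submodule k L) ≤
      Module.finrank k (N ⊓ (LinearMap.ker d ⊓ h.eigenspace c) : Submodule k L) +
      Module.finrank k (LinearMap.ker dS ⊓ hS.eigenspace c : Submodule k S) := by
  rw [finrank_eq_add hg inf_le_left, inf_right_comm, inf_eq_right.2 hNN]
  refine Nat.add_le_add_left (Submodule.finrank_mono ?_) _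
  rintro _ ⟨v, ⟨hv, hv1, hv2⟩, rfl⟩
  rw [SetLike.mem_coe, LinearMap.mem_ker] at hv1
  rw [SetLike.mem_coe, Module.End.mem_eigenspace_iff] at hv2
  refine ⟨?_, ?_⟩
  · rw [SetLike.mem_coe, LinearMap.mem_ker, ← hgd v hv, hv1, map_zero]
  · rw [SetLike.mem_coe, Module.End.mem_eigenspace_iff, ← hgh v hv, hv2, map_smul]

variable {p : ℕ} [CharP k p] [Fact p.Prime]

theorem sub_pow_char_of_pow_eq (hp : h ^ p = h) {c : k} (hc : c ^ p = c) :
    (h - algebraMap k _ c) ^ p = h - algebraMap k _ c := by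
  have h1 : (X - C c : k[X]) ^ p = X ^ p - C (c ^ p) := by rw [sub_pow_char, C_pow]
  have h2 := congrArg (aeval h) h1
  simpa [hp, hc] using h2

/-- Eigenvectors of a quotient lift because `h` is diagonalizable: with `q = h - c` one has `q ^ p =
q`, so `1 - q ^ (p - 1)` projects onto the `c`-eigenspace. -/
theorem map_inf_eigenspace (hp : h ^ p = h) (hN' : ∀ v ∈ N', h v ∈ N') (hgs : N'.map g = ⊤)
    (hgh : ∀ v ∈ N', g (h v) = hS (g v)) {c : k} (hc : c ^ p = c) :
    (N' ⊓ h.eigenspace c).map g = hS.eigenspace c := by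
  have hp2 := (Fact.out : p.Prime).two_le
  apply le_antisymm
  · rintro _ ⟨v, ⟨hv, hv'⟩, rfl⟩
    rw [SetLike.mem_coe, Module.End.mem_eigenspace_iff] at hv'
    rw [Module.End.mem_eigenspace_iff, ← hgh v hv, hv', map_smul]
  · intro u hu
    rw [Module.End.mem_eigenspace_iff] at hu
    obtain ⟨v, hv, rfl⟩ : u ∈ N'.map g := by rw [hgs]; trivial
    set q : Module.End k L := h - algebraMap k _ c with hq
    have hqa : ∀ w, q w = h w - c • w := fun w => rfl
    have hqm : ∀ m, (q ^ m) v ∈ N' ∧ (0 < m → g ((q ^ m) v) = 0) := by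
      intro m
      induction m with
      | zero => exact ⟨by simpa using hv, by simp⟩
      | succ m ih =>
        rw [pow_succ', Module.End.mul_apply, hqa]
        refine ⟨N'.sub_mem (hN' _ ih.1) (N'.smul_mem _ ih.1), fun _ => ?_⟩
        rw [map_sub, hgh _ ih.1, map_smul]
        rcases Nat.eq_zero_or_pos m with rfl | hm
        · rw [pow_zero, Module.End.one_apply, hu, sub_self]
        · rw [ih.2 hm, map_zero, smul_zero, sub_zero]
    -- The correction `q ^ (p - 1) v` maps to zero, since the image of `v` is already an eigenvector
    -- and `p - 1 > 0`.
    refine ⟨v - (q ^ (p - 1)) v, ⟨N'.sub_mem hv (hqm _).1, ?_⟩, ?_⟩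
    · rw [SetLike.mem_coe, Module.End.mem_eigenspace_iff, ← sub_eq_zero, ← hqa, map_sub,
        ← Module.End.mul_apply q, ← pow_succ', Nat.sub_add_cancel (by omega),
        sub_pow_char_of_pow_eq hp hc, sub_self]
    · rw [map_sub, (hqm _).2 (by omega), sub_zero]

theorem finrank_inf_eigenspace [FiniteDimensional k L] (hp : h ^ p = h) (hNN : N ≤ N') (hN' : ∀ v ∈ N', h v ∈ N')
    (hg : ∀ v ∈ N', g v = 0 ↔ v ∈ N) (hgs : N'.map g = ⊤)
    (hgh : ∀ v ∈ N', g (h v) = hS (g v)) {c : k} (hc : c ^ p = c) :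
    Module.finrank k (N' ⊓ h.eigenspace c : Submodule k L) =
      Module.finrank k (N ⊓ h.eigenspace c : Submodule k L) +
      Module.finrank k (hS.eigenspace c) := by
  rw [finrank_eq_add hg inf_le_left, map_inf_eigenspace hp hN' hgs hgh hc, inf_right_comm,
    inf_eq_right.2 hNN]

/-- Ranks are superadditive: the image from `N'` contains the image from `N` and maps onto the image
in the quotient, since weight vectors lift. -/
theorem finrank_map_pow_le [FiniteDimensional k L] [FiniteDimensional k S] (hp : h ^ p = h) (hNN : N ≤ N')
    (hdN' : ∀ v ∈ N', d v ∈ N') (hN' : ∀ v ∈ N', h v ∈ N')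
    (hg : ∀ v ∈ N', g v = 0 ↔ v ∈ N) (hgs : N'.map g = ⊤)
    (hgd : ∀ v ∈ N', g (d v) = dS (g v))
    (hgh : ∀ v ∈ N', g (h v) = hS (g v)) {c : k} (hc : c ^ p = c) (m : ℕ) :
    Module.finrank k ((N ⊓ h.eigenspace c).map (d ^ m)) +
      Module.finrank k ((hS.eigenspace c).map (dS ^ m)) ≤
      Module.finrank k ((N' ⊓ h.eigenspace c).map (d ^ m)) := by
  have hm : ∀ v ∈ N', (d ^ m) v ∈ N' ∧ g ((d ^ m) v) = (dS ^ m) (g v) := by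
    intro v hv
    induction m with
    | zero => exact ⟨hv, rfl⟩
    | succ m ih =>
      rw [pow_succ', pow_succ', Module.End.mul_apply, Module.End.mul_apply, ← ih.2]
      exact ⟨hdN' _ ih.1, hgd _ ih.1⟩
  have hT : (N' ⊓ h.eigenspace c).map (d ^ m) ≤ N' := by
    rintro _ ⟨v, hv, rfl⟩
    exact (hm v hv.1).1
  rw [finrank_eq_add hg hT]
  refine Nat.add_le_add (Submodule.finrank_mono ?_) (Submodule.finrank_mono ?_)
  · rintro _ ⟨v, hv, rfl⟩
    refine ⟨⟨v, ⟨hNN hv.1, hv.2⟩, rfl⟩, ?_⟩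
    have h1 := hm v (hNN hv.1)
    refine (hg _ h1.1).1 ?_
    rw [h1.2, (hg v (hNN hv.1)).2 hv.1, map_zero]
  · rw [← map_inf_eigenspace hp hN' hgs hgh hc]
    rintro _ ⟨_, ⟨v, hv, rfl⟩, rfl⟩
    exact ⟨_, ⟨v, hv, rfl⟩, (hm v hv.1).2⟩

end Subquotient

/-! ### Composition factors of `𝔤|W` in terms of kernels and weight spaces. -/

section

variable {p : ℕ} {k L : Type*} [Field k] [CharP k p] [LieRing L] [LieAlgebra k L]
  {W : LieSubalgebra k L}

theorem FactorIso.exists_linearMap {φ : Witt k p ≃ₗ⁅k⁆ W} {N N' : LieSubmodule k W L} {r : ℕ}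
    (hf : FactorIso φ N N' r) : ∃ g : L →ₗ[k] SimpleWittModule k p r,
      (∀ v ∈ N'.toSubmodule, g v = 0 ↔ v ∈ N.toSubmodule) ∧ N'.toSubmodule.map g = ⊤ ∧
      ∀ D : Witt k p, ∀ v ∈ N'.toSubmodule, g (LieAlgebra.ad k L (φ D : L) v) =
        LieModule.toEnd k (Witt k p) (SimpleWittModule k p r) D (g v) := by
  obtain ⟨f, hf⟩ := hf
  let q : N' →ₗ[k] (N' ⧸ LieSubmodule.comap N'.incl N) :=
    (LieSubmodule.Quotient.mk' (LieSubmodule.comap N'.incl N) :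
      N' →ₗ[k] (N' ⧸ LieSubmodule.comap N'.incl N))
  obtain ⟨g, hg⟩ := LinearMap.exists_extend (p := N'.toSubmodule) (f.toLinearMap ∘ₗ q)
  have hg' : ∀ v : N', g (v : L) = f (LieSubmodule.Quotient.mk' _ v) := fun v =>
    LinearMap.congr_fun hg v
  refine ⟨g, ?_, ?_, ?_⟩
  · intro v hv
    rw [hg' ⟨v, hv⟩, LinearEquiv.map_eq_zero_iff, LieSubmodule.Quotient.mk'_apply,
      LieSubmodule.Quotient.mk_eq_zero']
    rfl
  · rw [eq_top_iff]
    intro u _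
    obtain ⟨v, hv⟩ := LieSubmodule.Quotient.surjective_mk' (LieSubmodule.comap N'.incl N) (f.symm u)
    exact ⟨v, v.2, by rw [hg', hv, LinearEquiv.apply_symm_apply]⟩
  · intro D v hv
    have h1 : LieAlgebra.ad k L (φ D : L) v = ((⁅φ D, (⟨v, hv⟩ : N')⁆ : N') : L) := rfl
    rw [h1, hg', hg' ⟨v, hv⟩, LieModuleHom.map_lie, hf, LieModule.toEnd_apply_apply]

variable [Fact p.Prime] [IsAlgClosed k] [FiniteDimensional k L]

/-- The covering relation makes the subquotient irreducible, and the identities between `p`-th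
powers of `ad` descend to it, so the classification of irreducible restricted modules applies. -/
theorem exists_factorIso_of_covBy (hW : IsPSubalgebra p W) (φ : Witt k p ≃ₗ⁅k⁆ W)
    {N N' : LieSubmodule k W L} (h : N ⋖ N') : ∃ r < p, FactorIso φ N N' r := by
  let K : LieSubmodule k W N' := LieSubmodule.comap N'.incl N
  let ρ : Witt k p →ₗ[k] Module.End k (N' ⧸ K) :=
    (LieModule.toEnd k W (N' ⧸ K) : W →ₗ[k] Module.End k (N' ⧸ K)) ∘ₗ
      (φ.toLinearEquiv : Witt k p →ₗ[k] W)
  have hρa : ∀ D v, ρ D v = ⁅φ D, v⁆ := fun D v => rfl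
  have hρ : ∀ (D E : Witt k p) v, ρ ⁅D, E⁆ v = ρ D (ρ E v) - ρ E (ρ D v) := by
    intro D E v
    simp only [hρa]
    rw [LieEquiv.map_lie, lie_lie]
  have hpow : ∀ (D : Witt k p) (m : ℕ) (v : N'), ∃ w : N',
      (w : L) = (LieAlgebra.ad k L (φ D : L) ^ m) v ∧
      (ρ D ^ m) (LieSubmodule.Quotient.mk' K v) = LieSubmodule.Quotient.mk' K w := by
    intro D m v
    induction m with
    | zero => exact ⟨v, rfl, rfl⟩
    | succ m ih =>
      obtain ⟨w, hw, hw'⟩ := ih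
      refine ⟨⁅φ D, w⁆, ?_, ?_⟩
      · rw [pow_succ', Module.End.mul_apply, ← hw]; rfl
      · rw [pow_succ', Module.End.mul_apply, hw', hρa, LieModuleHom.map_lie]
  have hrestr : ∀ D E : Witt k p, LieAlgebra.ad k (Witt k p) D ^ p = LieAlgebra.ad k (Witt k p) E →
      ρ D ^ p = ρ E := by
    intro D E hDE
    ext1 v
    obtain ⟨v, rfl⟩ := LieSubmodule.Quotient.surjective_mk' K v
    obtain ⟨w, hw, hw'⟩ := hpow D p v
    rw [hw', hρa, ← LieModuleHom.map_lie]
    congr 1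
    apply Subtype.ext
    rw [hw, Witt.ad_pow_of_isPSubalgebra hW φ hDE]
    rfl
  have hnt : Nontrivial (N' ⧸ K) := by
    obtain ⟨v, hv, hv'⟩ := Set.exists_of_ssubset (SetLike.coe_ssubset_coe.2 h.1)
    refine ⟨LieSubmodule.Quotient.mk' K ⟨v, hv⟩, 0, fun h0 => hv' ?_⟩
    rw [LieSubmodule.Quotient.mk'_apply, LieSubmodule.Quotient.mk_eq_zero'] at h0
    exact h0
  have hfin : FiniteDimensional k (N' ⧸ K) :=
    Module.Finite.of_surjective (LieSubmodule.Quotient.mk' K : N' →ₗ[k] (N' ⧸ K))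
      (LieSubmodule.Quotient.surjective_mk' K)
  have hirr : ∀ U : Submodule k (N' ⧸ K), (∀ D, ∀ u ∈ U, ρ D u ∈ U) → U = ⊥ ∨ U = ⊤ := by
    intro U hU
    let M : LieSubmodule k W L :=
      { toSubmodule := (U.comap (LieSubmodule.Quotient.mk' K : N' →ₗ[k] (N' ⧸ K))).map
          N'.toSubmodule.subtype
        lie_mem := by
          rintro w _ ⟨⟨v, hvN⟩, hv, rfl⟩
          refine ⟨⟨⁅w, v⁆, N'.lie_mem hvN⟩, ?_, rfl⟩
          change LieSubmodule.Quotient.mk' K ⁅w, (⟨v, hvN⟩ : N')⁆ ∈ U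
          rw [LieModuleHom.map_lie]
          have := hU (φ.symm w) _ hv
          rw [hρa, LieEquiv.apply_symm_apply] at this
          exact this }
    have hM : ∀ v : N', (v : L) ∈ M ↔ LieSubmodule.Quotient.mk' K v ∈ U := by
      intro v
      constructor
      · rintro ⟨w, hw, hwv⟩
        rw [← Subtype.ext hwv]; exact hw
      · intro hv; exact ⟨v, hv, rfl⟩
    have hNM : N ≤ M := by
      intro v hv
      refine (hM ⟨v, h.le hv⟩).2 ?_
      have : LieSubmodule.Quotient.mk' K ⟨v, h.le hv⟩ = 0 := by
        rw [LieSubmodule.Quotient.mk'_apply, LieSubmodule.Quotient.mk_eq_zero']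
        exact hv
      rw [this]; exact U.zero_mem
    have hMN' : M ≤ N' := by
      rintro _ ⟨v, _, rfl⟩; exact v.2
    rcases h.eq_or_eq hNM hMN' with h1 | h1
    · left
      rw [eq_bot_iff]
      intro u hu
      obtain ⟨v, rfl⟩ := LieSubmodule.Quotient.surjective_mk' K u
      have h2 := (hM v).2 hu
      rw [h1] at h2
      rw [Submodule.mem_bot, LieSubmodule.Quotient.mk'_apply, LieSubmodule.Quotient.mk_eq_zero']
      exact h2
    · right
      rw [eq_top_iff]
      intro u _
      obtain ⟨v, rfl⟩ := LieSubmodule.Quotient.surjective_mk' K u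
      exact (hM v).1 (by rw [h1]; exact v.2)
  obtain ⟨r, hr, f, hf⟩ := Witt.exists_equiv_simple hρ
    (by
      rw [hrestr (Witt.del k p) 0 (by rw [Witt.ad_del_pow, map_zero]), map_zero])
    (fun a ha => ⟨p, by
      rw [hrestr (Witt.xpow k p a) 0 (by rw [Witt.ad_xpow_pow k p ha, map_zero]), map_zero]⟩)
    (hrestr _ _ (Witt.ad_xdel_pow k p)) hirr
  exact ⟨r, hr, f, hf⟩

/-- The composition factors of `L` as a module over a `p`-subalgebra `W ≅ W₁` are determined by the
dimensions of the weight spaces for the weights `0` and `1`, and by the dimensions of the kernel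
of `∂` on the other weight spaces. -/
theorem hasCompositionFactors_of_finrank (hW : IsPSubalgebra p W) (φ : Witt k p ≃ₗ⁅k⁆ W)
    {m : ℕ → ℕ}
    (hm : ∀ s, 0 < s → s + 1 < p →
      Module.finrank k (LinearMap.ker (LieAlgebra.ad k L (φ (Witt.del k p) : L)) ⊓
        (LieAlgebra.ad k L (φ (Witt.xdel k p) : L)).eigenspace ((s : k) + 1) : Submodule k L) = m s)
    (h0 : Module.finrank k ((LieAlgebra.ad k L (φ (Witt.xdel k p) : L)).eigenspace 0) =
      ∑ j ∈ Finset.range (p - 1), m j)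
    (h1 : Module.finrank k ((LieAlgebra.ad k L (φ (Witt.xdel k p) : L)).eigenspace 1) =
      ∑ j ∈ Finset.Ico 1 p, m j) :
    HasCompositionFactors φ m := by
  have hp2 := (Fact.out : p.Prime).two_le
  refine ⟨?_, fun s hs0 hs1 => ?_⟩
  -- In finite dimension some composition series exists; it is obtained by refining a one-term
  -- chain.
  · have := LieSubmodule.wellFoundedLT_of_isArtinian k W L
    obtain ⟨t, _, _, ht⟩ := LTSeries.exists_relSeries_covBy_and_head_eq_bot_and_last_eq_bot
      (RelSeries.singleton _ (⊥ : LieSubmodule k W L))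
    exact ⟨t, ht⟩
  have hstep : ∀ i : Fin s.length, ∃ r : Fin p, FactorIso φ (s i.castSucc) (s i.succ) r := by
    intro i
    obtain ⟨r, hr, h⟩ := exists_factorIso_of_covBy hW φ (s.step i)
    exact ⟨⟨r, hr⟩, h⟩
  choose r hr using hstep
  refine ⟨r, hr, ?_⟩
  set d := LieAlgebra.ad k L (φ (Witt.del k p) : L) with hd
  set h := LieAlgebra.ad k L (φ (Witt.xdel k p) : L) with hh
  have hhp : h ^ p = h := Witt.ad_pow_of_isPSubalgebra hW φ (Witt.ad_xdel_pow k p)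
  have hdp : d ^ p = 0 := by
    rw [hd, Witt.ad_pow_of_isPSubalgebra hW φ (E := 0) (by rw [Witt.ad_del_pow, map_zero])]
    simp
  have hcast : ∀ n : ℕ, (n : k) ^ p = n := fun n => by
    rw [← frobenius_def, map_natCast]
  choose g hg hgs hgl using fun i => (hr i).exists_linearMap
  have hle : ∀ i : Fin s.length, (s i.castSucc).toSubmodule ≤ (s i.succ).toSubmodule :=
    fun i => (s.step i).le
  have hst : ∀ (i : Fin s.length) (D : Witt k p), ∀ v ∈ (s i.succ).toSubmodule,
      LieAlgebra.ad k L (φ D : L) v ∈ (s i.succ).toSubmodule :=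
    fun i D v hv => (s i.succ).lie_mem (x := φ D) hv
  have hbot : (s.toFun 0).toSubmodule = ⊥ := by
    have : s.toFun 0 = ⊥ := hs0
    rw [this]; rfl
  have htop : (s.toFun (Fin.last _)).toSubmodule = ⊤ := by
    have : s.toFun (Fin.last _) = ⊤ := hs1
    rw [this]; rfl
  have hw : ∀ c : k, c ^ p = c → Module.finrank k (h.eigenspace c) =
      ∑ i, Module.finrank k (Module.End.eigenspace
        (LieModule.toEnd k (Witt k p) (SimpleWittModule k p (r i)) (Witt.xdel k p)) c) := by
    intro c hc
    have e : ∀ i : Fin s.length, _ := fun i =>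
      Subquotient.finrank_inf_eigenspace hhp (hle i) (hst i _) (hg i) (hgs i) (hgl i _) hc
    have e1 := Fin.le_add_sum_of_succ_le (fun i => Module.finrank k
      ((s i).toSubmodule ⊓ h.eigenspace c : Submodule k L)) _ fun i => (e i).le
    have e2 := Fin.add_sum_le_of_le_succ (fun i => Module.finrank k
      ((s i).toSubmodule ⊓ h.eigenspace c : Submodule k L)) _ fun i => (e i).ge
    beta_reduce at e1 e2
    rw [hbot, htop, bot_inf_eq, top_inf_eq, finrank_bot, zero_add] at e1 e2
    exact le_antisymm e1 e2
  have hcard : ∀ j : Fin p, (Finset.univ.filter fun i => r i = j).card =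
      ∑ i, if (r i : ℕ) = j then 1 else 0 := by
    intro j
    rw [Finset.card_filter]
    simp only [Fin.ext_iff]
  have hmid : ∀ j : Fin p, 0 < (j : ℕ) → (j : ℕ) + 1 < p →
      (Finset.univ.filter fun i => r i = j).card = m j := by
    intro j hj0 hj1
    rw [hcard, ← hm j hj0 hj1]
    apply le_antisymm
    -- Lower bound for the kernel: the factors isomorphic to `L(j)` contribute to the rank of `d ^
    -- (p - 1)` on weight `j`, whose image lies in `ker d` and in weight `j - (p - 1) = j + 1`.
    · have e := Fin.add_sum_le_of_le_succ (fun i => Module.finrank k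
        (((s i).toSubmodule ⊓ h.eigenspace (j : k)).map (d ^ (p - 1))))
        (fun i => if (r i : ℕ) = j then 1 else 0) fun i =>
          (Nat.add_le_add_left (Verma.le_finrank_map_del_pow_eigenspace k p (r i).2 hj0 hj1) _).trans
            (Subquotient.finrank_map_pow_le hhp (hle i) (hst i _) (hst i _) (hg i) (hgs i)
              (hgl i _) (hgl i _) (hcast j) (p - 1))
      beta_reduce at e
      rw [hbot, htop, bot_inf_eq, top_inf_eq, Submodule.map_bot, finrank_bot, zero_add] at e
      refine e.trans (Submodule.finrank_mono ?_)
      have hcomm : ∀ v, h (d v) = d (h v) - d v := by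
        intro v
        have e1 : ⁅Witt.xdel k p, Witt.del k p⁆ = (-1 : k) • Witt.del k p := by
          rw [← Witt.xpow_one, ← Witt.xpow_zero, Witt.lie_xpow]
          simp
        have e2 : ⁅(φ (Witt.xdel k p) : L), (φ (Witt.del k p) : L)⁆ = -(φ (Witt.del k p) : L) := by
          rw [← LieSubalgebra.coe_bracket, ← LieEquiv.map_lie, e1, map_smul, neg_one_smul]
          rfl
        simp only [hd, hh, LieAlgebra.ad_apply]
        rw [leibniz_lie, e2, neg_lie]; abel
      have hwt : ∀ (n : ℕ) v, h v = (j : k) • v → h ((d ^ n) v) = ((j : k) - n) • (d ^ n) v := by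
        intro n v hv
        induction n with
        | zero => simp [hv]
        | succ n ih =>
          rw [pow_succ', Module.End.mul_apply, hcomm, ih, map_smul, Nat.cast_succ]
          module
      rintro _ ⟨v, hv, rfl⟩
      rw [SetLike.mem_coe, Module.End.mem_eigenspace_iff] at hv
      refine ⟨?_, ?_⟩
      · rw [SetLike.mem_coe, LinearMap.mem_ker, ← Module.End.mul_apply, ← pow_succ',
          Nat.sub_add_cancel (by omega), hdp, LinearMap.zero_apply]
      · rw [SetLike.mem_coe, Module.End.mem_eigenspace_iff, hwt _ _ hv]
        congr 1
        have := Verma.natCast_pred_add_one k p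
        rw [sub_eq_iff_eq_add, add_assoc, add_comm 1, this, add_zero]
    -- Upper bound for the kernel: only factors `L(j)` have a vector of weight `j + 1` killed by
    -- `∂`.
    · have e := Fin.le_add_sum_of_succ_le (fun i => Module.finrank k
        ((s i).toSubmodule ⊓ (LinearMap.ker d ⊓ h.eigenspace ((j : k) + 1)) : Submodule k L))
        (fun i => if (r i : ℕ) = j then 1 else 0) fun i =>
          (Subquotient.finrank_inf_ker_inf_eigenspace_le (hle i) (hg i)
              (hgl i _) (hgl i _) _).trans
          (Nat.add_le_add_left (Verma.finrank_ker_del_inf_eigenspace_le k p (r i).2 hj0 hj1) _)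
      beta_reduce at e
      rwa [hbot, htop, bot_inf_eq, top_inf_eq, finrank_bot, zero_add] at e
  have hsum : ∀ (A : Finset ℕ), (∑ i, if (r i : ℕ) ∈ A then 1 else 0) =
      ∑ j ∈ A, ∑ i, if (r i : ℕ) = j then 1 else 0 := by
    intro A
    rw [Finset.sum_comm]
    exact Finset.sum_congr rfl fun i _ => by rw [Finset.sum_ite_eq]
  have hmid' : ∀ j, 0 < j → j + 1 < p → (∑ i, if (r i : ℕ) = j then 1 else 0) = m j := by
    intro j hj0 hj1
    rw [← hmid ⟨j, by omega⟩ hj0 hj1, hcard]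
  -- A total over `A` yields the multiplicity at the single index `a` for which no direct formula is
  -- available. It is used for `a = 0` with the factors seen by weight `0`, and for `a = p - 1` with
  -- those seen by weight `1`.
  have hend : ∀ (A : Finset ℕ) (a : ℕ), a ∈ A → (∀ j ∈ A, j ≠ a → 0 < j ∧ j + 1 < p) →
      (∑ i, if (r i : ℕ) ∈ A then 1 else 0) = ∑ j ∈ A, m j →
      (∑ i, if (r i : ℕ) = a then 1 else 0) = m a := by
    intro A a ha hA e
    have e1 : m a + ∑ j ∈ A.erase a, m j = ∑ j ∈ A, m j := Finset.add_sum_erase _ _ ha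
    rw [hsum, ← Finset.add_sum_erase _ _ ha, ← e1] at e
    rw [Finset.sum_congr rfl fun j hj => hmid' j
      (hA j (Finset.mem_of_mem_erase hj) (Finset.ne_of_mem_erase hj)).1
      (hA j (Finset.mem_of_mem_erase hj) (Finset.ne_of_mem_erase hj)).2] at e
    exact Nat.add_right_cancel e
  intro j
  by_cases hj0 : (j : ℕ) = 0
  · rw [hcard, hj0]
    refine hend (Finset.range (p - 1)) 0 (by simp; omega) (fun i hi hi' => ?_) ?_
    · simp at hi; omega
    · rw [← h0, hw 0 (zero_pow (by omega))]
      refine Finset.sum_congr rfl fun i _ => ?_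
      rw [Verma.finrank_eigenspace_zero k p (r i).2]
      have := (r i).2
      simp only [Finset.mem_range]
      split_ifs <;> omega
  by_cases hj1 : (j : ℕ) + 1 < p
  · exact hmid j (by omega) hj1
  · have hjp : (j : ℕ) = p - 1 := by omega
    rw [hcard, hjp]
    refine hend (Finset.Ico 1 p) (p - 1) (by simp; omega) (fun i hi hi' => ?_) ?_
    · simp at hi; omega
    · rw [← h1, hw 1 (one_pow _)]
      refine Finset.sum_congr rfl fun i _ => ?_
      rw [Verma.finrank_eigenspace_one k p (r i).2]
      have := (r i).2
      simp only [Finset.mem_Ico]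
      split_ifs <;> omega

end

/-! ### Certified enumeration of the roots by decimal codes. -/

namespace SimplyLaced

variable {n : ℕ}

/-- The vector whose coordinates are the `n` decimal digits of `z`. -/
def digits (n z : ℕ) (i : Fin n) : ℤ := ((z / 10 ^ (n - 1 - i.val) % 10 : ℕ) : ℤ)

/-- The code of the `i`-th basis vector. -/
def unitCode (n : ℕ) (i : Fin n) : ℕ := 10 ^ (n - 1 - i.val)

/-- The standard inner product of two vectors. -/
def dot (a v : Fin n → ℤ) : ℤ := ((List.finRange n).map fun i => a i * v i).sum

/-- The number with (signed) decimal digits `v`. -/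
def code (v : Fin n → ℤ) : ℤ := dot v fun i => unitCode n i

/-- Membership in a list of natural numbers. -/
def memCode (a : ℕ) : List ℕ → Bool
  | [] => false
  | b :: l => bif Nat.beq a b then true else memCode a l

/-- Absence of duplicates in a list of natural numbers. -/
def nodupCodes : List ℕ → Bool
  | [] => true
  | b :: l => bif memCode b l then false else nodupCodes l

theorem memCode_iff {a : ℕ} {l : List ℕ} : memCode a l = true ↔ a ∈ l := by
  induction l with
  | nil => simp [memCode]
  | cons b l ih =>
    rw [memCode, List.mem_cons, ← ih]
    by_cases h : a = b
    · simp [h]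
    · have : Nat.beq a b = false := by
        rw [← Bool.not_eq_true]
        exact fun h' => h (Nat.eq_of_beq_eq_true h')
      simp [this, h]

theorem nodup_of_nodupCodes {l : List ℕ} (h : nodupCodes l = true) : l.Nodup := by
  induction l with
  | nil => exact List.nodup_nil
  | cons b l ih =>
    rw [nodupCodes] at h
    cases hm : memCode b l with
    | true => simp [hm] at h
    | false =>
      rw [hm] at h
      refine List.nodup_cons.2 ⟨fun hb => ?_, ih h⟩
      rw [memCode_iff.2 hb] at hm
      exact absurd hm (by simp)

theorem dot_eq_sum (a v : Fin n → ℤ) : dot a v = ∑ i, a i * v i := by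
  rw [dot, Fin.sum_univ_def]

theorem dot_add_right (a v w : Fin n → ℤ) : dot a (v + w) = dot a v + dot a w := by
  simp only [dot_eq_sum, Pi.add_apply, mul_add, Finset.sum_add_distrib]

theorem dot_neg_right (a v : Fin n → ℤ) : dot a (-v) = -dot a v := by
  simp only [dot_eq_sum, Pi.neg_apply, mul_neg, Finset.sum_neg_distrib]

theorem dot_single (a : Fin n → ℤ) (j : Fin n) : dot a (Pi.single j 1) = a j := by
  simp [dot_eq_sum, Pi.single_apply]

variable (A : Matrix (Fin n) (Fin n) ℤ)

theorem form_single_left (j : Fin n) (v : Fin n → ℤ) : form A (Pi.single j 1) v = dot (A j) v := by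
  simp [form, dot_eq_sum, Pi.single_apply]

theorem form_eq_dot (v w : Fin n → ℤ) : form A v w = dot v fun i => dot (A i) w := by
  rw [form_eq_sum_left, dot_eq_sum]
  simp only [form_single_left]

/-- `P` is the list of the codes of the positive roots: all of its members are roots, it contains
the simple roots, and it is closed under the addition of a simple root. -/
def isRootList (P : List ℕ) : Bool :=
  nodupCodes P &&
  ((List.finRange n).all fun i => (List.finRange n).all fun j =>
    decide (i = j) || decide (A i j ≤ 0)) &&
  ((List.finRange n).all fun j => memCode (unitCode n j) P &&
    (List.finRange n).all fun i =>
      decide (digits n (unitCode n j) i = (Pi.single j 1 : Fin n → ℤ) i)) &&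
  P.all fun z => decide (code (digits n z) = z) &&
    decide (dot (digits n z) (fun i => dot (A i) (digits n z)) = 2) &&
    (List.finRange n).all fun j => !decide (dot (A j) (digits n z) = -1) ||
      (memCode (z + unitCode n j) P && (List.finRange n).all fun i =>
        decide (digits n (z + unitCode n j) i = digits n z i + (Pi.single j 1 : Fin n → ℤ) i))

variable {A} {P : List ℕ}

theorem digits_nonneg (z : ℕ) : 0 ≤ digits n z := fun _ => Int.natCast_nonneg _

/-- Decimal addition may carry, so the compatibility of `digits` with adding a simple root is one of
the tested facts and not a general law. -/
theorem isRootList.spec (h : isRootList A P = true) : P.Nodup ∧ (∀ i j, i ≠ j → A i j ≤ 0) ∧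
    (∀ j, unitCode n j ∈ P ∧ digits n (unitCode n j) = Pi.single j 1) ∧
    ∀ z ∈ P, code (digits n z) = z ∧ form A (digits n z) (digits n z) = 2 ∧
      ∀ j, dot (A j) (digits n z) = -1 → z + unitCode n j ∈ P ∧
        digits n (z + unitCode n j) = digits n z + Pi.single j 1 := by
  simp only [isRootList, Bool.and_eq_true, List.all_eq_true, Bool.or_eq_true, decide_eq_true_eq,
    List.mem_finRange, true_imp_iff, memCode_iff, Bool.not_eq_true', decide_eq_false_iff_not] at h
  obtain ⟨⟨⟨h1, h2⟩, h3⟩, h4⟩ := h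
  refine ⟨nodup_of_nodupCodes h1, fun i j hij => (h2 i j).resolve_left hij,
    fun j => ⟨(h3 j).1, funext (h3 j).2⟩, fun z hz => ?_⟩
  obtain ⟨⟨h5, h6⟩, h7⟩ := h4 z hz
  refine ⟨h5, by rw [form_eq_dot]; exact h6, fun j hj => ?_⟩
  obtain ⟨h8, h9⟩ := (h7 j).resolve_left (not_not_intro hj)
  exact ⟨h8, funext h9⟩

theorem form_zero_right (v : Fin n → ℤ) : form A v 0 = 0 := by simp [form]

variable (n) in
/-- The list of the vectors with codes in `P` and of their opposites. -/
def signedVectors (P : List ℕ) : List (Fin n → ℤ) :=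
  P.map (digits n) ++ P.map fun z => -digits n z

theorem nodup_signedVectors (h : isRootList A P = true) : (signedVectors n P).Nodup := by
  obtain ⟨h1, -, -, h4⟩ := isRootList.spec h
  have hinj : ∀ z ∈ P, ∀ z' ∈ P, digits n z = digits n z' → z = z' := by
    intro z hz z' hz' he
    have := (h4 z hz).1
    rw [he, (h4 z' hz').1] at this
    exact_mod_cast this.symm
  refine List.Nodup.append (h1.map_on hinj)
    (h1.map_on fun z hz z' hz' he => hinj z hz z' hz' (neg_injective he)) ?_
  intro v hv hv'
  obtain ⟨z, hz, rfl⟩ := List.mem_map.1 hv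
  obtain ⟨z', hz', he⟩ := List.mem_map.1 hv'
  have h0 : digits n z = 0 := by
    funext i
    have h5 := congrFun he i
    have h6 := digits_nonneg (n := n) z i
    have h7 := digits_nonneg (n := n) z' i
    simp only [Pi.neg_apply, Pi.zero_apply] at h5 h6 h7 ⊢
    omega
  have := (h4 z hz).2.1
  rw [h0, form_zero_right] at this
  omega

variable [EvenPosDef A]

/-- The form is positive, and it is even because `(v, v) = 2 η(v, v)`. -/
theorem two_le_form {v : Fin n → ℤ} (hv : v ≠ 0) : 2 ≤ form A v v := by
  have h1 := eta_add_eta A v v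
  have h2 : 0 < form A v v := EvenPosDef.pos (A := A) v hv
  omega

variable (A) in
/-- The simple roots. -/
def simpleRoot (i : Fin n) : Root A :=
  ⟨Pi.single i 1, by rw [form_single, EvenPosDef.diag (A := A)]⟩

theorem form_sub_single (v : Fin n → ℤ) (hv : form A v v = 2) (j : Fin n) :
    form A (v - Pi.single j 1) (v - Pi.single j 1) = 4 - 2 * dot (A j) v := by
  have h1 := form_add_left A v (-Pi.single j 1) (v - Pi.single j 1)
  have h2 := fun u => form_add_right A u v (-Pi.single j 1)
  simp only [← sub_eq_add_neg] at h1 h2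
  rw [h1, h2, h2, form_neg_left, form_neg_left, form_neg_right, form_neg_right, hv,
    form_comm A v, form_single_left, form_single, EvenPosDef.diag (A := A)]
  ring

/-- Descent on the height. As `(v, v) > 0`, some `α_j` in the support of `v` has positive product
with `v`. If the product is `2`, then `v = α_j`; if it is `1`, then `v - α_j` is a smaller
nonnegative root, and the closure property of the list leads back to `v`. -/
theorem exists_digits_of_nonneg (h : isRootList A P = true) {v : Fin n → ℤ}
    (hv : form A v v = 2) (h0 : 0 ≤ v) : ∃ z ∈ P, digits n z = v := by
  obtain ⟨-, -, h3, h4⟩ := isRootList.spec h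
  have key : ∀ m : ℕ, ∀ v : Fin n → ℤ, form A v v = 2 → 0 ≤ v → ∑ i, v i = m →
      ∃ z ∈ P, digits n z = v := by
    intro m
    induction m with
    | zero =>
      intro v hv h0 hs
      have : v = 0 := by
        rw [Nat.cast_zero, Finset.sum_eq_zero_iff_of_nonneg fun i _ => h0 i] at hs
        exact funext fun i => hs i (Finset.mem_univ i)
      rw [this, form_zero_right] at hv
      omega
    | succ m ih =>
      intro v hv h0 hs
      obtain ⟨j, hj0, hj⟩ : ∃ j, 0 < v j ∧ 0 < dot (A j) v := by
        by_contra! hcon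
        have : form A v v ≤ 0 := by
          rw [form_eq_dot, dot_eq_sum]
          refine Finset.sum_nonpos fun i _ => ?_
          rcases (h0 i).eq_or_lt with hi | hi
          · rw [← hi]; simp
          · exact mul_nonpos_of_nonneg_of_nonpos hi.le (hcon i hi)
        omega
      have h2 := le_two A (simpleRoot A j) ⟨v, hv⟩
      simp only [simpleRoot, form_single_left] at h2
      obtain h5 | h5 : dot (A j) v = 1 ∨ dot (A j) v = 2 := by omega
      · have hu := form_sub_single v hv j
        rw [h5] at hu
        obtain ⟨z, hz, hzv⟩ := ih (v - Pi.single j 1) (by rw [hu]; norm_num) (fun i => by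
            have := h0 i
            by_cases hij : i = j
            · subst hij; simp; omega
            · simpa [hij] using this) (by
            simp only [Pi.sub_apply, Finset.sum_sub_distrib, hs]
            simp)
        have h6 : dot (A j) (digits n z) = -1 := by
          have h7 := dot_add_right (A j) (v - Pi.single j 1) (Pi.single j 1)
          rw [sub_add_cancel, h5, dot_single, EvenPosDef.diag (A := A)] at h7
          rw [hzv]; omega
        obtain ⟨h8, h9⟩ := (h4 z hz).2.2 j h6
        exact ⟨_, h8, by rw [h9, hzv, sub_add_cancel]⟩
      · have h6 := eq_of_form_eq_two A (simpleRoot A j) ⟨v, hv⟩ (by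
          simp only [simpleRoot, form_single_left, h5])
        have h7 : v = Pi.single j 1 := (congrArg Subtype.val h6).symm
        exact ⟨_, (h3 j).1, by rw [(h3 j).2, h7]⟩
  have hs : 0 ≤ ∑ i, v i := Finset.sum_nonneg fun i _ => h0 i
  exact key (∑ i, v i).toNat v hv h0 (by omega)

/-- Write `v = a - b` with `a`, `b` nonnegative of disjoint supports. Then `(a, b) ≤ 0`, so if both
were nonzero, `(v, v) ≥ (a, a) + (b, b) ≥ 4`. -/
theorem nonneg_or_nonpos_of_root (hA : ∀ i j, i ≠ j → A i j ≤ 0) {v : Fin n → ℤ}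
    (hv : form A v v = 2) : 0 ≤ v ∨ 0 ≤ -v := by
  set a : Fin n → ℤ := fun i => max (v i) 0 with ha
  set b : Fin n → ℤ := fun i => max (-v i) 0 with hb
  have hab : v = a + -b := by
    funext i
    simp only [ha, hb, Pi.add_apply, Pi.neg_apply]
    omega
  have hneg : form A a b ≤ 0 := by
    refine Finset.sum_nonpos fun i _ => Finset.sum_nonpos fun j _ => ?_
    by_cases hij : i = j
    · subst hij
      have : a i = 0 ∨ b i = 0 := by simp only [ha, hb]; omega
      rcases this with h | h <;> simp [h]
    · exact mul_nonpos_of_nonpos_of_nonneg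
        (mul_nonpos_of_nonneg_of_nonpos (le_max_right _ _) (hA i j hij)) (le_max_right _ _)
  have hexp : form A v v = form A a a + form A b b - 2 * form A a b := by
    rw [hab, form_add_left, form_add_right, form_add_right, form_neg_left, form_neg_left,
      form_neg_right, form_neg_right, form_comm A b a]
    ring
  by_cases h1 : b = 0
  · left
    rw [hab, h1]
    intro i
    simp [ha]
  by_cases h2 : a = 0
  · right
    rw [hab, h2]
    intro i
    simp [hb]
  have h3 := two_le_form (A := A) h1
  have h4 := two_le_form (A := A) h2
  omega

theorem mem_signedVectors (h : isRootList A P = true) (v : Fin n → ℤ) :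
    v ∈ signedVectors n P ↔ form A v v = 2 := by
  obtain ⟨-, h2, -, h4⟩ := isRootList.spec h
  rw [signedVectors, List.mem_append, List.mem_map, List.mem_map]
  constructor
  · rintro (⟨z, hz, rfl⟩ | ⟨z, hz, rfl⟩)
    · exact (h4 z hz).2.1
    · rw [form_neg_left, form_neg_right, neg_neg]; exact (h4 z hz).2.1
  · intro hv
    rcases nonneg_or_nonpos_of_root h2 hv with h0 | h0
    · exact Or.inl (exists_digits_of_nonneg h hv h0)
    · obtain ⟨z, hz, hzv⟩ := exists_digits_of_nonneg h (v := -v)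
        (by rw [form_neg_left, form_neg_right, neg_neg]; exact hv) h0
      exact Or.inr ⟨z, hz, by rw [hzv, neg_neg]⟩

theorem finite_root (h : isRootList A P = true) : Finite (Root A) := by
  have : {v : Fin n → ℤ | form A v v = 2} = ↑(signedVectors n P).toFinset := by
    ext v; simp [mem_signedVectors h]
  have hfin : {v : Fin n → ℤ | form A v v = 2}.Finite := by
    rw [this]; exact Finset.finite_toSet _
  exact hfin

/-- Counting roots by means of their codes. -/
theorem ncard_root (h : isRootList A P = true) (Q : (Fin n → ℤ) → Prop) (q q' : ℕ → Bool)
    (hq : ∀ z, q z = true ↔ Q (digits n z)) (hq' : ∀ z, q' z = true ↔ Q (-digits n z)) :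
    {β : Root A | Q β.1}.ncard = P.countP q + P.countP q' := by
  classical
  have h1 : {β : Root A | Q β.1}.ncard =
      ((fun β : Root A => β.1) '' {β : Root A | Q β.1}).ncard :=
    (Set.ncard_image_of_injective _ Subtype.val_injective).symm
  have h2 : (fun β : Root A => β.1) '' {β : Root A | Q β.1} =
      ↑((signedVectors n P).filter fun v => decide (Q v)).toFinset := by
    ext v
    simp only [Set.mem_image, Set.mem_ofPred_eq, Subtype.exists, exists_and_left, exists_prop,
      exists_eq_right_right, List.coe_toFinset, List.mem_filter, mem_signedVectors h,
      decide_eq_true_eq]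
    tauto
  rw [h1, h2, Set.ncard_coe_finset, List.toFinset_card_of_nodup ((nodup_signedVectors h).filter _),
    ← List.countP_eq_length_filter, signedVectors, List.countP_append, List.countP_map,
    List.countP_map]
  congr 1
  · refine List.countP_congr fun z _ => ?_
    simp [hq]
  · refine List.countP_congr fun z _ => ?_
    simp [hq']

end SimplyLaced

/-! ### Elimination certificates for the equations of the centralizer. -/

namespace SimplyLaced

variable {n : ℕ}

/-- The vector with code `z`, or its opposite. -/
def signedDigits (n : ℕ) (pos : Bool) (z : ℕ) (i : Fin n) : ℤ :=
  bif pos then digits n z i else -digits n z i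

/-- The code of the sum of a vector (of given sign) and a simple root. -/
def addCode (n : ℕ) (pos : Bool) (z : ℕ) (i : Fin n) : ℕ :=
  bif pos then z + unitCode n i else z - unitCode n i

/-- The code of the difference of a vector (of given sign) and a simple root. -/
def subCode (n : ℕ) (pos : Bool) (z : ℕ) (i : Fin n) : ℕ :=
  bif pos then z - unitCode n i else z + unitCode n i

/-- The vector with code `t` is the sum of the one with code `z` and the `i`-th simple root. -/
def isSum (pos : Bool) (z t : ℕ) (i : Fin n) : Bool :=
  (List.finRange n).all fun j =>
    decide (signedDigits n pos t j = signedDigits n pos z j + (Pi.single i 1 : Fin n → ℤ) j)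

theorem signedDigits_true (z : ℕ) : signedDigits n true z = digits n z := rfl

theorem signedDigits_false (z : ℕ) : signedDigits n false z = -digits n z := rfl

theorem eq_add_of_isSum {pos : Bool} {z t : ℕ} {i : Fin n} (h : isSum pos z t i = true) :
    signedDigits n pos t = signedDigits n pos z + Pi.single i 1 := by
  simp only [isSum, List.all_eq_true, List.mem_finRange, true_imp_iff, decide_eq_true_eq] at h
  exact funext h

variable (A : Matrix (Fin n) (Fin n) ℤ) (J : List (Fin n)) (pos : Bool)

/-- Given the coordinates with codes in `K`, the equations for a vector in the centralizer of
`∑ j ∈ J, e_{α_j}` determine successively the coordinates with codes in the second list. -/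
def solves : List ℕ → List ℕ → Bool
  | _, [] => true
  | K, b :: S =>
    (J.any fun j => decide (dot (A j) (signedDigits n pos b) = -1) &&
      isSum pos b (addCode n pos b j) j &&
      J.all fun i => decide (i = j) ||
        !decide (dot (A i) (signedDigits n pos (addCode n pos b j)) = 1) ||
        (memCode (subCode n pos (addCode n pos b j) i) K &&
          isSum pos (subCode n pos (addCode n pos b j) i) (addCode n pos b j) i)) &&
    solves (b :: K) S

/-- The sign `ε(α_i, v)`. -/
def simpleSgn (i : Fin n) (v : Fin n → ℤ) : ℤ :=
  bif decide (dot (fun j => bif decide (j < i) then A i j else bif decide (j = i) then 1 else 0) v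
    % 2 = 0) then 1 else -1

/-- The terms of the equation of the centralizer at the root with code `t`. -/
def eqTerms (c : ℤ) (t : ℕ) : List (ℤ × ℕ) :=
  (J.filter fun i => decide (dot (A i) (signedDigits n pos t) = 1)).map fun i =>
    (c * simpleSgn A i (signedDigits n pos (subCode n pos t i)), subCode n pos t i)

/-- The coefficient at `z` of a formal linear combination. -/
def coeffAt (T : List (ℤ × ℕ)) (z : ℕ) : ℤ :=
  (T.map fun t => bif Nat.beq t.2 z then t.1 else 0).sum

/-- The linear combination of equations described by `L` has the form `a X_b = 0`, with `a` not
divisible by `p`. -/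
def isolates (p : ℕ) (P : List ℕ) (b : ℕ) (L : List (ℤ × ℕ)) : Bool :=
  (L.all fun t => memCode t.2 P && J.all fun i =>
    !decide (dot (A i) (signedDigits n pos t.2) = 1) ||
      isSum pos (subCode n pos t.2 i) t.2 i) &&
  !decide (coeffAt (L.flatMap fun t => eqTerms A J pos t.1 t.2) b % p = 0) &&
  (L.flatMap fun t => eqTerms A J pos t.1 t.2).all fun t => Nat.beq t.2 b ||
    decide (coeffAt (L.flatMap fun t => eqTerms A J pos t.1 t.2) t.2 = 0)

variable {A J pos}

theorem eta_single_left (i : Fin n) (v : Fin n → ℤ) : eta A (Pi.single i 1) v =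
    dot (fun j => bif decide (j < i) then A i j else bif decide (j = i) then 1 else 0) v := by
  have h : ∀ j : Fin n, (bif decide (j < i) then A i j else bif decide (j = i) then 1 else 0) * v j
      = (if j = i then v j else 0) + if j < i then A i j * v j else 0 := by
    intro j
    rcases lt_trichotomy j i with h | h | h
    · simp [h, h.ne]
    · simp [h]
    · simp [h.ne', h.not_gt]
  rw [dot_eq_sum]
  simp only [h, Finset.sum_add_distrib, eta]
  congr 1
  · simp [Pi.single_apply]
  · rw [Finset.sum_eq_single i]
    · simp
    · intro j _ hj
      simp [hj]
    · simp

theorem simpleSgn_eq (i : Fin n) (v : Fin n → ℤ) : simpleSgn A i v = sgn A (Pi.single i 1) v := by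
  rw [simpleSgn, ← eta_single_left, sgn]
  by_cases h : eta A (Pi.single i 1) v % 2 = 0
  · rw [Int.negOnePow_even _ (Int.even_iff.2 h)]
    simp [h]
  · rw [Int.negOnePow_odd _ (Int.odd_iff.2 (by omega))]
    simp [h]

theorem sum_eq_sum_coeffAt {k : Type*} [Field k] (f : ℕ → k) (T : List (ℤ × ℕ)) (S : Finset ℕ)
    (hS : ∀ t ∈ T, t.2 ∈ S) :
    (T.map fun t => (t.1 : k) * f t.2).sum = ∑ z ∈ S, (coeffAt T z : k) * f z := by
  induction T with
  | nil => simp [coeffAt]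
  | cons t T ih =>
    have h : ∀ z, (coeffAt (t :: T) z : k) * f z =
        (if t.2 = z then (t.1 : k) * f z else 0) + (coeffAt T z : k) * f z := by
      intro z
      by_cases hz : t.2 = z
      · simp [coeffAt, hz, add_mul]
      · have : Nat.beq t.2 z = false := by
          rw [← Bool.not_eq_true]
          exact fun h' => hz (Nat.eq_of_beq_eq_true h')
        simp [coeffAt, hz, this]
    rw [List.map_cons, List.sum_cons, ih fun t ht => hS t (List.mem_cons_of_mem _ ht)]
    simp only [h, Finset.sum_add_distrib, Finset.sum_ite_eq, if_pos (hS t List.mem_cons_self)]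

theorem form_signedDigits {P : List ℕ} (h : isRootList A P = true) {z : ℕ} (hz : z ∈ P) :
    form A (signedDigits n pos z) (signedDigits n pos z) = 2 := by
  have h1 := ((isRootList.spec h).2.2.2 z hz).2.1
  cases pos
  · rw [signedDigits_false, form_neg_left, form_neg_right, neg_neg, h1]
  · exact h1

theorem sgn_ne_zero {k : Type*} [Field k] (v w : Fin n → ℤ) : (sgn A v w : k) ≠ 0 := by
  intro h
  have := congrArg (Int.cast (R := k)) (sgn_mul_self A v w)
  rw [Int.cast_mul, h] at this
  simp at this

variable [EvenPosDef A] {k : Type*} [Field k] {X : (Fin n → ℤ) → k} {P : List ℕ}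

theorem sub_single_eq_zero (hX0 : ∀ v, form A v v ≠ 2 → X v = 0) {v : Fin n → ℤ}
    (hv : form A v v = 2) {i : Fin n} (hi : dot (A i) v ≠ 1) : X (v - Pi.single i 1) = 0 := by
  refine hX0 _ fun h => hi ?_
  rw [form_sub_single v hv] at h
  omega

/-- The equation at the root `t = b + α_j` contains `X b` with coefficient `±1`. All its other terms
are either attached to non-roots `t - α_i` or already known to vanish. -/
theorem solves.spec (hP : isRootList A P = true) (hX0 : ∀ v, form A v v ≠ 2 → X v = 0)
    (hX : ∀ v, form A v v = 2 → (J.map fun i =>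
      (sgn A (Pi.single i 1) (v - Pi.single i 1) : k) * X (v - Pi.single i 1)).sum = 0)
    (hJ : J.Nodup) {S K : List ℕ} (h : solves A J pos K S = true) (hS : ∀ z ∈ S, z ∈ P)
    (hK : ∀ z ∈ K, X (signedDigits n pos z) = 0) :
    ∀ z ∈ S, X (signedDigits n pos z) = 0 := by
  induction S generalizing K with
  | nil => simp
  | cons b S ih =>
    simp only [solves, Bool.and_eq_true, List.any_eq_true, decide_eq_true_eq, List.all_eq_true,
      Bool.or_eq_true, Bool.not_eq_true', decide_eq_false_iff_not, memCode_iff] at h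
    obtain ⟨⟨j, hj, ⟨hjb, hsum⟩, hall⟩, h⟩ := h
    have hb : X (signedDigits n pos b) = 0 := by
      have ht := eq_add_of_isSum hsum
      set t := addCode n pos b j
      have hroot : form A (signedDigits n pos t) (signedDigits n pos t) = 2 := by
        have hb2 := form_signedDigits (pos := pos) hP (hS b List.mem_cons_self)
        have := (add_root_iff A ⟨_, hb2⟩ (simpleRoot A j)).2 (by
          rw [form_comm]
          exact (form_single_left A j _).trans hjb)
        rw [ht]
        exact this
      have h1 := hX _ hroot
      rw [List.sum_map_eq_nsmul_single j, hJ.count, if_pos hj, one_smul] at h1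
      · rw [ht, add_sub_cancel_right] at h1
        exact (mul_eq_zero.1 h1).resolve_left (sgn_ne_zero _ _)
      · intro i hij hi
        rcases hall i hi with (h2 | h2) | ⟨h2, h3⟩
        · exact absurd h2 hij
        · rw [sub_single_eq_zero hX0 hroot h2, mul_zero]
        · rw [eq_add_of_isSum h3, add_sub_cancel_right, hK _ h2, mul_zero]
    intro z hz
    rcases List.mem_cons.1 hz with rfl | hz
    · exact hb
    · refine ih h (fun z hz => hS z (List.mem_cons_of_mem _ hz)) (fun z hz => ?_) z hz
      rcases List.mem_cons.1 hz with rfl | hz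
      · exact hb
      · exact hK z hz

theorem sum_eqTerms (hX0 : ∀ v, form A v v ≠ 2 → X v = 0)
    (hX : ∀ v, form A v v = 2 → (J.map fun i =>
      (sgn A (Pi.single i 1) (v - Pi.single i 1) : k) * X (v - Pi.single i 1)).sum = 0)
    {t : ℕ} (ht : form A (signedDigits n pos t) (signedDigits n pos t) = 2)
    (h : ∀ i ∈ J, dot (A i) (signedDigits n pos t) = 1 → isSum pos (subCode n pos t i) t i = true)
    (c : ℤ) :
    ((eqTerms A J pos c t).map fun t => (t.1 : k) * X (signedDigits n pos t.2)).sum = 0 := by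
  have key : ∀ J' : List (Fin n), (∀ i ∈ J', i ∈ J) →
      ((eqTerms A J' pos c t).map fun t => (t.1 : k) * X (signedDigits n pos t.2)).sum =
      c * (J'.map fun i => (sgn A (Pi.single i 1) (signedDigits n pos t - Pi.single i 1) : k) *
        X (signedDigits n pos t - Pi.single i 1)).sum := by
    intro J' hJ'
    induction J' with
    | nil => simp [eqTerms]
    | cons i J' ih =>
      specialize ih fun i hi => hJ' i (List.mem_cons_of_mem _ hi)
      rw [List.map_cons, List.sum_cons, mul_add, ← ih]
      by_cases hi : dot (A i) (signedDigits n pos t) = 1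
      · have h1 := eq_add_of_isSum (h i (hJ' i List.mem_cons_self) hi)
        rw [← sub_eq_iff_eq_add] at h1
        rw [h1, eqTerms, List.filter_cons_of_pos (by simpa using hi), List.map_cons, List.map_cons,
          List.sum_cons, simpleSgn_eq, ← eqTerms]
        push_cast
        ring
      · rw [sub_single_eq_zero hX0 ht hi, eqTerms, List.filter_cons_of_neg (by simpa using hi),
          ← eqTerms]
        ring
  rw [key J fun _ h => h, hX _ ht, mul_zero]

/-- After collecting terms, the combination has integer coefficient zero at every code but `b`. This
is where the characteristic enters: the coefficient at `b` need not be `±1`, only prime to `p`. -/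
theorem isolates.spec {p : ℕ} [CharP k p] (hP : isRootList A P = true)
    (hX0 : ∀ v, form A v v ≠ 2 → X v = 0)
    (hX : ∀ v, form A v v = 2 → (J.map fun i =>
      (sgn A (Pi.single i 1) (v - Pi.single i 1) : k) * X (v - Pi.single i 1)).sum = 0)
    {b : ℕ} {L : List (ℤ × ℕ)} (h : isolates A J pos p P b L = true) :
    X (signedDigits n pos b) = 0 := by
  simp only [isolates, Bool.and_eq_true, decide_eq_true_eq, List.all_eq_true,
      Bool.or_eq_true, Bool.not_eq_true', decide_eq_false_iff_not, memCode_iff] at h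
  obtain ⟨⟨h1, h2⟩, h3⟩ := h
  have h4 : ∀ L' : List (ℤ × ℕ), (∀ t ∈ L', t ∈ L) →
      ((L'.flatMap fun t => eqTerms A J pos t.1 t.2).map
        fun t => (t.1 : k) * X (signedDigits n pos t.2)).sum = 0 := by
    intro L' hL'
    induction L' with
    | nil => simp
    | cons t L' ih =>
      obtain ⟨h5, h6⟩ := h1 t (hL' t List.mem_cons_self)
      rw [List.flatMap_cons, List.map_append, List.sum_append,
        sum_eqTerms hX0 hX (form_signedDigits hP h5) fun i hi hi1 =>
          (h6 i hi).resolve_left (not_not_intro hi1),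
        ih fun t ht => hL' t (List.mem_cons_of_mem _ ht), add_zero]
  have h5 := h4 L fun _ h => h
  set T := L.flatMap fun t => eqTerms A J pos t.1 t.2
  rw [sum_eq_sum_coeffAt (fun z => X (signedDigits n pos z)) T (insert b (T.map Prod.snd).toFinset)
    fun t ht => by
      simp only [Finset.mem_insert, List.mem_toFinset, List.mem_map]
      exact Or.inr ⟨t, ht, rfl⟩, Finset.sum_eq_single b] at h5
  · refine (mul_eq_zero.1 h5).resolve_left fun h0 => h2 ?_
    rw [CharP.intCast_eq_zero_iff k p] at h0
    exact Int.emod_eq_zero_of_dvd h0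
  · intro z hz hzb
    simp only [Finset.mem_insert, hzb, List.mem_toFinset, List.mem_map, false_or] at hz
    obtain ⟨t, ht, rfl⟩ := hz
    rcases h3 t ht with h6 | h6
    · exact absurd (Nat.eq_of_beq_eq_true h6) hzb
    · rw [h6]; simp
  · simp

/-- A certificate for the solution of the equations for the centralizer of `∑ j ∈ J, e_{α_j}`:
the coordinates at the free roots determine all the others. The entries of `isolated` are the codes
of coordinates that vanish, together with a linear combination of equations showing it, and the
coordinates with codes in `chain` are obtained one after the other. -/
structure Elimination where
  /-- The codes of the free roots. -/
  free : List ℕ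
  /-- The coordinates that vanish because of a combination of several equations. -/
  isolated : List (ℕ × List (ℤ × ℕ))
  /-- The remaining coordinates, in the order in which they are determined. -/
  chain : List ℕ

/-- The codes of all the roots that occur in an elimination. -/
def Elimination.codes (E : Elimination) : List ℕ := E.free ++ E.isolated.map Prod.fst ++ E.chain

variable (A J pos) in
/-- The elimination is correct. -/
def Elimination.valid (p : ℕ) (P : List ℕ) (E : Elimination) : Bool :=
  (P.all fun z => memCode z E.codes) && (E.chain.all fun z => memCode z P) &&
  (E.isolated.all fun t => isolates A J pos p P t.1 t.2) &&
  solves A J pos (E.free ++ E.isolated.map Prod.fst) E.chain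

theorem Elimination.valid.spec {p : ℕ} [CharP k p] (hP : isRootList A P = true)
    (hX0 : ∀ v, form A v v ≠ 2 → X v = 0)
    (hX : ∀ v, form A v v = 2 → (J.map fun i =>
      (sgn A (Pi.single i 1) (v - Pi.single i 1) : k) * X (v - Pi.single i 1)).sum = 0)
    (hJ : J.Nodup) {E : Elimination} (h : E.valid A J pos p P = true)
    (hE : ∀ z ∈ E.free, X (signedDigits n pos z) = 0) :
    ∀ z ∈ P, X (signedDigits n pos z) = 0 := by
  simp only [Elimination.valid, Bool.and_eq_true, List.all_eq_true, memCode_iff] at h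
  obtain ⟨⟨⟨h1, h2⟩, h3⟩, h4⟩ := h
  have h5 : ∀ z ∈ E.free ++ E.isolated.map Prod.fst, X (signedDigits n pos z) = 0 := by
    intro z hz
    rcases List.mem_append.1 hz with hz | hz
    · exact hE z hz
    · obtain ⟨t, ht, rfl⟩ := List.mem_map.1 hz
      exact isolates.spec hP hX0 hX (h3 t ht)
  intro z hz
  rcases List.mem_append.1 (h1 z hz) with hz | hz
  · exact h5 z hz
  · exact solves.spec hP hX0 hX hJ h4 h2 h5 z hz

/-- The coordinates at the free roots determine a solution. -/
theorem eq_zero_of_eq_zero_on_free {p : ℕ} [CharP k p] (hP : isRootList A P = true)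
    (hX0 : ∀ v, form A v v ≠ 2 → X v = 0)
    (hX : ∀ v, form A v v = 2 → (J.map fun i =>
      (sgn A (Pi.single i 1) (v - Pi.single i 1) : k) * X (v - Pi.single i 1)).sum = 0)
    (hJ : J.Nodup) {E : Bool → Elimination} (h : ∀ pos, (E pos).valid A J pos p P = true)
    (hE : ∀ pos, ∀ z ∈ (E pos).free, X (signedDigits n pos z) = 0) (v : Fin n → ℤ) : X v = 0 := by
  by_cases hv : form A v v = 2
  · rw [← mem_signedVectors hP, signedVectors, List.mem_append, List.mem_map, List.mem_map] at hv
    rcases hv with ⟨z, hz, rfl⟩ | ⟨z, hz, rfl⟩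
    · exact Elimination.valid.spec hP hX0 hX hJ (h true) (hE true) z hz
    · exact Elimination.valid.spec hP hX0 hX hJ (h false) (hE false) z hz
  · exact hX0 v hv

end SimplyLaced

/-! ### Eigenspaces of operators that are diagonal in a basis. -/

section Diagonal

variable {ι k V : Type*} [Field k] [AddCommGroup V] [Module k V] (b : Module.Basis ι k V)

theorem Module.Basis.eigenspace_eq_span {T : Module.End k V} {wt : ι → k}
    (hT : ∀ i, T (b i) = wt i • b i) (c : k) :
    T.eigenspace c = Submodule.span k (b '' {i | wt i = c}) := by
  have hrepr : ∀ x i, b.repr (T x) i = wt i * b.repr x i := by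
    intro x i
    have : b.coord i ∘ₗ T = wt i • b.coord i := by
      refine b.ext fun j => ?_
      rcases eq_or_ne j i with rfl | hj
      · simp [hT]
      · simp [hT, hj]
    exact LinearMap.congr_fun this x
  ext x
  rw [Module.End.mem_eigenspace_iff, b.mem_span_image]
  constructor
  · intro h i hi
    have := hrepr x i
    rw [h, map_smul, Finsupp.smul_apply, smul_eq_mul] at this
    exact (mul_right_cancel₀ (Finsupp.mem_support_iff.1 hi) this).symm
  · intro h
    refine b.repr.injective (Finsupp.ext fun i => ?_)
    rw [hrepr, map_smul, Finsupp.smul_apply, smul_eq_mul]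
    by_cases hi : b.repr x i = 0
    · simp [hi]
    · rw [h (Finsupp.mem_support_iff.2 hi)]

theorem Module.Basis.finrank_span_image [Finite ι] (s : Set ι) :
    Module.finrank k (Submodule.span k (b '' s)) = s.ncard := by
  have := Fintype.ofFinite s
  have h : LinearIndependent k fun i : s => b i := b.linearIndependent.comp _ Subtype.val_injective
  rw [← Nat.card_coe_set_eq, Nat.card_eq_fintype_card, ← finrank_span_eq_card h,
    Set.image_eq_range]

end Diagonal

/-! ### Weight spaces of torus elements and bounds for the centralizer of a sum of simple root
vectors. -/

namespace SimplyLacedLie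

open SimplyLaced

variable {n : ℕ} {A : Matrix (Fin n) (Fin n) ℤ} {k : Type*} [Field k]

variable (A k) in
/-- The `w`-weights of the basis vectors. -/
def weight (w : Fin n → ℤ) : Fin n ⊕ Root A → k
  | Sum.inl _ => 0
  | Sum.inr β => (form A w β.1 : k)

variable (A k) in
/-- The span of the root vectors `e_β` for `β` in a set of vectors. -/
def rootSpan (Q : (Fin n → ℤ) → Prop) : Submodule k (SimplyLacedLie A k) :=
  Submodule.span k (basisVec A k '' (Sum.inr '' {β | Q β.1}))

variable (A k) in
theorem finrank_rootSpan [Finite (Root A)] (Q : (Fin n → ℤ) → Prop) :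
    Module.finrank k (rootSpan A k Q) = {β : Root A | Q β.1}.ncard := by
  rw [rootSpan, Module.Basis.finrank_span_image, Set.ncard_image_of_injective _ Sum.inr_injective]

theorem rootVec_mem_rootSpan {Q : (Fin n → ℤ) → Prop} {v : Fin n → ℤ} (hv : Q v) :
    rootVec A k v ∈ rootSpan A k Q := by
  rw [rootVec]
  split
  · exact Submodule.subset_span ⟨_, ⟨_, hv, rfl⟩, rfl⟩
  · exact zero_mem _

variable (A k) in
/-- The sum of the simple root vectors `e_{α_j}` for `j` in a list. -/
def simpleSum (J : List (Fin n)) : SimplyLacedLie A k :=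
  (J.map fun j => rootVec A k (Pi.single j 1)).sum

variable (A k) in
/-- The coordinate at `e_v`, which is `0` if `v` is not a root. -/
def rootCoord (v : Fin n → ℤ) : SimplyLacedLie A k →ₗ[k] k :=
  if h : form A v v = 2 then (basisVec A k).coord (Sum.inr ⟨v, h⟩) else 0

theorem rootCoord_of_not_root {v : Fin n → ℤ} (h : form A v v ≠ 2) : rootCoord A k v = 0 :=
  dif_neg h

theorem rootCoord_basisVec_inr (v : Fin n → ℤ) (β : Root A) :
    rootCoord A k v (basisVec A k (Sum.inr β)) = if v = β.1 then 1 else 0 := by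
  rw [rootCoord]
  split_ifs with h1 h2 h2
  · subst h2; simp
  · have : β ≠ ⟨v, h1⟩ := fun h => h2 (by rw [h])
    simp [this]
  · subst h2; exact absurd β.2 h1
  · rfl

theorem rootCoord_rootVec {v : Fin n → ℤ} (hv : form A v v = 2) (u : Fin n → ℤ) :
    rootCoord A k v (rootVec A k u) = if v = u then 1 else 0 := by
  rw [rootVec]
  split_ifs with h1 h2 h2
  · rw [rootCoord_basisVec_inr, if_pos h2]
  · rw [rootCoord_basisVec_inr, if_neg h2]
  · subst h2; exact absurd hv h1
  · exact map_zero _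

theorem rootCoord_torusElt (v u : Fin n → ℤ) : rootCoord A k v (torusElt A k u) = 0 := by
  rw [rootCoord]
  split_ifs with h1
  · simp [torusElt]
  · rfl

theorem eq_zero_of_rootCoord {x : SimplyLacedLie A k} (hx : x ∈ rootSpan A k fun _ => True)
    (h : ∀ v, rootCoord A k v x = 0) : x = 0 := by
  rw [rootSpan, (basisVec A k).mem_span_image] at hx
  refine (basisVec A k).repr.injective (Finsupp.ext fun b => ?_)
  rw [map_zero]
  by_contra hb
  obtain ⟨β, -, rfl⟩ := hx (Finsupp.mem_support_iff.2 hb)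
  have := h β.1
  rw [rootCoord, dif_pos β.2] at this
  exact hb this

theorem rootCoord_eq_zero_of_mem_rootSpan {Q : (Fin n → ℤ) → Prop} {x : SimplyLacedLie A k}
    (hx : x ∈ rootSpan A k Q) {v : Fin n → ℤ} (hv : ¬ Q v) : rootCoord A k v x = 0 := by
  rw [rootCoord]
  split_ifs with h
  · rw [rootSpan, (basisVec A k).mem_span_image] at hx
    by_contra hb
    obtain ⟨β, hβ, he⟩ := hx (Finsupp.mem_support_iff.2 hb)
    rw [Sum.inr_injective he] at hβ
    exact hv hβ
  · rfl

theorem rootSpan_mono {Q Q' : (Fin n → ℤ) → Prop} (h : ∀ v, Q v → Q' v) :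
    rootSpan A k Q ≤ rootSpan A k Q' :=
  Submodule.span_mono (Set.image_mono (Set.image_mono fun β hβ => h β.1 hβ))

variable [EvenPosDef A]

variable (A k) in
theorem lie_def (x y : SimplyLacedLie A k) : ⁅x, y⁆ = bracketMap A k x y := rfl

variable (A k) in
theorem lie_torusElt_basisVec (w : Fin n → ℤ) (b : Fin n ⊕ Root A) :
    ⁅torusElt A k w, basisVec A k b⁆ = weight A k w b • basisVec A k b := by
  rw [lie_def]
  cases b with
  | inl i => simp [torusElt, bracketMap_hh, weight]
  | inr β =>
    rw [bracketMap_swap, bracketMap_e_torusElt, neg_neg, weight]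

variable (A k) in
theorem eigenspace_torusElt (w : Fin n → ℤ) (c : k) :
    (LieAlgebra.ad k _ (torusElt A k w)).eigenspace c =
      Submodule.span k (basisVec A k '' {b | weight A k w b = c}) :=
  (basisVec A k).eigenspace_eq_span (fun b => lie_torusElt_basisVec A k w b) c

/-- The torus has weight `0`, so a nonzero weight space involves root vectors only. -/
theorem eigenspace_torusElt_of_ne_zero (w : Fin n → ℤ) {c : k} (hc : c ≠ 0) :
    (LieAlgebra.ad k _ (torusElt A k w)).eigenspace c =
      rootSpan A k fun v => (form A w v : k) = c := by
  rw [eigenspace_torusElt, rootSpan]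
  congr 2
  ext b
  cases b with
  | inl i => simp [weight, hc.symm]
  | inr β => simp [weight]

theorem finrank_eigenspace_torusElt_zero [Finite (Root A)] (w : Fin n → ℤ) :
    Module.finrank k ((LieAlgebra.ad k _ (torusElt A k w)).eigenspace 0) =
      n + {β : Root A | (form A w β.1 : k) = 0}.ncard := by
  rw [eigenspace_torusElt, Module.Basis.finrank_span_image]
  have : {b | weight A k w b = 0} = Set.range Sum.inl ∪
      Sum.inr '' {β : Root A | (form A w β.1 : k) = 0} := by
    ext b
    cases b <;> simp [weight]
  rw [this, Set.ncard_union_eq, Set.ncard_image_of_injective _ Sum.inr_injective, ← Set.image_univ,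
    Set.ncard_image_of_injective _ Sum.inl_injective, Set.ncard_univ, Nat.card_fin]
  · rw [Set.disjoint_left]
    rintro _ ⟨i, rfl⟩ ⟨β, -, h⟩
    cases h

theorem rootVec_single (j : Fin n) :
    rootVec A k (Pi.single j 1) = basisVec A k (Sum.inr (simpleRoot A j)) :=
  dif_pos (simpleRoot A j).2

theorem lie_simpleSum (J : List (Fin n)) (x : SimplyLacedLie A k) :
    ⁅simpleSum A k J, x⁆ = (J.map fun j => ⁅basisVec A k (Sum.inr (simpleRoot A j)), x⁆).sum := by
  induction J with
  | nil => simp [simpleSum]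
  | cons j J ih =>
    rw [simpleSum, List.map_cons, List.sum_cons, add_lie, ← simpleSum, ih, List.map_cons,
      List.sum_cons, rootVec_single]

theorem rootCoord_lie_basisVec {v : Fin n → ℤ} (hv : form A v v = 2) (α : Root A)
    {x : SimplyLacedLie A k} (hx : x ∈ rootSpan A k fun _ => True) :
    rootCoord A k v ⁅basisVec A k (Sum.inr α), x⁆ =
      (sgn A α.1 (v - α.1) : k) * rootCoord A k (v - α.1) x := by
  induction hx using Submodule.span_induction with
  | mem y hy =>
    obtain ⟨_, ⟨β, -, rfl⟩, rfl⟩ := hy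
    rw [lie_def, bracketMap_ee, map_smul, rootCoord_basisVec_inr, smul_eq_mul]
    by_cases h : v = α.1 + β.1
    · have h0 : α.1 + β.1 ≠ 0 := by
        intro h0
        rw [h, h0, form_zero_right] at hv
        omega
      rw [if_neg h0, rootCoord_rootVec hv, if_pos h, h, add_sub_cancel_left, if_pos rfl]
    · have h1 : ¬ v - α.1 = β.1 := fun h1 => h (by rw [← h1]; abel)
      rw [if_neg h1]
      split_ifs
      · rw [rootCoord_torusElt, mul_zero, mul_zero]
      · rw [rootCoord_rootVec hv, if_neg h, mul_zero, mul_zero]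
  | zero => simp
  | add y z _ _ hy hz => rw [lie_add, map_add, map_add, hy, hz, mul_add]
  | smul c y _ hy => rw [lie_smul, map_smul, map_smul, hy, smul_eq_mul, smul_eq_mul, mul_left_comm]

/-- Only the root components of `[e, x] = 0` are exploited. Its torus component involves the
coordinates at the `-α_j`, `j ∈ J`; in the application these have weight `1`, whereas kernels are
computed for weights `s + 1 ≥ 2`. -/
theorem sum_sgn_mul_rootCoord_eq_zero {J : List (Fin n)} {x : SimplyLacedLie A k}
    (hx : x ∈ rootSpan A k fun _ => True) (he : ⁅simpleSum A k J, x⁆ = 0) {v : Fin n → ℤ}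
    (hv : form A v v = 2) :
    (J.map fun i => (sgn A (Pi.single i 1) (v - Pi.single i 1) : k) *
      rootCoord A k (v - Pi.single i 1) x).sum = 0 := by
  have h := congrArg (rootCoord A k v) he
  rw [lie_simpleSum, map_list_sum, List.map_map, map_zero] at h
  rw [← h]
  congr 1
  refine List.map_congr_left fun i _ => ?_
  exact (rootCoord_lie_basisVec hv (simpleRoot A i) hx).symm

/-- The centralizer of `∑ j ∈ J, e_{α_j}` in a weight space embeds into the functions on the free
roots of that weight. -/
theorem finrank_ker_inf_rootSpan_le {p : ℕ} [CharP k p] {P : List ℕ} (hP : isRootList A P = true)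
    {J : List (Fin n)} (hJ : J.Nodup) {E : Bool → Elimination}
    (hE : ∀ pos, (E pos).valid A J pos p P = true) (Q : (Fin n → ℤ) → Prop) (q : Bool → ℕ → Bool)
    (hq : ∀ pos z, q pos z = true ↔ Q (signedDigits n pos z)) :
    Module.finrank k (LinearMap.ker (LieAlgebra.ad k _ (simpleSum A k J)) ⊓ rootSpan A k Q :
      Submodule k (SimplyLacedLie A k)) ≤
      (E true).free.countP (q true) + (E false).free.countP (q false) := by
  classical
  set F : Bool → Finset (Fin n → ℤ) := fun pos =>
    (((E pos).free.filter (q pos)).map (signedDigits n pos)).toFinset with hF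
  have hcard : (F true ∪ F false).card ≤
      (E true).free.countP (q true) + (E false).free.countP (q false) := by
    refine (Finset.card_union_le _ _).trans (add_le_add ?_ ?_) <;>
    · refine (List.toFinset_card_le _).trans ?_
      rw [List.length_map, List.countP_eq_length_filter]
  refine le_trans ?_ hcard
  set K := LinearMap.ker (LieAlgebra.ad k _ (simpleSum A k J)) ⊓ rootSpan A k Q with hK
  -- Evaluation at the free roots of the given weight. It is injective on the kernel: free
  -- coordinates of other weights vanish automatically, and the elimination determines the rest.
  let g : K →ₗ[k] (↥(F true ∪ F false) → k) :=
    LinearMap.pi fun v => rootCoord A k v.1 ∘ₗ K.subtype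
  have hg : Function.Injective g := by
    rw [← LinearMap.ker_eq_bot, LinearMap.ker_eq_bot']
    rintro ⟨x, hx1, hx2⟩ hx
    have hx3 := rootSpan_mono (fun _ _ => trivial) hx2
    refine Subtype.ext (eq_zero_of_rootCoord hx3 ?_)
    refine eq_zero_of_eq_zero_on_free (p := p) hP
      (fun v hv => by rw [rootCoord_of_not_root hv]; rfl)
      (fun v hv => sum_sgn_mul_rootCoord_eq_zero hx3 hx1 hv) hJ hE ?_
    intro pos z hz
    by_cases hQ : Q (signedDigits n pos z)
    · have hmem : signedDigits n pos z ∈ F true ∪ F false := by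
        have : signedDigits n pos z ∈ F pos := by
          rw [hF, List.mem_toFinset]
          exact List.mem_map.2 ⟨z, List.mem_filter.2 ⟨hz, (hq pos z).2 hQ⟩, rfl⟩
        cases pos
        · exact Finset.mem_union_right _ this
        · exact Finset.mem_union_left _ this
      exact congrFun hx ⟨_, hmem⟩
    · exact rootCoord_eq_zero_of_mem_rootSpan hx2 hQ
  have := LinearMap.finrank_le_finrank_of_injective hg
  rwa [Module.finrank_fintype_fun_eq_card, Fintype.card_coe] at this

/-- Rank-nullity for `ad e` from the span of the roots in `Q₁` to that of the roots in `Q₂`. The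
condition that `α_j + v` is nonzero keeps the image out of the torus. -/
theorem le_finrank_ker_inf_rootSpan [Finite (Root A)] {J : List (Fin n)}
    {Q Q₁ Q₂ : (Fin n → ℤ) → Prop} (h1 : ∀ v, Q₁ v → Q v)
    (h2 : ∀ j ∈ J, ∀ v, Q₁ v → Pi.single j 1 + v ≠ 0 ∧ Q₂ (Pi.single j 1 + v)) :
    {β : Root A | Q₁ β.1}.ncard ≤
      Module.finrank k (LinearMap.ker (LieAlgebra.ad k _ (simpleSum A k J)) ⊓ rootSpan A k Q :
        Submodule k (SimplyLacedLie A k)) + {β : Root A | Q₂ β.1}.ncard := by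
  have : FiniteDimensional k (SimplyLacedLie A k) := (basisVec A k).finiteDimensional_of_finite
  have hmap : ∀ x ∈ rootSpan A k Q₁, LieAlgebra.ad k _ (simpleSum A k J) x ∈ rootSpan A k Q₂ := by
    intro x hx
    induction hx using Submodule.span_induction with
    | mem y hy =>
      obtain ⟨_, ⟨β, hβ, rfl⟩, rfl⟩ := hy
      rw [LieAlgebra.ad_apply, lie_simpleSum]
      refine list_sum_mem fun y hy => ?_
      obtain ⟨j, hj, rfl⟩ := List.mem_map.1 hy
      obtain ⟨h3, h4⟩ := h2 j hj _ hβ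
      rw [lie_def, bracketMap_ee]
      refine Submodule.smul_mem _ _ ?_
      exact (if_neg h3).symm ▸ rootVec_mem_rootSpan h4
    | zero => rw [map_zero]; exact zero_mem _
    | add y z _ _ hy hz => rw [map_add]; exact add_mem hy hz
    | smul c y _ hy => rw [map_smul]; exact Submodule.smul_mem _ _ hy
  let g := (LieAlgebra.ad k _ (simpleSum A k J)).restrict hmap
  have h3 := g.finrank_range_add_finrank_ker
  have h4 : Module.finrank k (LinearMap.range g) ≤ Module.finrank k (rootSpan A k Q₂) :=
    Submodule.finrank_le _
  have h5 : Module.finrank k (LinearMap.ker g) ≤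
      Module.finrank k (LinearMap.ker (LieAlgebra.ad k _ (simpleSum A k J)) ⊓ rootSpan A k Q :
        Submodule k (SimplyLacedLie A k)) := by
    rw [← Submodule.finrank_map_subtype_eq]
    refine Submodule.finrank_mono ?_
    rintro _ ⟨x, hx, rfl⟩
    exact ⟨congrArg Subtype.val hx, rootSpan_mono h1 x.2⟩
  rw [← finrank_rootSpan A k, ← finrank_rootSpan A k]
  omega

end SimplyLacedLie

/-! ### Numerical conditions on weights modulo `p`. -/

namespace SimplyLaced

variable {n : ℕ}

/-- The residue modulo `p` of the value of a linear form at the vector with code `z`. -/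
def residue (p : ℕ) (a : Fin n → ℤ) (z : ℕ) : ℕ := (dot a (digits n z) % p).toNat

/-- The linear form `a + l b` takes the value `c` modulo `p` at a signed vector. -/
def hasWeight (p : ℕ) (a b : Fin n → ℤ) (l c : ℕ) (pos : Bool) (z : ℕ) : Bool :=
  bif pos then Nat.beq ((residue p a z + l * residue p b z) % p) c
  else Nat.beq ((residue p a z + l * residue p b z + c) % p) 0

theorem natCast_residue {p : ℕ} (k : Type*) [Field k] [CharP k p] (hp : p ≠ 0) (a : Fin n → ℤ)
    (z : ℕ) : (residue p a z : k) = (dot a (digits n z) : k) := by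
  have h1 : ((residue p a z : ℕ) : ℤ) = dot a (digits n z) % p :=
    Int.toNat_of_nonneg (Int.emod_nonneg _ (by exact_mod_cast hp))
  rw [← Int.cast_natCast, h1, CharP.intCast_eq_intCast k p]
  exact Int.mod_modEq _ _

theorem dot_signedDigits (a : Fin n → ℤ) (pos : Bool) (z : ℕ) :
    dot a (signedDigits n pos z) = bif pos then dot a (digits n z) else -dot a (digits n z) := by
  cases pos
  · rw [signedDigits_false, dot_neg_right]; rfl
  · rfl

theorem natCast_eq_natCast_iff_mod {p : ℕ} (k : Type*) [Field k] [CharP k p] {a c : ℕ}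
    (hc : c < p) : (a : k) = c ↔ a % p = c := by
  rw [CharP.cast_eq_iff_mod_eq k p, Nat.mod_eq_of_lt hc]

/-- For a negative root the condition `-w = c` is tested as `w + c = 0`, so that the computation
stays within natural numbers. -/
theorem hasWeight_iff {p : ℕ} (k : Type*) [Field k] [CharP k p] {a b : Fin n → ℤ} {l c : ℕ}
    (hc : c < p) (pos : Bool) (z : ℕ) : hasWeight p a b l c pos z = true ↔
      ((dot a (signedDigits n pos z) + l * dot b (signedDigits n pos z) : ℤ) : k) = c := by
  have hp : p ≠ 0 := by omega
  rw [dot_signedDigits, dot_signedDigits]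
  cases pos
  · rw [hasWeight, cond_false, Nat.beq_eq, ← natCast_eq_natCast_iff_mod k (by omega)]
    push_cast
    rw [natCast_residue k hp, natCast_residue k hp, ← neg_inj, ← sub_eq_zero,
      ← sub_eq_zero (b := (c : k))]
    simp only [cond_false]
    push_cast
    ring_nf
  · rw [hasWeight, cond_true, Nat.beq_eq, ← natCast_eq_natCast_iff_mod k hc]
    push_cast
    rw [natCast_residue k hp, natCast_residue k hp]
    rfl

variable (A : Matrix (Fin n) (Fin n) ℤ)

/-- The numerical conditions on the weights of `∑ j ∈ J, e_{α_j}` and of the free roots which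
guarantee that the multiplicities of the composition factors are given by `m`, if `X ∂` is
represented by `u + l v`. The values of `r` on the simple roots in `J` are `2`. -/
def multiplicityCheck (J : List (Fin n)) (E : Bool → Elimination) (P : List ℕ) (p : ℕ)
    (a b r : Fin n → ℤ) (l : ℕ) (m : ℕ → ℕ) : Bool :=
  (J.all fun j => decide ((a j + l * b j + 1) % p = 0) && decide (r j = 2)) &&
  Nat.beq (n + (P.countP (hasWeight p a b l 0 true) + P.countP (hasWeight p a b l 0 false)))
    (∑ j ∈ Finset.range (p - 1), m j) &&
  Nat.beq (P.countP (hasWeight p a b l 1 true) + P.countP (hasWeight p a b l 1 false))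
    (∑ j ∈ Finset.Ico 1 p, m j) &&
  (List.range p).all fun s => Nat.beq s 0 || Nat.ble p (s + 1) ||
    (Nat.ble ((E true).free.countP (hasWeight p a b l (s + 1) true) +
      (E false).free.countP (hasWeight p a b l (s + 1) false)) (m s) &&
    Nat.ble (m s +
      (P.countP (fun z => hasWeight p a b l s true z &&
          decide (2 ≤ dot r (signedDigits n true z))) +
        P.countP fun z => hasWeight p a b l s false z &&
          decide (2 ≤ dot r (signedDigits n false z))))
      (P.countP (fun z => hasWeight p a b l (s + 1) true z &&
          decide (0 ≤ dot r (signedDigits n true z))) +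
        P.countP fun z => hasWeight p a b l (s + 1) false z &&
          decide (0 ≤ dot r (signedDigits n false z))))

variable {A} [EvenPosDef A]

theorem form_eq_dot_left (u v : Fin n → ℤ) : form A u v = dot (fun i => dot (A i) u) v := by
  rw [form_comm, form_eq_dot, dot_eq_sum, dot_eq_sum]
  exact Finset.sum_congr rfl fun i _ => mul_comm _ _

theorem form_add_smul_left (u v w : Fin n → ℤ) (l : ℕ) : form A (u + (l : ℤ) • v) w =
    dot (fun i => dot (A i) u) w + l * dot (fun i => dot (A i) v) w := by
  rw [form_add_left, ← form_eq_dot_left, ← form_eq_dot_left]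
  congr 1
  simp only [form, Pi.smul_apply, smul_eq_mul, Finset.mul_sum, mul_assoc]

end SimplyLaced

/-! ### Invariance of the dimensions under isomorphisms. -/

section Transport

variable {k L L' : Type*} [Field k] [LieRing L] [LieAlgebra k L] [LieRing L'] [LieAlgebra k L']

theorem LieEquiv.finrank_eigenspace_ad (σ : L ≃ₗ⁅k⁆ L') (y : L) (c : k) :
    Module.finrank k ((LieAlgebra.ad k L y).eigenspace c) =
      Module.finrank k ((LieAlgebra.ad k L' (σ y)).eigenspace c) := by
  have h : (LieAlgebra.ad k L y).eigenspace c =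
      ((LieAlgebra.ad k L' (σ y)).eigenspace c).comap (σ.toLinearEquiv : L →ₗ[k] L') := by
    have hinj : Function.Injective σ := σ.injective
    ext z
    simp only [Module.End.mem_eigenspace_iff, Submodule.mem_comap, LieAlgebra.ad_apply]
    change _ ↔ ⁅σ y, σ z⁆ = c • σ z
    rw [← LieEquiv.map_lie, ← map_smul, hinj.eq_iff]
  rw [h]
  exact (σ.toLinearEquiv.ofSubmodule' _).finrank_eq

theorem LieEquiv.finrank_ker_inf_eigenspace_ad (σ : L ≃ₗ⁅k⁆ L') (x y : L) (c : k) :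
    Module.finrank k (LinearMap.ker (LieAlgebra.ad k L x) ⊓
        (LieAlgebra.ad k L y).eigenspace c : Submodule k L) =
      Module.finrank k (LinearMap.ker (LieAlgebra.ad k L' (σ x)) ⊓
        (LieAlgebra.ad k L' (σ y)).eigenspace c : Submodule k L') := by
  have h : LinearMap.ker (LieAlgebra.ad k L x) ⊓ (LieAlgebra.ad k L y).eigenspace c =
      (LinearMap.ker (LieAlgebra.ad k L' (σ x)) ⊓
        (LieAlgebra.ad k L' (σ y)).eigenspace c).comap (σ.toLinearEquiv : L →ₗ[k] L') := by
    have hinj : Function.Injective σ := σ.injective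
    ext z
    simp only [Module.End.mem_eigenspace_iff, Submodule.mem_comap, LieAlgebra.ad_apply,
      Submodule.mem_inf, LinearMap.mem_ker]
    change _ ↔ ⁅σ x, σ z⁆ = 0 ∧ ⁅σ y, σ z⁆ = c • σ z
    rw [← LieEquiv.map_lie, ← LieEquiv.map_lie, ← map_smul, hinj.eq_iff,
      ← map_zero σ, hinj.eq_iff]
  rw [h]
  exact (σ.toLinearEquiv.ofSubmodule' _).finrank_eq

end Transport

/-! ### From the numerical conditions to the composition factors. -/

namespace SimplyLacedLie

open SimplyLaced

variable {n : ℕ} {A : Matrix (Fin n) (Fin n) ℤ} [EvenPosDef A] {k : Type*} [Field k]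

theorem hasCompositionFactors_of_multiplicityCheck {p : ℕ} [Fact p.Prime] [IsAlgClosed k]
    [CharP k p] {P : List ℕ} (hP : isRootList A P = true) {J : List (Fin n)} (hJ : J.Nodup)
    {E : Bool → Elimination} (hE : ∀ pos, (E pos).valid A J pos p P = true)
    {u v R : Fin n → ℤ} {l : ℕ} {m : ℕ → ℕ}
    (hm : multiplicityCheck J E P p (fun i => dot (A i) u) (fun i => dot (A i) v)
      (fun i => dot (A i) R) l m = true)
    {W : LieSubalgebra k (SimplyLacedLie A k)} (hW : IsPSubalgebra p W) (φ : Witt k p ≃ₗ⁅k⁆ W)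
    (σ : SimplyLacedLie A k ≃ₗ⁅k⁆ SimplyLacedLie A k)
    (hdel : σ (φ (Witt.del k p)) = simpleSum A k J)
    (hxdel : σ (φ (Witt.xdel k p)) = torusElt A k (u + (l : ℤ) • v)) :
    HasCompositionFactors φ m := by
  have hp : 1 < p := (Fact.out : p.Prime).one_lt
  have : Finite (Root A) := finite_root hP
  have : FiniteDimensional k (SimplyLacedLie A k) := (basisVec A k).finiteDimensional_of_finite
  simp only [multiplicityCheck, Bool.and_eq_true, List.all_eq_true, decide_eq_true_eq, Nat.beq_eq,
    Bool.or_eq_true, Nat.ble_eq, List.mem_range] at hm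
  obtain ⟨⟨⟨hmJ, hm0⟩, hm1⟩, hms⟩ := hm
  set w := u + (l : ℤ) • v
  have hwt : ∀ c < p, ∀ pos z, hasWeight p (fun i => dot (A i) u) (fun i => dot (A i) v) l c pos z
      = true ↔ (form A w (signedDigits n pos z) : k) = c := by
    intro c hc pos z
    rw [hasWeight_iff k hc, form_add_smul_left]
  have hR : ∀ z, dot (fun i => dot (A i) R) z = form A R z := fun z => (form_eq_dot_left R z).symm
  have hcount : ∀ c < p, {β : Root A | (form A w β.1 : k) = c}.ncard =
      P.countP (hasWeight p (fun i => dot (A i) u) (fun i => dot (A i) v) l c true) +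
      P.countP (hasWeight p (fun i => dot (A i) u) (fun i => dot (A i) v) l c false) :=
    fun c hc => ncard_root hP (fun x => (form A w x : k) = c) _ _ (hwt c hc true) (hwt c hc false)
  have hcountR : ∀ c < p, ∀ d : ℤ,
      {β : Root A | (form A w β.1 : k) = c ∧ d ≤ form A R β.1}.ncard =
      P.countP (fun z => hasWeight p (fun i => dot (A i) u) (fun i => dot (A i) v) l c true z &&
          decide (d ≤ dot (fun i => dot (A i) R) (signedDigits n true z))) +
        P.countP fun z => hasWeight p (fun i => dot (A i) u) (fun i => dot (A i) v) l c false z &&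
          decide (d ≤ dot (fun i => dot (A i) R) (signedDigits n false z)) := by
    intro c hc d
    refine ncard_root hP (fun x => (form A w x : k) = c ∧ d ≤ form A R x) _ _
      (fun z => ?_) fun z => ?_
    · rw [Bool.and_eq_true, hwt c hc, decide_eq_true_eq, hR, signedDigits_true]
    · rw [Bool.and_eq_true, hwt c hc, decide_eq_true_eq, hR, signedDigits_false]
  refine hasCompositionFactors_of_finrank hW φ (fun s hs hs1 => ?_) ?_ ?_
  · obtain ⟨h1, h2⟩ := (hms s (by omega)).resolve_left (by omega)
    have hc : ((s + 1 : ℕ) : k) ≠ 0 := by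
      rw [Ne, CharP.cast_eq_zero_iff k p]
      exact Nat.not_dvd_of_pos_of_lt (by omega) hs1
    have hE' := eigenspace_torusElt_of_ne_zero (A := A) w hc
    rw [σ.finrank_ker_inf_eigenspace_ad, hdel, hxdel, ← Nat.cast_add_one, hE']
    refine le_antisymm ?_ ?_
    · refine (finrank_ker_inf_rootSpan_le (p := p) hP hJ hE _ _ fun pos z => ?_).trans h1
      exact hwt (s + 1) hs1 pos z
    · rw [← hcountR _ hs1, ← hcountR s (by omega)] at h2
      -- Adding `α_j` lowers the `w`-weight by `1` and raises the degree `(R, ·)` by `2`. A sum of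
      -- degree at least `2` is in particular nonzero. The difference of the two root counts is at
      -- least `m s`, so it meets the upper bound given by the free roots.
      have h3 := le_finrank_ker_inf_rootSpan (A := A) (k := k) (J := J)
        (Q := fun x => (form A w x : k) = (s + 1 : ℕ))
        (Q₁ := fun x => (form A w x : k) = (s + 1 : ℕ) ∧ 0 ≤ form A R x)
        (Q₂ := fun x => (form A w x : k) = s ∧ 2 ≤ form A R x) (fun x hx => hx.1) (by
          rintro j hj x ⟨hx1, hx2⟩
          obtain ⟨h3, h4⟩ := hmJ j hj
          have h5 : form A R (Pi.single j 1) = 2 := by rw [← hR, dot_single, h4]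
          have h6 : (form A w (Pi.single j 1) : k) = -1 := by
            rw [form_add_smul_left, dot_single, dot_single, ← add_eq_zero_iff_eq_neg]
            have := (CharP.intCast_eq_zero_iff k p _).2 (Int.dvd_of_emod_eq_zero h3)
            push_cast at this ⊢
            exact this
          have h7 : 2 ≤ form A R (Pi.single j 1 + x) := by rw [form_add_right, h5]; omega
          refine ⟨fun h0 => ?_, ?_, h7⟩
          · rw [h0, form_zero_right] at h7
            omega
          · rw [form_add_right, Int.cast_add, h6, hx1]
            push_cast
            ring)
      omega
  · rw [σ.finrank_eigenspace_ad, hxdel, finrank_eigenspace_torusElt_zero, ← hm0,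
      ← hcount 0 (by omega), Nat.cast_zero]
  · have hE' := eigenspace_torusElt_of_ne_zero (A := A) (k := k) w one_ne_zero
    rw [σ.finrank_eigenspace_ad, hxdel, hE', finrank_rootSpan, ← hm1, ← hcount 1 hp, Nat.cast_one]

end SimplyLacedLie

/-! ### Certificates for the four cases. -/

namespace TypeACase

open SimplyLaced

/-- The simple roots of the standard Levi subalgebra of type `A_{p-1}`. -/
def levi (c : TypeACase) : List (Fin c.rank) :=
  (List.finRange c.rank).filter fun i => decide (c.eCoeff i = 1)

/-- The sum of the positive coroots of the standard Levi subalgebra of type `A_{p-1}`. -/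
def twoRho : (c : TypeACase) → Fin c.rank → ℤ
  | E6A4 => ![4, 4, 6, 6, 0, 0]
  | E7A4 => ![4, 4, 6, 6, 0, 0, 0]
  | E7A6 => ![6, 0, 10, 12, 12, 10, 6]
  | E8A6 => ![0, 6, 0, 10, 12, 12, 10, 6]

/-- The elimination for the coordinates at the positive roots. -/
def positiveElimination : TypeACase → Elimination
  | E6A4 =>
    { free :=
        [100, 1100, 11100, 111100, 1, 11210, 112210, 11211, 112211, 122321]
      isolated := []
      chain :=
        [1000, 10000, 100000, 10100, 101000, 101100, 10, 110, 1110, 10110, 11110, 101110, 111110,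
         111210, 11, 111, 1111, 10111, 11111, 101111, 111111, 111211, 11221, 111221, 112221, 112321] }
  | E7A4 =>
    { free :=
        [1000, 11000, 111000, 1111000, 1, 10, 11, 112100, 1122100, 112110, 1122110, 112111, 1122111,
         1223210, 1223211, 1223221, 2234321]
      isolated := []
      chain :=
        [10000, 100000, 1000000, 101000, 1010000, 1011000, 100, 1100, 11100, 101100, 111100, 1011100,
         1111100, 1112100, 110, 1110, 11110, 101110, 111110, 1011110, 1111110, 1112110, 111, 1111,
         11111, 101111, 111111, 1011111, 1111111, 1112111, 112210, 1112210, 1122210, 1123210, 112211,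
         1112211, 1122211, 1123211, 112221, 1112221, 1122221, 1123221, 1123321, 1223321, 1224321,
         1234321] }
  | E7A6 =>
    { free :=
        [1, 11, 111, 1111, 11111, 1011111, 112111, 112221, 1112221, 1122221, 1123321, 2234321]
      isolated :=
        -- The three equations form a cycle in the unknowns with codes `1111100`, `111110` and
        -- `112100`, each of which occurs in two of them. The last two unknowns cancel in the sum,
        -- leaving `±2` times the first, and `2` is invertible modulo `7`.
        [(1111100, [(1, 112110), (1, 1111110), (1, 1112100)]),
         (1122110, [(1, 112221), (1, 1112211), (1, 1122111), (1, 1122210)])]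
      chain :=
        [10, 100, 1000, 10000, 1000000, 110, 1100, 11000, 1010000, 1110, 11100, 1011000, 11110,
         1011100, 1011110, 100000, 101000, 101100, 111000, 101110, 111100, 1111000, 111110, 112100,
         101111, 112110, 1112100, 111111, 1111110, 112210, 1112110, 1122100, 1111111, 112211,
         1112111, 1112210, 1112211, 1122210, 1122111, 1122211, 1123210, 1123211, 1123221, 1223210,
         1223211, 1223221, 1223321, 1224321, 1234321] }
  | E8A6 =>
    { free :=
        [1, 11, 111, 1111, 11111, 1011111, 1111111, 1122111, 1122221, 10000000, 11111111, 11122111,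
         11122221, 11222221, 12232221, 11233321, 12233321, 12244321, 13354321, 23354321, 23465432]
      isolated :=
        [(11222111, [(1, 11222211), (1, 11232111), (-1, 11232210)]),
         (11232221, [(1, 11233221), (1, 12232221), (-1, 12233211), (1, 12243210)])]
      chain :=
        [10, 100, 1000, 10000, 1000000, 110, 1100, 11000, 1010000, 1110, 11100, 1011000, 11110,
         1011100, 1011110, 100000, 110000, 111000, 1110000, 111100, 1111000, 111110, 1111100,
         1121000, 1121100, 1111110, 111111, 1121110, 1122100, 1122110, 1121111, 1122210, 1122211,
         10100000, 10110000, 10111000, 11110000, 10111100, 11111000, 10111110, 11111100, 11121000,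
         11121100, 11111110, 10111111, 11121110, 11122100, 11122110, 11121111, 11122210, 11122211,
         11221000, 11221100, 11221110, 11222100, 11222110, 11232100, 11221111, 11222210, 11232110,
         12232100, 11222211, 11232210, 12232110, 11232111, 11232211, 11233210, 12232210, 12232111,
         11233211, 12232211, 12233210, 11233221, 12233211, 12243210, 12233221, 12243211, 12243221,
         12243321, 12343210, 12343211, 12343221, 12343321, 12344321, 12354321, 22343210, 22343211,
         22343221, 22343321, 22344321, 22354321, 22454321, 23454321, 23464321, 23465321, 23465421,
         23465431] }

/-- The elimination for the coordinates at the negative roots. -/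
def negativeElimination : TypeACase → Elimination
  | E6A4 =>
    { free :=
        [11221, 10111, 11, 10110, 10, 1, 100000, 10000, 1000, 100]
      isolated := []
      chain :=
        [122321, 112321, 112221, 111221, 112211, 111211, 111111, 11211, 11111, 101111, 1111, 111,
         112210, 111210, 111110, 11210, 11110, 101110, 1110, 110, 111100, 101100, 11100, 101000,
         10100, 1100] }
  | E7A4 =>
    { free :=
        [1123321, 112221, 112211, 112210, 101111, 111, 101110, 110, 101100, 100, 11, 10, 1, 1000000,
         100000, 10000, 1000]
      isolated := []
      chain :=
        [2234321, 1234321, 1224321, 1223321, 1223221, 1123221, 1122221, 1112221, 1223211, 1123211,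
         1122211, 1112211, 1223210, 1123210, 1122210, 1112210, 1122111, 1112111, 1111111, 112111,
         111111, 1011111, 11111, 1111, 1122110, 1112110, 1111110, 112110, 111110, 1011110, 11110,
         1110, 1122100, 1112100, 1111100, 112100, 111100, 1011100, 11100, 1100, 1111000, 1011000,
         111000, 1010000, 101000, 11000] }
  | E7A6 =>
    { free :=
        [1223210, 1122100, 112100, 1111000, 111000, 100000, 1000000, 10000, 1000, 100, 10, 1]
      isolated :=
        [(1112211, [(1, 1122110), (1, 1112210), (1, 1112111)]),
         (112110, [(1, 1111100), (1, 112100), (1, 111110), (1, 101111)])]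
      chain :=
        [2234321, 1234321, 1224321, 1223321, 1223221, 1223211, 1123321, 1123221, 1123211, 1122221,
         1122211, 1112221, 1123210, 1122210, 1122111, 112221, 1122110, 1112111, 112211, 1112210,
         1112110, 1111111, 112111, 112210, 1112100, 111111, 1111110, 1111100, 111110, 101111, 111100,
         101110, 101100, 101000, 1011111, 1011110, 11111, 1011100, 11110, 1111, 1011000, 11100, 1110,
         111, 1010000, 11000, 1100, 110, 11] }
  | E8A6 =>
    { free :=
        [22454321, 22343210, 12343210, 12232210, 12232100, 11232100, 11222100, 11221000, 11121000,
         11110000, 10100000, 10000000, 1121000, 1110000, 100000, 1000000, 10000, 1000, 100, 10, 1]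
      isolated :=
        [(12233211, [(1, 12232211), (1, 11233211), (-1, 11232221)]),
         (11222211, [(1, 12232100), (-1, 11232110), (1, 11222210), (1, 11222111)])]
      chain :=
        [23465432, 23465431, 23465421, 23465321, 23464321, 23454321, 23354321, 22354321, 22344321,
         22343321, 22343221, 22343211, 13354321, 12354321, 12344321, 12343321, 12343221, 12343211,
         12244321, 12243321, 12243221, 12233321, 12243211, 12233221, 11233321, 12243210, 12232221,
         11233221, 12232211, 11232221, 12233210, 11233211, 12232111, 11232211, 11222221, 11233210,
         12232110, 11232210, 11232111, 11232110, 11222111, 11222210, 11222110, 11221111, 11221110,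
         11221100, 11122221, 11122211, 11122111, 11122210, 11122110, 11121111, 11111111, 11121110,
         11122100, 11121100, 11111110, 10111111, 11111100, 10111110, 11111000, 10111100, 10111000,
         10110000, 1122221, 1122211, 1122111, 1122210, 1122110, 1121111, 1111111, 1121110, 1122100,
         1121100, 1111110, 111111, 1111100, 111110, 1111000, 111100, 111000, 110000, 1011111,
         1011110, 11111, 1011100, 11110, 1111, 1011000, 11100, 1110, 111, 1010000, 11000, 1100, 110,
         11] }

/-- The elimination for the centralizer of `e`. -/
def elimination (c : TypeACase) (pos : Bool) : Elimination :=
  bif pos then c.positiveElimination else c.negativeElimination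

theorem isRootList_codes : ∀ c : TypeACase,
    isRootList c.cartan c.positiveElimination.codes = true
  | E6A4 => by decide +kernel
  | E7A4 => by decide +kernel
  | E7A6 => by decide +kernel
  | E8A6 => by decide +kernel

theorem valid_positiveElimination : ∀ c : TypeACase, c.positiveElimination.valid c.cartan c.levi
    true c.p c.positiveElimination.codes = true
  | E6A4 => by decide +kernel
  | E7A4 => by decide +kernel
  | E7A6 => by decide +kernel
  | E8A6 => by decide +kernel

theorem valid_negativeElimination : ∀ c : TypeACase, c.negativeElimination.valid c.cartan c.levi
    false c.p c.positiveElimination.codes = true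
  | E6A4 => by decide +kernel
  | E7A4 => by decide +kernel
  | E7A6 => by decide +kernel
  | E8A6 => by decide +kernel

/-- The checks for all `l` contain the congruences `(α_j, H) = -1` and `(α_j, H₀) = 0` modulo `p` on
the Levi subalgebra: `e` has weight `-1` for `H` and commutes with `H₀`. -/
theorem all_multiplicityCheck : ∀ c : TypeACase, ((List.range c.p).all fun l =>
    multiplicityCheck c.levi c.elimination c.positiveElimination.codes c.p
      (fun i => dot (c.cartan i) c.HCoeff) (fun i => dot (c.cartan i) c.H0Coeff)
      (fun i => dot (c.cartan i) c.twoRho) l (c.mult l)) = true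
  | E6A4 => by decide +kernel
  | E7A4 => by decide +kernel
  | E7A6 => by decide +kernel
  | E8A6 => by decide +kernel

instance : ∀ c : TypeACase, Fact c.p.Prime
  | E6A4 => ⟨Nat.prime_five⟩
  | E7A4 => ⟨Nat.prime_five⟩
  | E7A6 => ⟨Nat.prime_seven⟩
  | E8A6 => ⟨Nat.prime_seven⟩

theorem nodup_levi (c : TypeACase) : c.levi.Nodup :=
  (List.nodup_finRange _).filter _

theorem e_eq_simpleSum (c : TypeACase) (k : Type*) [Field k] :
    c.e k = SimplyLacedLie.simpleSum c.cartan k c.levi := by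
  have h1 : ∀ i, c.eCoeff i = 0 ∨ c.eCoeff i = 1 := by
    cases c <;> decide
  rw [e, SimplyLacedLie.simpleSum, levi, Fin.sum_univ_def]
  generalize List.finRange c.rank = l
  induction l with
  | nil => rfl
  | cons i l ih =>
    rw [List.map_cons, List.sum_cons, ih]
    rcases h1 i with h2 | h2 <;> simp [h2]

theorem H_add_smul_H0 (c : TypeACase) (k : Type*) [Field k] (l : ℕ) : c.H k + (l : k) • c.H0 k =
    SimplyLacedLie.torusElt c.cartan k (c.HCoeff + (l : ℤ) • c.H0Coeff) := by
  rw [SimplyLacedLie.torusElt_add, H, H0]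
  congr 1
  simp [SimplyLacedLie.torusElt, Finset.smul_sum, mul_smul]

end TypeACase

end

theorem propositionA1 (c : TypeACase) (k : Type*) [Field k] [IsAlgClosed k] [CharP k c.p]
    (W : LieSubalgebra k (c.lie k)) (hW : IsPSubalgebra c.p W)
    (φ : Witt k c.p ≃ₗ⁅k⁆ W) (lam : ZMod c.p)
    (hφ : ∃ σ : c.lie k ≃ₗ⁅k⁆ c.lie k,
      σ (φ (Witt.del k c.p) : c.lie k) = c.e k ∧
      σ (φ (Witt.xdel k c.p) : c.lie k) = c.H k + (lam.val : k) • c.H0 k) :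
    HasCompositionFactors φ (c.mult lam.val) := by
  obtain ⟨σ, hdel, hxdel⟩ := hφ
  rw [c.e_eq_simpleSum] at hdel
  rw [c.H_add_smul_H0] at hxdel
  have hm := List.all_eq_true.1 c.all_multiplicityCheck lam.val (List.mem_range.2 lam.val_lt)
  refine SimplyLacedLie.hasCompositionFactors_of_multiplicityCheck c.isRootList_codes c.nodup_levi
    (E := c.elimination) (fun pos => ?_) hm hW φ σ hdel hxdel
  cases pos
  · exact c.valid_negativeElimination
  · exact c.valid_positiveElimination
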